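/- Let $n\ge 2$. For $x\in\mathbf{R}$ let $P(x)$ be the unique integer $m$ with $m-\frac12<x\le m+\frac12$, and let $\pi:\mathbf{R}^n\to\mathbf{Z}^n$ be $P$ applied to each coordinate. The discretization of a matrix $A\in M_n(\mathbf{R})$ is the map $\widehat A:\mathbf{Z}^n\to\mathbf{Z}^n$, $\widehat A(x)=\pi(Ax)$. Put $B_R=\{x\in\mathbf{Z}^n : \|x\|_\infty\le R\}$. For a sequence $(A_k)_{k\ge1}$ of matrices in $SL_n(\mathbf{R})$ the rate of injectivity in time $k\ge 0$ is \[\tau^k(A_1,\dots,A_k)=\limsup_{R\to+\infty}\frac{\operatorname{Card}\big((\widehat{A_k}\circ\cdots\circ\widehat{A_1})(\mathbf{Z}^n)\cap B_R\big)}{\operatorname{Card}(B_R)}\] (the empty composition, for $k=0$, being the identity), and the asymptotic rate of injectivity is $\tau^\infty\big((A_k)_{k\ge 1}\big)=\lim_{k\to+\infty}\tau^k(A_1,\dots,A_k)$. Fix any norm $\|\cdot\|$ on $M_n(\mathbf{R})$, and let $\ell^\infty(SL_n(\mathbf{R}))$ be the space of bounded sequences $(A_k)_{k\ge1}$ of matrices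 in $SL_n(\mathbf{R})$, with the metric $\sup_{k\ge1}\|A_k-B_k\|$. A property is said to hold for a generic sequence if the set of sequences having it contains a countable intersection of dense open subsets of $\ell^\infty(SL_n(\mathbf{R}))$. Then: (1) For a generic sequence $(A_k)_{k\ge1}\in\ell^\infty(SL_n(\mathbf{R}))$, the limit $\tau^\infty\big((A_k)_{k\ge1}\big)$ exists and equals $0$, and moreover for every integer $\ell\ge1$ there exists $\lambda_\ell\in{]0,1[}$ such that for every integer $k\ge0$, \[\tau^{\ell k}(A_1,\dots,A_{\ell k})\le\lambda_\ell^k+\frac1\ell .\] (2) For every $\varepsilon>0$, there is a dense open subset of $\ell^\infty(SL_n(\mathbf{R}))$ on which the limit $\tau^\infty\big((A_k)_{k\ge1}\big)$ exists and is $<\varepsilon$. -/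

import Mathlib

open Filter Topology Set

noncomputable section

namespace LinDiscr

/-- The projection `P : ℝ → ℤ`: `P x` is the unique integer `k` with `k - 1/2 < x ≤ k + 1/2`
(see `proj_eq_iff`). -/
def proj (x : ℝ) : ℤ := ⌈x - 1 / 2⌉

theorem proj_eq_iff (x : ℝ) (k : ℤ) :
    proj x = k ↔ (k : ℝ) - 1 / 2 < x ∧ x ≤ (k : ℝ) + 1 / 2 := by
  unfold proj
  rw [Int.ceil_eq_iff]
  constructor <;> rintro ⟨h1, h2⟩ <;> constructor <;> linarith

/-- The projection `π : ℝⁿ → ℤⁿ`, coordinate by coordinate. -/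
def projVec {n : ℕ} (x : Fin n → ℝ) : Fin n → ℤ := fun i => proj (x i)

/-- The discretization `Â : ℤⁿ → ℤⁿ`, `x ↦ π (A x)`. -/
def discr {n : ℕ} (A : Matrix (Fin n) (Fin n) ℝ) (x : Fin n → ℤ) : Fin n → ℤ :=
  projVec (A.mulVec fun i => (x i : ℝ))

/-- `Â_k ∘ ⋯ ∘ Â_1`. Sequences are indexed from `0` in Lean: `A i` stands for `A_{i+1}`. -/
def discrIter {n : ℕ} (A : ℕ → Matrix (Fin n) (Fin n) ℝ) : ℕ → (Fin n → ℤ) → (Fin n → ℤ)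
  | 0 => id
  | k + 1 => discr (A k) ∘ discrIter A k

/-- The integer points `B_R` of the ball of centre `0` and radius `R` for the sup norm. -/
def intBall (n : ℕ) (R : ℝ) : Set (Fin n → ℤ) := {x | ∀ i, |(x i : ℝ)| ≤ R}

/-- The rate of injectivity `τ^k(A_1, …, A_k)`. -/
def rate {n : ℕ} (A : ℕ → Matrix (Fin n) (Fin n) ℝ) (k : ℕ) : ℝ :=
  limsup (fun R : ℝ =>
    ((range (discrIter A k) ∩ intBall n R).ncard : ℝ) / ((intBall n R).ncard : ℝ)) atTop

/-- The asymptotic rate of injectivity `τ^∞((A_k)_k) = lim_k τ^k(A_1, …, A_k)`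
exists and is equal to `t`. -/
def HasAsymptoticRate {n : ℕ} (A : ℕ → Matrix (Fin n) (Fin n) ℝ) (t : ℝ) : Prop :=
  Tendsto (fun k => rate A k) atTop (𝓝 t)

/-- The space `ℓ^∞(SL_n(ℝ))` of the sequences of matrices of determinant `1` that are bounded for
the norm `N`. -/
def EllInfSL {n : ℕ} (N : Seminorm ℝ (Matrix (Fin n) (Fin n) ℝ)) : Type :=
  {A : ℕ → Matrix.SpecialLinearGroup (Fin n) ℝ //
    ∃ C : ℝ, ∀ k, N (A k : Matrix (Fin n) (Fin n) ℝ) ≤ C}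

namespace EllInfSL

variable {n : ℕ} {N : Seminorm ℝ (Matrix (Fin n) (Fin n) ℝ)}

/-- The underlying sequence of matrices. -/
def mat (A : EllInfSL N) (k : ℕ) : Matrix (Fin n) (Fin n) ℝ := (A.1 k : Matrix (Fin n) (Fin n) ℝ)

theorem bddAbove_sub (A B : EllInfSL N) :
    BddAbove (range fun k => N (A.mat k - B.mat k)) := by
  obtain ⟨C, hC⟩ := A.2
  obtain ⟨D, hD⟩ := B.2
  refine ⟨C + D, ?_⟩
  rintro _ ⟨k, rfl⟩
  exact (map_sub_le_add N _ _).trans (add_le_add (hC k) (hD k))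

/-- The distance `sup_k N (A_k - B_k)`, which also gives the topology. -/
instance : PseudoMetricSpace (EllInfSL N) where
  dist A B := ⨆ k, N (A.mat k - B.mat k)
  dist_self A := by simp
  dist_comm A B := by simp only [map_sub_rev N]
  dist_triangle A B C := by
    refine ciSup_le fun k => ?_
    have h : A.mat k - C.mat k = (A.mat k - B.mat k) + (B.mat k - C.mat k) := by abel
    rw [h]
    exact (map_add_le_add N _ _).trans
      (add_le_add (le_ciSup (bddAbove_sub A B) k) (le_ciSup (bddAbove_sub B C) k))

end EllInfSL

end LinDiscr

end

noncomputable section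
namespace LinDiscr

open MeasureTheory

/-! ### Boxes and upper Banach density -/

/-- The integer points of the cube `∏ [z i, z i + L)`. -/
def box {n : ℕ} (z : Fin n → ℤ) (L : ℕ) : Finset (Fin n → ℤ) :=
  Fintype.piFinset fun i => Finset.Ico (z i) (z i + L)

theorem mem_box {n : ℕ} {z x : Fin n → ℤ} {L : ℕ} :
    x ∈ box z L ↔ ∀ i, z i ≤ x i ∧ x i < z i + L := by
  simp [box]

theorem card_box {n : ℕ} (z : Fin n → ℤ) (L : ℕ) : (box z L).card = L ^ n := by
  simp [box]

/-- The number of points of `Γ` in `box z L`. -/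
def cnt {n : ℕ} (Γ : Set (Fin n → ℤ)) (z : Fin n → ℤ) (L : ℕ) : ℕ :=
  (Γ ∩ (box z L : Set (Fin n → ℤ))).ncard

theorem cnt_mono {n : ℕ} {Γ Δ : Set (Fin n → ℤ)} (h : Γ ⊆ Δ) (z : Fin n → ℤ) (L : ℕ) :
    cnt Γ z L ≤ cnt Δ z L :=
  Set.ncard_le_ncard (inter_subset_inter_left _ h) ((Finset.finite_toSet _).inter_of_right _)

/-- The upper Banach density of `Γ` is at most `d`. -/
def UpperDensityLE {n : ℕ} (Γ : Set (Fin n → ℤ)) (d : ℝ) : Prop :=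
  ∀ ε : ℝ, 0 < ε → ∃ L₀ : ℕ, ∀ L : ℕ, L₀ ≤ L → ∀ z, (cnt Γ z L : ℝ) ≤ (d + ε) * (L : ℝ) ^ n

theorem abs_proj_sub_le (x : ℝ) : |x - proj x| ≤ 1 / 2 := by
  have h := (proj_eq_iff x (proj x)).1 rfl
  rw [abs_le]; constructor <;> linarith [h.1, h.2]

theorem norm_mulVec_sub_discr_le {n : ℕ} (A : Matrix (Fin n) (Fin n) ℝ) (x : Fin n → ℤ) :
    ‖A.mulVec (fun i => (x i : ℝ)) - fun i => (discr A x i : ℝ)‖ ≤ 1 / 2 := by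
  rw [pi_norm_le_iff_of_nonneg (by norm_num)]
  intro i
  simpa [discr, projVec] using abs_proj_sub_le ((A.mulVec fun i => (x i : ℝ)) i)

theorem discr_one {n : ℕ} (x : Fin n → ℤ) :
    discr (1 : Matrix (Fin n) (Fin n) ℝ) x = x := by
  ext i
  simp only [discr, projVec, Matrix.one_mulVec]
  rw [proj_eq_iff]
  constructor <;> linarith

theorem norm_mulVec_le_sum {n : ℕ} (A : Matrix (Fin n) (Fin n) ℝ) :
    ∃ C : ℝ, 0 ≤ C ∧ ∀ x : Fin n → ℝ, ‖A.mulVec x‖ ≤ C * ‖x‖ := by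
  refine ⟨∑ i, ∑ j, |A i j|, by positivity, fun x => ?_⟩
  rw [pi_norm_le_iff_of_nonneg (by positivity)]
  intro i
  rw [Matrix.mulVec, dotProduct, Real.norm_eq_abs]
  refine (Finset.abs_sum_le_sum_abs _ _).trans ?_
  calc ∑ j, |A i j * x j| ≤ ∑ j, |A i j| * ‖x‖ := by
        refine Finset.sum_le_sum fun j _ => ?_
        rw [abs_mul]
        exact mul_le_mul_of_nonneg_left (norm_le_pi_norm x j) (abs_nonneg _)
    _ = (∑ j, |A i j|) * ‖x‖ := by rw [Finset.sum_mul]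
    _ ≤ _ := by
        refine mul_le_mul_of_nonneg_right ?_ (norm_nonneg _)
        exact Finset.single_le_sum (f := fun i => ∑ j, |A i j|)
          (fun i _ => Finset.sum_nonneg fun j _ => abs_nonneg _) (Finset.mem_univ i)

theorem volume_preimage_mulVec {n : ℕ} {A : Matrix (Fin n) (Fin n) ℝ} (hA : A.det = 1)
    (s : Set (Fin n → ℝ)) : volume (A.mulVec ⁻¹' s) = volume s := by
  have h := Measure.addHaar_preimage_linearMap (volume : Measure (Fin n → ℝ))
    (f := Matrix.toLin' A) (by rw [LinearMap.det_toLin', hA]; exact one_ne_zero) s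
  rw [LinearMap.det_toLin', hA, inv_one, abs_one, ENNReal.ofReal_one, one_mul] at h
  exact h

/-- The real cube `∏ [b i * L, b i * L + L)`. -/
def realBlock {n : ℕ} (L : ℕ) (b : Fin n → ℤ) : Set (Fin n → ℝ) :=
  Set.univ.pi fun i => Ico ((b i : ℝ) * L) ((b i : ℝ) * L + L)

theorem card_mul_pow_le_volume {n : ℕ} {L : ℕ} (hL : 1 ≤ L) (𝓑 : Finset (Fin n → ℤ))
    (s : Set (Fin n → ℝ)) (h : ∀ b ∈ 𝓑, realBlock L b ⊆ s) :
    (𝓑.card : ENNReal) * (L : ENNReal) ^ n ≤ volume s := by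
  have hL' : (0 : ℝ) < L := by exact_mod_cast hL
  have hd : Set.PairwiseDisjoint (𝓑 : Set (Fin n → ℤ)) (realBlock L) := by
    intro b _ b' _ hbb
    rw [Function.onFun, Set.disjoint_left]
    intro x hx hx'
    apply hbb
    ext i
    have h1 := hx i (mem_univ i)
    have h2 := hx' i (mem_univ i)
    have h3 : (b i : ℝ) * L < ((b' i : ℝ) + 1) * L := by linarith [h1.1, h2.2]
    have h4 : (b' i : ℝ) * L < ((b i : ℝ) + 1) * L := by linarith [h1.2, h2.1]
    have h5 := lt_of_mul_lt_mul_right h3 hL'.le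
    have h6 := lt_of_mul_lt_mul_right h4 hL'.le
    norm_cast at h5 h6
    omega
  have hm : ∀ b ∈ 𝓑, MeasurableSet (realBlock L b) := fun b _ =>
    MeasurableSet.univ_pi fun i => measurableSet_Ico
  have hv : ∀ b : Fin n → ℤ, volume (realBlock L b) = (L : ENNReal) ^ n := by
    intro b
    rw [realBlock, volume_pi_pi]
    simp
  calc (𝓑.card : ENNReal) * (L : ENNReal) ^ n = ∑ b ∈ 𝓑, volume (realBlock L b) := by
        simp [hv]
    _ = volume (⋃ b ∈ 𝓑, realBlock L b) := (measure_biUnion_finset hd hm).symm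
    _ ≤ volume s := measure_mono (iUnion₂_subset h)

theorem cnt_image_discr_le {n : ℕ} {A : Matrix (Fin n) (Fin n) ℝ} (hA : A.det = 1)
    {Γ : Set (Fin n → ℤ)} {L D : ℕ} (hL : 1 ≤ L) (hD : ∀ z, cnt Γ z L ≤ D) :
    ∃ C : ℝ, 0 ≤ C ∧ ∀ (L' : ℕ) z,
      (cnt (discr A '' Γ) z L' : ℝ) * (L : ℝ) ^ n ≤ D * ((L' : ℝ) + C) ^ n := by
  classical
  obtain ⟨C₁, hC₁, hC⟩ := norm_mulVec_le_sum A
  refine ⟨2 * (C₁ * L + 1), by positivity, fun L' z => ?_⟩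
  have hL' : (0 : ℝ) < L := by exact_mod_cast hL
  have hLz : (0 : ℤ) < L := by exact_mod_cast hL
  set Y : Set (Fin n → ℤ) := discr A '' Γ ∩ (box z L' : Set (Fin n → ℤ)) with hY
  have hYf : Y.Finite := (Finset.finite_toSet _).inter_of_right _
  have hch : ∀ y : Fin n → ℤ, ∃ x, y ∈ Y → x ∈ Γ ∧ discr A x = y := by
    intro y
    by_cases h : y ∈ Y
    · obtain ⟨⟨x, hx, hxy⟩, _⟩ := h
      exact ⟨x, fun _ => ⟨hx, hxy⟩⟩
    · exact ⟨0, fun h' => absurd h' h⟩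
  choose f hf using hch
  set X : Finset (Fin n → ℤ) := hYf.toFinset.image f with hX
  have hcard : X.card = cnt (discr A '' Γ) z L' := by
    rw [hX, Finset.card_image_of_injOn, cnt, Set.ncard_eq_toFinset_card _ hYf]
    intro y hy y' hy' h
    rw [← (hf y (by simpa using hy)).2, ← (hf y' (by simpa using hy')).2, h]
  have hXm : ∀ x ∈ X, x ∈ Γ ∧ discr A x ∈ box z L' := by
    intro x hx
    obtain ⟨y, hy, rfl⟩ := Finset.mem_image.1 hx
    have hy' : y ∈ Y := by simpa using hy
    refine ⟨(hf y hy').1, ?_⟩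
    rw [(hf y hy').2]
    exact hy'.2
  set blk : (Fin n → ℤ) → (Fin n → ℤ) := fun x i => x i / L with hblk
  have hfib : ∀ b ∈ X.image blk, (X.filter fun x => blk x = b).card ≤ D := by
    intro b _
    refine le_trans ?_ (hD fun i => b i * L)
    rw [cnt, ← Set.ncard_coe_finset]
    refine Set.ncard_le_ncard ?_ ((Finset.finite_toSet _).inter_of_right _)
    intro x hx
    simp only [Finset.coe_filter, mem_ofPred_eq] at hx
    refine ⟨(hXm x hx.1).1, ?_⟩
    rw [Finset.mem_coe, mem_box]
    intro i
    have : x i / L = b i := congrFun hx.2 i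
    rw [← this]
    constructor
    · exact Int.ediv_mul_le _ hLz.ne'
    · have := Int.lt_ediv_add_one_mul_self (x i) hLz
      linarith
  have h1 := Finset.card_le_mul_card_image X D hfib
  have h2 := card_mul_pow_le_volume hL (X.image blk)
    (A.mulVec ⁻¹' (Set.univ.pi fun i => Icc ((z i : ℝ) - (C₁ * L + 1)) (z i + L' + (C₁ * L + 1))))
    (by
      intro b hb w hw
      obtain ⟨x, hx, rfl⟩ := Finset.mem_image.1 hb
      rw [mem_preimage]
      intro i _
      have hwx : ‖w - fun i => (x i : ℝ)‖ ≤ L := by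
        rw [pi_norm_le_iff_of_nonneg hL'.le]
        intro j
        have h1 := hw j (mem_univ j)
        have h2 : ((x j / L : ℤ) : ℝ) * L ≤ x j := by exact_mod_cast Int.ediv_mul_le _ hLz.ne'
        have h3 : (x j : ℝ) < ((x j / L : ℤ) : ℝ) * L + L := by
          have := Int.lt_ediv_add_one_mul_self (x j) hLz
          have h : x j < x j / L * L + L := by linarith
          exact_mod_cast h
        simp only [hblk] at h1
        rw [Pi.sub_apply, Real.norm_eq_abs, abs_le]
        constructor <;> linarith [h1.1, h1.2]
      have h3 : ‖A.mulVec w - A.mulVec fun i => (x i : ℝ)‖ ≤ C₁ * L := by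
        rw [← Matrix.mulVec_sub]
        exact (hC _).trans (mul_le_mul_of_nonneg_left hwx hC₁)
      have h4 := (norm_le_pi_norm _ i).trans h3
      have h5 := (norm_le_pi_norm _ i).trans (norm_mulVec_sub_discr_le A x)
      have h6 := mem_box.1 (hXm x hx).2 i
      have h7 : (z i : ℝ) ≤ discr A x i := by exact_mod_cast h6.1
      have h8 : (discr A x i : ℝ) < z i + L' := by exact_mod_cast h6.2
      rw [Pi.sub_apply, Real.norm_eq_abs, abs_le] at h4 h5
      constructor <;> linarith [h4.1, h4.2, h5.1, h5.2])
  rw [volume_preimage_mulVec hA, volume_pi_pi] at h2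
  have h3 : ((X.image blk).card : ℝ) * (L : ℝ) ^ n ≤ ((L' : ℝ) + 2 * (C₁ * L + 1)) ^ n := by
    have : ∀ i : Fin n, volume (Icc ((z i : ℝ) - (C₁ * L + 1)) (z i + L' + (C₁ * L + 1))) =
        ENNReal.ofReal ((L' : ℝ) + 2 * (C₁ * L + 1)) := by
      intro i
      rw [Real.volume_Icc]
      congr 1; ring
    simp only [this, Finset.prod_const, Finset.card_univ, Fintype.card_fin] at h2
    rw [← ENNReal.ofReal_pow (by positivity)] at h2
    have h4 := ENNReal.toReal_mono ENNReal.ofReal_ne_top h2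
    rw [ENNReal.toReal_ofReal (by positivity)] at h4
    simpa using h4
  have h1' : (X.card : ℝ) ≤ D * (X.image blk).card := by exact_mod_cast h1
  rw [← hcard]
  calc (X.card : ℝ) * (L : ℝ) ^ n ≤ D * (X.image blk).card * (L : ℝ) ^ n := by gcongr
    _ = D * ((X.image blk).card * (L : ℝ) ^ n) := by ring
    _ ≤ _ := by gcongr

theorem upperDensityLE_image_of_cnt_le {n : ℕ} {A : Matrix (Fin n) (Fin n) ℝ} (hA : A.det = 1)
    {Γ : Set (Fin n → ℤ)} {L D : ℕ} (hL : 1 ≤ L) (hD : ∀ z, cnt Γ z L ≤ D) {d : ℝ}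
    (hd : (D : ℝ) ≤ d * (L : ℝ) ^ n) : UpperDensityLE (discr A '' Γ) d := by
  obtain ⟨C, hC, h⟩ := cnt_image_discr_le hA hL hD
  intro ε hε
  have hL' : (0 : ℝ) < (L : ℝ) ^ n := by
    have : (0 : ℝ) < L := by exact_mod_cast hL
    positivity
  have ht : Tendsto (fun L' : ℕ => d * (1 + C / (L' : ℝ)) ^ n) atTop (𝓝 (d * (1 + 0) ^ n)) :=
    ((tendsto_const_nhds.add (tendsto_const_nhds.div_atTop tendsto_natCast_atTop_atTop)).pow
      n).const_mul d
  simp only [add_zero, one_pow, mul_one] at ht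
  have hev := (ht.eventually (gt_mem_nhds (show d < d + ε by linarith))).and (eventually_ge_atTop 1)
  obtain ⟨L₀, hL₀⟩ := eventually_atTop.1 hev
  refine ⟨L₀, fun L' hL'' z => ?_⟩
  obtain ⟨h1, h2⟩ := hL₀ L' hL''
  have h2' : (0 : ℝ) < L' := by exact_mod_cast h2
  have h3 : (cnt (discr A '' Γ) z L' : ℝ) * (L : ℝ) ^ n ≤
      d * ((L' : ℝ) + C) ^ n * (L : ℝ) ^ n := by
    refine (h L' z).trans ?_
    calc _ ≤ d * (L : ℝ) ^ n * ((L' : ℝ) + C) ^ n := by gcongr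
      _ = _ := by ring
  have h4 := le_of_mul_le_mul_right h3 hL'
  refine h4.trans ?_
  have h5 : ((L' : ℝ) + C) ^ n = (1 + C / L') ^ n * (L' : ℝ) ^ n := by
    rw [← mul_pow]; congr 1; field_simp
  rw [h5, ← mul_assoc]
  gcongr

theorem upperDensityLE_of_cnt_le {n : ℕ} {Γ : Set (Fin n → ℤ)} {L : ℕ} (hL : 1 ≤ L) {d : ℝ}
    (hd : ∀ z, (cnt Γ z L : ℝ) ≤ d * (L : ℝ) ^ n) : UpperDensityLE Γ d := by
  have h0 : 0 ≤ d * (L : ℝ) ^ n := (Nat.cast_nonneg _).trans (hd 0)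
  have h := upperDensityLE_image_of_cnt_le (A := (1 : Matrix (Fin n) (Fin n) ℝ)) (Γ := Γ)
    Matrix.det_one hL (D := ⌊d * (L : ℝ) ^ n⌋₊) (fun z => Nat.le_floor (hd z))
    (Nat.floor_le h0)
  have : discr (1 : Matrix (Fin n) (Fin n) ℝ) '' Γ = Γ := by
    simp [Set.image, discr_one]
  rwa [this] at h

theorem upperDensityLE_of_forall {n : ℕ} {Γ : Set (Fin n → ℤ)} {d : ℝ}
    (h : ∀ ε : ℝ, 0 < ε → UpperDensityLE Γ (d + ε)) : UpperDensityLE Γ d := by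
  intro ε hε
  obtain ⟨L₀, h0⟩ := h (ε / 2) (by positivity) (ε / 2) (by positivity)
  refine ⟨L₀, fun L hL z => (h0 L hL z).trans (le_of_eq ?_)⟩
  ring

theorem UpperDensityLE.image_discr {n : ℕ} {Γ : Set (Fin n → ℤ)} {d : ℝ}
    (h : UpperDensityLE Γ d) {A : Matrix (Fin n) (Fin n) ℝ} (hA : A.det = 1) :
    UpperDensityLE (discr A '' Γ) d := by
  refine upperDensityLE_of_forall fun ε hε => ?_
  obtain ⟨L₀, h0⟩ := h ε hε
  have h1 := h0 (max L₀ 1) (le_max_left _ _)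
  have hn : 0 ≤ (d + ε) * ((max L₀ 1 : ℕ) : ℝ) ^ n := (Nat.cast_nonneg _).trans (h1 0)
  exact upperDensityLE_image_of_cnt_le hA (le_max_right _ _) (fun z => Nat.le_floor (h1 z))
    (Nat.floor_le hn)

theorem intBall_eq_box {n : ℕ} {R : ℝ} (hR : 0 ≤ R) :
    intBall n R =
      ((box (fun _ : Fin n => -(⌊R⌋₊ : ℤ)) (2 * ⌊R⌋₊ + 1) : Finset _) : Set (Fin n → ℤ)) := by
  ext x
  rw [Finset.mem_coe, mem_box]
  refine forall_congr' fun i => ?_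
  have h1 : |(x i : ℝ)| ≤ R ↔ (x i).natAbs ≤ ⌊R⌋₊ := by
    rw [Nat.le_floor_iff hR, Nat.cast_natAbs, Int.cast_abs]
  rw [h1]
  omega

theorem ratio_nonneg_le_one {n : ℕ} (Γ : Set (Fin n → ℤ)) (R : ℝ) :
    0 ≤ ((Γ ∩ intBall n R).ncard : ℝ) / ((intBall n R).ncard : ℝ) ∧
    ((Γ ∩ intBall n R).ncard : ℝ) / ((intBall n R).ncard : ℝ) ≤ 1 := by
  refine ⟨by positivity, div_le_one_of_le₀ ?_ (by positivity)⟩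
  by_cases hR : 0 ≤ R
  · rw [intBall_eq_box hR]
    exact_mod_cast Set.ncard_le_ncard inter_subset_right (Finset.finite_toSet _)
  · rcases (intBall n R).eq_empty_or_nonempty with h | ⟨x, hx⟩
    · simp [h]
    · rcases Nat.eq_zero_or_pos n with rfl | hn
      · exact_mod_cast Set.ncard_le_ncard inter_subset_right (Set.toFinite _)
      · exact absurd ((abs_nonneg _).trans (hx ⟨0, hn⟩)) hR

theorem ratio_eq_cnt {n : ℕ} (Γ : Set (Fin n → ℤ)) {R : ℝ} (hR : 0 ≤ R) :
    ((Γ ∩ intBall n R).ncard : ℝ) / ((intBall n R).ncard : ℝ) =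
      (cnt Γ (fun _ => -(⌊R⌋₊ : ℤ)) (2 * ⌊R⌋₊ + 1) : ℝ) / ((2 * ⌊R⌋₊ + 1 : ℕ) : ℝ) ^ n := by
  rw [intBall_eq_box hR, cnt, Set.ncard_coe_finset, card_box]
  push_cast
  rfl

theorem rate_le_one {n : ℕ} (A : ℕ → Matrix (Fin n) (Fin n) ℝ) (k : ℕ) : rate A k ≤ 1 :=
  limsup_le_of_le ((isBoundedUnder_of ⟨0, fun R => (ratio_nonneg_le_one _ R).1⟩ :
    IsBoundedUnder (· ≥ ·) _ _).isCoboundedUnder_flip)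
    (Eventually.of_forall fun R => (ratio_nonneg_le_one _ R).2)

theorem rate_nonneg {n : ℕ} (A : ℕ → Matrix (Fin n) (Fin n) ℝ) (k : ℕ) : 0 ≤ rate A k :=
  le_limsup_of_frequently_le (Frequently.of_forall fun R => (ratio_nonneg_le_one _ R).1)
    (isBoundedUnder_of ⟨1, fun R => (ratio_nonneg_le_one _ R).2⟩)

theorem tendsto_two_mul_floor : Tendsto (fun R : ℝ => 2 * ⌊R⌋₊ + 1) atTop atTop :=
  tendsto_atTop_mono (fun R => by omega) (tendsto_nat_floor_atTop (α := ℝ))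

theorem rate_le_of_upperDensityLE {n : ℕ} {A : ℕ → Matrix (Fin n) (Fin n) ℝ} {k : ℕ} {d : ℝ}
    (h : UpperDensityLE (range (discrIter A k)) d) : rate A k ≤ d := by
  refine le_of_forall_pos_le_add fun ε hε => ?_
  obtain ⟨L₀, h0⟩ := h ε hε
  refine limsup_le_of_le ((isBoundedUnder_of ⟨0, fun R => (ratio_nonneg_le_one _ R).1⟩ :
    IsBoundedUnder (· ≥ ·) _ _).isCoboundedUnder_flip) ?_
  filter_upwards [eventually_ge_atTop 0, tendsto_two_mul_floor.eventually_ge_atTop L₀] with R hR hL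
  rw [ratio_eq_cnt _ hR, div_le_iff₀ (by positivity)]
  exact h0 _ hL _

/-- If counts in boxes depend little on the position of the box, then the rate bounds the upper
Banach density. -/
theorem upperDensityLE_rate {n : ℕ} {A : ℕ → Matrix (Fin n) (Fin n) ℝ} {k : ℕ}
    (h : ∀ ε : ℝ, 0 < ε → ∃ L₀ : ℕ, ∀ L, L₀ ≤ L → ∀ z z',
      (cnt (range (discrIter A k)) z L : ℝ) ≤
        cnt (range (discrIter A k)) z' L + ε * (L : ℝ) ^ n) :
    UpperDensityLE (range (discrIter A k)) (rate A k) := by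
  refine upperDensityLE_of_forall fun ε hε => ?_
  obtain ⟨L₀, h0⟩ := h (ε / 2) (by positivity)
  have h1 : ∀ᶠ R : ℝ in atTop, ((range (discrIter A k) ∩ intBall n R).ncard : ℝ) /
      ((intBall n R).ncard : ℝ) < rate A k + ε / 2 :=
    eventually_lt_of_limsup_lt (by unfold rate; linarith)
      (isBoundedUnder_of ⟨1, fun R => (ratio_nonneg_le_one _ R).2⟩)
  obtain ⟨R, hR, hR0, hL⟩ := (h1.and ((eventually_ge_atTop 0).and
    (tendsto_two_mul_floor.eventually_ge_atTop L₀))).exists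
  rw [ratio_eq_cnt _ hR0, div_lt_iff₀ (by positivity)] at hR
  refine upperDensityLE_of_cnt_le (L := 2 * ⌊R⌋₊ + 1) (by omega) fun z => ?_
  have := h0 _ hL z (fun _ => -(⌊R⌋₊ : ℤ))
  linarith

end LinDiscr
end

noncomputable section
namespace LinDiscr

/-! ### Almost periodicity of the images -/

theorem UpperDensityLE.union {n : ℕ} {Γ Δ : Set (Fin n → ℤ)} {d e : ℝ}
    (h : UpperDensityLE Γ d) (h' : UpperDensityLE Δ e) : UpperDensityLE (Γ ∪ Δ) (d + e) := by
  intro ε hε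
  obtain ⟨L₁, h1⟩ := h (ε / 2) (by positivity)
  obtain ⟨L₂, h2⟩ := h' (ε / 2) (by positivity)
  refine ⟨max L₁ L₂, fun L hL z => ?_⟩
  have h3 := h1 L (le_of_max_le_left hL) z
  have h4 := h2 L (le_of_max_le_right hL) z
  have h5 : cnt (Γ ∪ Δ) z L ≤ cnt Γ z L + cnt Δ z L := by
    unfold cnt
    rw [union_inter_distrib_right]
    exact Set.ncard_union_le _ _
  have h6 : (cnt (Γ ∪ Δ) z L : ℝ) ≤ cnt Γ z L + cnt Δ z L := by exact_mod_cast h5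
  linarith

theorem upperDensityLE_empty {n : ℕ} : UpperDensityLE (∅ : Set (Fin n → ℤ)) 0 := by
  intro ε hε
  refine ⟨0, fun L _ z => ?_⟩
  simp only [cnt, empty_inter, Set.ncard_empty, Nat.cast_zero]
  positivity

theorem UpperDensityLE.mono {n : ℕ} {Γ Δ : Set (Fin n → ℤ)} {d e : ℝ}
    (h : UpperDensityLE Δ d) (hs : Γ ⊆ Δ) (hd : d ≤ e) : UpperDensityLE Γ e := by
  intro ε hε
  obtain ⟨L₀, h0⟩ := h ε hε
  refine ⟨L₀, fun L hL z => ?_⟩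
  have h1 : (cnt Γ z L : ℝ) ≤ cnt Δ z L := by exact_mod_cast cnt_mono hs z L
  refine h1.trans ((h0 L hL z).trans ?_)
  gcongr

theorem upperDensityLE_biUnion {n : ℕ} {ι : Type*} (s : Finset ι) {Γ : ι → Set (Fin n → ℤ)} {d : ℝ}
    (h : ∀ i ∈ s, UpperDensityLE (Γ i) d) :
    UpperDensityLE (⋃ i ∈ s, Γ i) (s.card * d) := by
  classical
  induction s using Finset.induction_on with
  | empty => simpa using upperDensityLE_empty
  | insert a s ha ih =>
    rw [Finset.set_biUnion_insert, Finset.card_insert_of_notMem ha]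
    refine ((h a (Finset.mem_insert_self _ _)).union
      (ih fun i hi => h i (Finset.mem_insert_of_mem hi))).mono subset_rfl (le_of_eq ?_)
    push_cast; ring

/-- The rounding residue of the discretization. -/
def residue {n : ℕ} (A : Matrix (Fin n) (Fin n) ℝ) (x : Fin n → ℤ) : Fin n → ℝ :=
  (A.mulVec fun i => (x i : ℝ)) - fun i => (discr A x i : ℝ)

theorem residue_bounds {n : ℕ} (A : Matrix (Fin n) (Fin n) ℝ) (x : Fin n → ℤ) (i : Fin n) :
    -(1 / 2) < residue A x i ∧ residue A x i ≤ 1 / 2 := by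
  have h := (proj_eq_iff ((A.mulVec fun i => (x i : ℝ)) i) (discr A x i)).1 rfl
  simp only [residue, Pi.sub_apply]
  constructor <;> linarith [h.1, h.2]

theorem discr_eq_of_residue {n : ℕ} {A : Matrix (Fin n) (Fin n) ℝ} {x y : Fin n → ℤ}
    (h : ∀ i, -(1 / 2) < (A.mulVec fun i => (x i : ℝ)) i - y i ∧
      (A.mulVec fun i => (x i : ℝ)) i - y i ≤ 1 / 2) : discr A x = y := by
  ext i
  refine (proj_eq_iff _ _).2 ?_
  constructor <;> linarith [(h i).1, (h i).2]

/-- The points whose residue in the coordinate `i` is within `δ` of the discontinuity. -/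
def nearJump {n : ℕ} (A : Matrix (Fin n) (Fin n) ℝ) (i : Fin n) (δ : ℝ) : Set (Fin n → ℤ) :=
  {v | 1 / 2 - δ ≤ |residue A v i|}

theorem exists_pos_le_abs_sub_int {a : ℝ} (ha : Irrational a) (T : ℕ) :
    ∃ δ : ℝ, 0 < δ ∧ ∀ t : ℤ, 0 < |t| → |t| < T → ∀ m : ℤ, δ ≤ |a * t - m| := by
  have hfin : ∀ t : ℤ, ∃ δ : ℝ, 0 < δ ∧ (t ≠ 0 → ∀ m : ℤ, δ ≤ |a * t - m|) := by
    intro t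
    by_cases ht : t = 0
    · exact ⟨1, one_pos, fun h => absurd ht h⟩
    · refine ⟨|a * t - round (a * t)|, ?_, fun _ m => round_le _ _⟩
      rw [abs_pos]
      have h1 : Irrational (a * t) := ha.mul_intCast ht
      exact sub_ne_zero.2 (h1.ne_int _)
  choose f hf hf' using hfin
  have hne : (Finset.Icc (-(T : ℤ)) T).Nonempty := ⟨0, by simp⟩
  refine ⟨(Finset.Icc (-(T : ℤ)) T).inf' hne f, (Finset.lt_inf'_iff hne).2 fun t _ => hf t, ?_⟩
  · intro t ht hT m
    refine (Finset.inf'_le f ?_).trans (hf' t (abs_pos.1 ht) m)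
    rw [abs_lt] at hT
    simp only [Finset.mem_Icc]
    omega

theorem upperDensityLE_nearJump {n : ℕ} (A : Matrix (Fin n) (Fin n) ℝ) (i i' : Fin n)
    (h : Irrational (A i i')) {ε : ℝ} (hε : 0 < ε) :
    ∃ δ : ℝ, 0 < δ ∧ UpperDensityLE (nearJump A i δ) ε := by
  classical
  obtain ⟨T, hT⟩ := exists_nat_ge (1 / ε)
  have hT1 : 1 ≤ T := by
    by_contra hT0
    have : T = 0 := by omega
    rw [this] at hT
    have : 0 < 1 / ε := by positivity
    norm_num at hT; linarith
  obtain ⟨δ, hδ, hδ'⟩ := exists_pos_le_abs_sub_int h T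
  refine ⟨δ / 4, by positivity, upperDensityLE_of_cnt_le hT1 fun z => ?_⟩
  set P : Finset (Fin n → ℤ) := Fintype.piFinset
    (Function.update (fun i => Finset.Ico (z i) (z i + T)) i' {z i'}) with hP
  have hPc : (P.card : ℝ) * T = (T : ℝ) ^ n := by
    rw [hP, Fintype.card_piFinset]
    have : ∀ j, (Function.update (fun i => Finset.Ico (z i) (z i + T)) i' {z i'} j).card =
        Function.update (fun _ : Fin n => T) i' 1 j := by
      intro j
      by_cases hj : j = i'
      · subst hj; simp
      · simp [hj]
    simp only [this]
    rw [Finset.prod_update_of_mem (Finset.mem_univ _)]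
    simp only [Finset.prod_const, one_mul]
    have h2 : (Finset.univ \ {i'} : Finset (Fin n)).card + 1 = n := by
      rw [Finset.card_sdiff_of_subset (Finset.subset_univ _)]
      have := i'.pos
      simp only [Finset.card_univ, Fintype.card_fin, Finset.card_singleton]
      omega
    push_cast
    rw [← pow_succ, h2]
  have hle : cnt (nearJump A i (δ / 4)) z T ≤ P.card := by
    rw [cnt, ← Set.ncard_coe_finset P]
    refine Set.ncard_le_ncard_of_injOn (fun v => Function.update v i' (z i')) ?_ ?_
      (Finset.finite_toSet _)
    · intro v hv
      have hv2 := mem_box.1 hv.2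
      rw [Finset.mem_coe, hP, Fintype.mem_piFinset]
      intro j
      by_cases hj : j = i'
      · subst hj; simp
      · simp [hj, hv2 j]
    · intro v hv w hw hvw
      have hne : ∀ j, j ≠ i' → v j = w j := by
        intro j hj
        simpa [hj] using congrFun hvw j
      by_contra hne'
      have hi : v i' ≠ w i' := by
        intro h
        apply hne'
        ext j
        by_cases hj : j = i'
        · rw [hj, h]
        · exact hne j hj
      have hv2 := mem_box.1 hv.2 i'
      have hw2 := mem_box.1 hw.2 i'
      have hlin : (A.mulVec fun i => (v i : ℝ)) i - (A.mulVec fun i => (w i : ℝ)) i =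
          A i i' * ((v i' - w i' : ℤ) : ℝ) := by
        simp only [Matrix.mulVec, dotProduct]
        rw [← Finset.sum_sub_distrib, Finset.sum_eq_single i']
        · push_cast; ring
        · intro j _ hj
          rw [hne j hj]; ring
        · simp
      have hb := hδ' (v i' - w i') (abs_pos.2 (sub_ne_zero.2 hi)) (by rw [abs_lt]; omega)
      have h1 : 1 / 2 - δ / 4 ≤ |residue A v i| := hv.1
      have h2 : 1 / 2 - δ / 4 ≤ |residue A w i| := hw.1
      have b1 := residue_bounds A v i
      have b2 := residue_bounds A w i
      have e : A i i' * ((v i' - w i' : ℤ) : ℝ) = residue A v i - residue A w i +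
          ((discr A v i - discr A w i : ℤ) : ℝ) := by
        rw [← hlin]; simp only [residue, Pi.sub_apply]; push_cast; ring
      rcases le_abs.1 h1 with c1 | c1 <;> rcases le_abs.1 h2 with c2 | c2
      · have := hb (discr A v i - discr A w i)
        rw [e] at this
        rcases le_abs.1 this with c | c <;> linarith [b1.1, b1.2, b2.1, b2.2]
      · have := hb (discr A v i - discr A w i + 1)
        rw [e, Int.cast_add, Int.cast_one] at this
        rcases le_abs.1 this with c | c <;> linarith [b1.1, b1.2, b2.1, b2.2]
      · have := hb (discr A v i - discr A w i - 1)
        rw [e, Int.cast_sub _ 1, Int.cast_one] at this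
        rcases le_abs.1 this with c | c <;> linarith [b1.1, b1.2, b2.1, b2.2]
      · have := hb (discr A v i - discr A w i)
        rw [e] at this
        rcases le_abs.1 this with c | c <;> linarith [b1.1, b1.2, b2.1, b2.2]
  have hTpos : (0 : ℝ) < T := by exact_mod_cast hT1
  have h1 : 1 ≤ ε * T := by
    rw [div_le_iff₀ hε] at hT
    linarith
  calc (cnt (nearJump A i (δ / 4)) z T : ℝ) ≤ P.card := by exact_mod_cast hle
    _ ≤ P.card * (ε * T) := le_mul_of_one_le_right (by positivity) h1
    _ = ε * (P.card * T) := by ring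
    _ = _ := by rw [hPc]

theorem residue_eq_of_close {n : ℕ} (A : Matrix (Fin n) (Fin n) ℝ) (i : Fin n)
    (h : ∀ i', ¬ Irrational (A i i')) :
    ∃ δ : ℝ, 0 < δ ∧ ∀ v w : Fin n → ℤ, |residue A v i - residue A w i| < δ →
      residue A v i = residue A w i := by
  have h' : ∀ i', ∃ q : ℚ, (q : ℝ) = A i i' := fun i' => by
    have := h i'
    rw [Irrational, not_not] at this
    exact this
  choose q hq using h'
  set D : ℕ := ∏ j, (q j).den with hD
  have hD0 : (0 : ℝ) < D := by
    exact_mod_cast Finset.prod_pos fun j _ => (q j).den_pos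
  have hint : ∀ v : Fin n → ℤ, ∃ m : ℤ, residue A v i * D = m := by
    intro v
    have h1 : ∀ j, ∃ m : ℤ, A i j * D = m := by
      intro j
      obtain ⟨e, he⟩ : (q j).den ∣ D := Finset.dvd_prod_of_mem _ (Finset.mem_univ j)
      refine ⟨(q j).num * e, ?_⟩
      rw [← hq j, he]
      have : (q j : ℝ) * (q j).den = (q j).num := by exact_mod_cast Rat.mul_den_eq_num (q j)
      push_cast
      rw [← mul_assoc, this]
    choose m hm using h1
    refine ⟨∑ j, m j * v j - discr A v i * D, ?_⟩
    simp only [residue, Pi.sub_apply, Matrix.mulVec, dotProduct]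
    push_cast
    rw [sub_mul, Finset.sum_mul]
    congr 1
    refine Finset.sum_congr rfl fun j _ => ?_
    rw [← hm j]; ring
  refine ⟨1 / D, by positivity, fun v w hvw => ?_⟩
  obtain ⟨a, ha⟩ := hint v
  obtain ⟨b, hb⟩ := hint w
  rw [lt_div_iff₀ hD0, ← abs_of_pos hD0, ← abs_mul, sub_mul, ha, hb] at hvw
  have : |a - b| < 1 := by exact_mod_cast hvw
  have hab : a = b := by
    rw [Int.abs_lt_one_iff] at this
    omega
  rw [hab, ← hb] at ha
  exact mul_right_cancel₀ hD0.ne' ha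

theorem exists_exceptional_step {n : ℕ} (A : Matrix (Fin n) (Fin n) ℝ) {ε : ℝ} (hε : 0 < ε) :
    ∃ (B : Set (Fin n → ℤ)) (δ : ℝ), 0 < δ ∧ UpperDensityLE B ε ∧
      ∀ x x' u : Fin n → ℤ, ‖residue A x - residue A x'‖ < δ → u ∉ B →
        discr A (u + x - x') = discr A u + discr A x - discr A x' := by
  have hstep : ∀ i : Fin n, ∃ δ : ℝ, 0 < δ ∧ ∃ B, UpperDensityLE B (ε / (n + 1)) ∧
      ∀ x x' u : Fin n → ℤ, |residue A x i - residue A x' i| < δ → u ∉ B →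
        -(1 / 2) < residue A u i + (residue A x i - residue A x' i) ∧
          residue A u i + (residue A x i - residue A x' i) ≤ 1 / 2 := by
    intro i
    by_cases h : ∃ i', Irrational (A i i')
    · obtain ⟨i', h⟩ := h
      obtain ⟨δ, hδ, hB⟩ := upperDensityLE_nearJump A i i' h (ε := ε / (n + 1)) (by positivity)
      refine ⟨δ, hδ, _, hB, fun x x' u hx hu => ?_⟩
      have hu' : |residue A u i| < 1 / 2 - δ := not_le.1 hu
      rw [abs_lt] at hx hu'
      constructor <;> linarith [hx.1, hx.2, hu'.1, hu'.2]
    · push Not at h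
      obtain ⟨δ, hδ, hB⟩ := residue_eq_of_close A i h
      refine ⟨δ, hδ, ∅, upperDensityLE_empty.mono subset_rfl (by positivity),
        fun x x' u hx _ => ?_⟩
      rw [hB _ _ hx, sub_self, add_zero]
      exact residue_bounds A u i
  choose δ hδ B hB hstep using hstep
  obtain ⟨d, hd, hd'⟩ : ∃ d : ℝ, 0 < d ∧ ∀ i, d ≤ δ i := by
    rcases isEmpty_or_nonempty (Fin n) with h | h
    · exact ⟨1, one_pos, fun i => isEmptyElim i⟩
    · refine ⟨Finset.univ.inf' Finset.univ_nonempty δ, ?_, fun i =>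
        Finset.inf'_le _ (Finset.mem_univ i)⟩
      rw [Finset.lt_inf'_iff]
      exact fun i _ => hδ i
  refine ⟨⋃ i ∈ (Finset.univ : Finset (Fin n)), B i, d, hd, ?_, ?_⟩
  · refine (upperDensityLE_biUnion Finset.univ fun i _ => hB i).mono subset_rfl ?_
    rw [Finset.card_univ, Fintype.card_fin, mul_div_assoc', div_le_iff₀ (by positivity)]
    linarith
  · intro x x' u hx hu
    refine discr_eq_of_residue fun i => ?_
    have hu' : u ∉ B i := fun h => hu (mem_biUnion (Finset.mem_coe.2 (Finset.mem_univ i)) h)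
    have hx' : |residue A x i - residue A x' i| < δ i :=
      ((norm_le_pi_norm (residue A x - residue A x') i).trans_lt hx).trans_le (hd' i)
    have h := hstep i x x' u hx' hu'
    have e : (A.mulVec fun i => ((u + x - x') i : ℝ)) i -
        ((discr A u + discr A x - discr A x') i : ℤ) =
        residue A u i + (residue A x i - residue A x' i) := by
      have : (fun i => ((u + x - x') i : ℝ)) =
          (fun i => (u i : ℝ)) + (fun i => (x i : ℝ)) - fun i => (x' i : ℝ) := by
        ext i; simp
      rw [this, Matrix.mulVec_sub, Matrix.mulVec_add]
      simp only [residue, Pi.sub_apply, Pi.add_apply]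
      push_cast; ring
    rw [e]
    exact h

theorem exists_exceptional_iter {n : ℕ} (A : ℕ → Matrix (Fin n) (Fin n) ℝ)
    (hA : ∀ j, (A j).det = 1) (k : ℕ) {ε : ℝ} (hε : 0 < ε) :
    ∃ (B : Set (Fin n → ℤ)) (δ : ℝ), 0 < δ ∧ UpperDensityLE B ε ∧
      ∀ x x' u : Fin n → ℤ, (∀ j < k, ‖residue (A j) (discrIter A j x) -
        residue (A j) (discrIter A j x')‖ < δ) → discrIter A k u ∉ B →
        discrIter A k (u + x - x') = discrIter A k u + discrIter A k x - discrIter A k x' := by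
  induction k generalizing ε with
  | zero => exact ⟨∅, 1, one_pos, upperDensityLE_empty.mono subset_rfl hε.le,
      fun x x' u _ _ => rfl⟩
  | succ k ih =>
    obtain ⟨B₁, δ₁, hδ₁, hB₁, h1⟩ := ih (ε := ε / 2) (by positivity)
    obtain ⟨B₂, δ₂, hδ₂, hB₂, h2⟩ := exists_exceptional_step (A k) (ε := ε / 2) (by positivity)
    refine ⟨discr (A k) '' (B₁ ∪ B₂), min δ₁ δ₂, lt_min hδ₁ hδ₂,
      ((hB₁.union hB₂).image_discr (hA k)).mono subset_rfl (by linarith), ?_⟩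
    intro x x' u hx hu
    have hu1 : discrIter A k u ∉ B₁ ∪ B₂ := fun h => hu ⟨_, h, rfl⟩
    rw [mem_union, not_or] at hu1
    have h3 := h1 x x' u (fun j hj => (hx j (by omega)).trans_le (min_le_left _ _)) hu1.1
    show discr (A k) (discrIter A k _) = _
    rw [h3]
    exact h2 _ _ _ ((hx k (by omega)).trans_le (min_le_right _ _)) hu1.2

theorem exists_discrIter_near {n : ℕ} (A : ℕ → Matrix (Fin n) (Fin n) ℝ)
    (hA : ∀ j, (A j).det = 1) (k : ℕ) :
    ∃ C : ℝ, 0 ≤ C ∧ ∀ d : Fin n → ℤ, ∃ x,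
      ‖(fun i => (discrIter A k x i : ℝ)) - fun i => (d i : ℝ)‖ ≤ C := by
  induction k with
  | zero => exact ⟨0, le_rfl, fun d => ⟨d, by simp [discrIter]⟩⟩
  | succ k ih =>
    obtain ⟨C, hC, ih⟩ := ih
    obtain ⟨C₁, hC₁, h1⟩ := norm_mulVec_le_sum (A k)
    refine ⟨C₁ * (C + 1 / 2) + 1 / 2, by positivity, fun d => ?_⟩
    set v : Fin n → ℝ := (A k)⁻¹.mulVec fun i => (d i : ℝ) with hv
    obtain ⟨x, hx⟩ := ih (projVec v)
    refine ⟨x, ?_⟩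
    have hAv : (A k).mulVec v = fun i => (d i : ℝ) := by
      rw [hv, Matrix.mulVec_mulVec, Matrix.mul_nonsing_inv _ (by rw [hA k]; exact isUnit_one),
        Matrix.one_mulVec]
    have h2 : ‖v - fun i => (projVec v i : ℝ)‖ ≤ 1 / 2 := by
      rw [pi_norm_le_iff_of_nonneg (by norm_num)]
      exact fun i => abs_proj_sub_le (v i)
    have h3 := norm_mulVec_sub_discr_le (A k) (discrIter A k x)
    set u : Fin n → ℝ := fun i => (discrIter A k x i : ℝ) with hu
    have h4 : ‖u - v‖ ≤ C + 1 / 2 := by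
      have : u - v = (u - fun i => (projVec v i : ℝ)) - (v - fun i => (projVec v i : ℝ)) := by abel
      rw [this]
      exact (norm_sub_le _ _).trans (add_le_add hx h2)
    have h5 : ‖(A k).mulVec u - fun i => (d i : ℝ)‖ ≤ C₁ * (C + 1 / 2) := by
      rw [← hAv, ← Matrix.mulVec_sub]
      exact (h1 _).trans (by gcongr)
    have e : (fun i => (discrIter A (k + 1) x i : ℝ)) - (fun i => (d i : ℝ)) =
        ((A k).mulVec u - fun i => (d i : ℝ)) -
          ((A k).mulVec u - fun i => (discr (A k) (discrIter A k x) i : ℝ)) := by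
      rw [sub_sub_sub_cancel_left]; rfl
    rw [e]
    exact (norm_sub_le _ _).trans (add_le_add h5 h3)

theorem cnt_le_cnt_add {n : ℕ} (Γ : Set (Fin n → ℤ)) (a b : Fin n → ℤ) (L T : ℕ) (hT : T ≤ L)
    (hab : ∀ i, |a i - b i| ≤ T) : (cnt Γ a L : ℝ) ≤ cnt Γ b L + ((L : ℝ) ^ n - ((L : ℝ) - T) ^ n) := by
  have hsub : box (fun i => max (a i) (b i)) (L - T) ⊆ box a L := by
    intro x hx
    rw [mem_box] at hx ⊢
    intro i
    have h1 := hx i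
    have h2 := abs_le.1 (hab i)
    omega
  have hsub' : Γ ∩ (box a L : Set (Fin n → ℤ)) ⊆ (Γ ∩ (box b L : Set (Fin n → ℤ))) ∪
      ((box a L \ box (fun i => max (a i) (b i)) (L - T) : Finset _) : Set (Fin n → ℤ)) := by
    rintro x ⟨hx, hxa⟩
    by_cases h : x ∈ box (fun i => max (a i) (b i)) (L - T)
    · left
      refine ⟨hx, ?_⟩
      rw [Finset.mem_coe, mem_box] at *
      intro i
      have h1 := h i
      have h2 := abs_le.1 (hab i)
      omega
    · right
      rw [Finset.mem_coe, Finset.mem_sdiff]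
      exact ⟨hxa, h⟩
  have h1 := Set.ncard_le_ncard hsub' (((Finset.finite_toSet _).inter_of_right _).union
    (Finset.finite_toSet _))
  have h2 := h1.trans (Set.ncard_union_le _ _)
  rw [Set.ncard_coe_finset, Finset.card_sdiff_of_subset hsub, card_box, card_box] at h2
  have h3 : (L - T) ^ n ≤ L ^ n := Nat.pow_le_pow_left (Nat.sub_le _ _) _
  have h4 : ((cnt Γ a L : ℕ) : ℝ) ≤ ((cnt Γ b L + (L ^ n - (L - T) ^ n) : ℕ) : ℝ) := by
    exact_mod_cast h2
  push_cast [Nat.cast_sub h3, Nat.cast_sub hT] at h4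
  exact h4

theorem cnt_range_discrIter_le {n : ℕ} {A : ℕ → Matrix (Fin n) (Fin n) ℝ}
    (hA : ∀ j, (A j).det = 1) (k : ℕ) {ε : ℝ} (hε : 0 < ε) :
    ∃ L₀ : ℕ, ∀ L, L₀ ≤ L → ∀ z z', (cnt (range (discrIter A k)) z L : ℝ) ≤
      cnt (range (discrIter A k)) z' L + ε * (L : ℝ) ^ n := by
  obtain ⟨B, δ, hδ, hB, hper⟩ := exists_exceptional_iter A hA k (ε := ε / 4) (by positivity)
  obtain ⟨C, hC, hnear⟩ := exists_discrIter_near A hA k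
  set ρ : (Fin n → ℤ) → (Fin k → Fin n → ℝ) := fun x j => residue (A j) (discrIter A j x) with hρ
  have htb : TotallyBounded (range ρ) := by
    refine (isCompact_closedBall (0 : Fin k → Fin n → ℝ) (1 / 2)).totallyBounded.subset ?_
    rintro _ ⟨x, rfl⟩
    rw [mem_closedBall_zero_iff, pi_norm_le_iff_of_nonneg (by norm_num)]
    exact fun j => norm_mulVec_sub_discr_le _ _
  obtain ⟨t, hts, htf, ht⟩ := Metric.finite_approx_of_totallyBounded htb δ hδ
  choose! g hg using fun (y : Fin k → Fin n → ℝ) (hy : y ∈ t) => hts hy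
  obtain ⟨M, hM⟩ : ∃ M : ℝ, ∀ y ∈ t, ‖fun i => (discrIter A k (g y) i : ℝ)‖ ≤ M := by
    obtain ⟨M, hM⟩ := (htf.image fun y => ‖fun i => (discrIter A k (g y) i : ℝ)‖).bddAbove
    exact ⟨M, fun y hy => hM (mem_image_of_mem _ hy)⟩
  obtain ⟨T, hT⟩ := exists_nat_ge (C + M)
  obtain ⟨L₁, hL₁⟩ := hB (ε / 4) (by positivity)
  have hlim : Tendsto (fun L : ℕ => 1 - (1 - (T : ℝ) / L) ^ n) atTop (𝓝 (1 - (1 - 0) ^ n)) :=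
    tendsto_const_nhds.sub ((tendsto_const_nhds.sub
      (tendsto_const_nhds.div_atTop tendsto_natCast_atTop_atTop)).pow n)
  simp only [sub_zero, one_pow, sub_self] at hlim
  obtain ⟨L₂, hL₂⟩ := eventually_atTop.1
    (hlim.eventually (gt_mem_nhds (show (0 : ℝ) < ε / 2 by positivity)))
  refine ⟨max (max L₁ L₂) (T + 1), fun L hL z z' => ?_⟩
  have hLT : T + 1 ≤ L := le_of_max_le_right hL
  have hL0 : (0 : ℝ) < L := by exact_mod_cast (show 0 < L by omega)
  obtain ⟨x, hx⟩ := hnear (z' - z)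
  obtain ⟨y, hy, hxy⟩ : ∃ y ∈ t, dist (ρ x) y < δ := by
    have := ht (mem_range_self x)
    simpa using this
  set x' := g y with hx'
  have hρx' : ρ x' = y := hg y hy
  set p : Fin n → ℤ := discrIter A k x - discrIter A k x' with hp
  have hclose : ∀ j < k, ‖residue (A j) (discrIter A j x) -
      residue (A j) (discrIter A j x')‖ < δ := by
    intro j hj
    rw [← hρx', dist_eq_norm] at hxy
    exact (norm_le_pi_norm (ρ x - ρ x') ⟨j, hj⟩).trans_lt hxy
  have h1 : cnt (range (discrIter A k)) z L ≤ cnt B z L + cnt (range (discrIter A k)) (z + p) L := by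
    have hsub : range (discrIter A k) ∩ (box z L : Set (Fin n → ℤ)) ⊆
        (B ∩ (box z L : Set (Fin n → ℤ))) ∪
        ((range (discrIter A k) ∩ (box z L : Set (Fin n → ℤ))) \ B) := by
      intro v hv
      by_cases h : v ∈ B
      · exact Or.inl ⟨h, hv.2⟩
      · exact Or.inr ⟨hv, h⟩
    refine (Set.ncard_le_ncard hsub (((Finset.finite_toSet _).inter_of_right _).union
      (((Finset.finite_toSet _).inter_of_right _).subset sdiff_subset))).trans
      ((Set.ncard_union_le _ _).trans ?_)
    refine Nat.add_le_add_left ?_ _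
    refine Set.ncard_le_ncard_of_injOn (fun v => v + p) ?_ ?_
      ((Finset.finite_toSet _).inter_of_right _)
    · rintro v ⟨⟨⟨u, rfl⟩, hv⟩, hvB⟩
      refine ⟨⟨u + x - x', ?_⟩, ?_⟩
      · rw [hper x x' u hclose hvB, hp, add_sub_assoc]
      · rw [Finset.mem_coe, mem_box] at hv ⊢
        intro i
        have := hv i
        simp only [Pi.add_apply]
        omega
    · intro v _ w _ hvw
      simpa using hvw
  have h2 : ∀ i, |(z + p) i - z' i| ≤ T := by
    intro i
    have h3 := (norm_le_pi_norm _ i).trans hx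
    have h4 := (norm_le_pi_norm _ i).trans (hM y hy)
    have h5 : |(((z + p) i - z' i : ℤ) : ℝ)| ≤ C + M := by
      have : (((z + p) i - z' i : ℤ) : ℝ) =
          ((discrIter A k x i : ℝ) - ((z' - z) i : ℤ)) - (discrIter A k x' i : ℝ) := by
        simp only [hp, Pi.add_apply, Pi.sub_apply]; push_cast; ring
      rw [this]
      exact (abs_sub _ _).trans (add_le_add h3 h4)
    exact_mod_cast h5.trans hT
  have h3 := cnt_le_cnt_add (range (discrIter A k)) (z + p) z' L T (by omega) h2
  have h4 := hL₁ L (le_of_max_le_left (le_of_max_le_left hL)) z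
  have h5 := hL₂ L (le_of_max_le_right (le_of_max_le_left hL))
  have h6 : (L : ℝ) ^ n - ((L : ℝ) - T) ^ n = (1 - (1 - (T : ℝ) / L) ^ n) * (L : ℝ) ^ n := by
    rw [sub_mul, one_mul, ← mul_pow]
    congr 2
    field_simp
  have h7 : (1 - (1 - (T : ℝ) / L) ^ n) * (L : ℝ) ^ n ≤ ε / 2 * (L : ℝ) ^ n := by gcongr
  have h1' : (cnt (range (discrIter A k)) z L : ℝ) ≤
    cnt B z L + cnt (range (discrIter A k)) (z + p) L := by exact_mod_cast h1
  linarith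

theorem rate_antitone {n : ℕ} {A : ℕ → Matrix (Fin n) (Fin n) ℝ} (hA : ∀ j, (A j).det = 1) :
    Antitone (rate A) := by
  refine antitone_nat_of_succ_le fun k => rate_le_of_upperDensityLE ?_
  have h := (upperDensityLE_rate (A := A) (k := k)
    fun ε hε => cnt_range_discrIter_le hA k hε).image_discr (hA k)
  rwa [← range_comp] at h

theorem exists_hasAsymptoticRate {n : ℕ} {A : ℕ → Matrix (Fin n) (Fin n) ℝ}
    (hA : ∀ j, (A j).det = 1) :
    ∃ t, HasAsymptoticRate A t ∧ 0 ≤ t ∧ ∀ k, t ≤ rate A k := by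
  have hb : BddBelow (range (rate A)) := ⟨0, by rintro _ ⟨k, rfl⟩; exact rate_nonneg A k⟩
  exact ⟨⨅ k, rate A k, tendsto_atTop_ciInf (rate_antitone hA) hb,
    le_ciInf fun k => rate_nonneg A k, fun k => ciInf_le hb k⟩

end LinDiscr
end

noncomputable section
namespace LinDiscr

open MeasureTheory

/-! ### Equidistribution on tori, uniformly in the base point -/

theorem norm_sum_zpow_le {c : ℂ} (hc : ‖c‖ = 1) (L : ℕ) :
    ‖∑ a ∈ Finset.Ico (0 : ℤ) L, c ^ a‖ ≤ L := by
  refine (norm_sum_le _ _).trans ?_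
  simp [norm_zpow, hc]

theorem norm_sum_zpow_le_of_ne_one {c : ℂ} (hc : ‖c‖ = 1) (hc1 : c ≠ 1) (L : ℕ) :
    ‖∑ a ∈ Finset.Ico (0 : ℤ) L, c ^ a‖ ≤ 2 / ‖c - 1‖ := by
  have h : ∑ a ∈ Finset.Ico (0 : ℤ) L, c ^ a = ∑ a ∈ Finset.range L, c ^ a := by
    refine (Finset.sum_bij (fun (a : ℕ) _ => (a : ℤ)) ?_ ?_ ?_ ?_).symm
    · intro a ha; simpa using ha
    · intro a _ b _ hab; exact_mod_cast hab
    · intro b hb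
      rw [Finset.mem_Ico] at hb
      exact ⟨b.toNat, by simp; omega, by simp [hb.1]⟩
    · intro a _; simp
  rw [h, geom_sum_eq hc1, norm_div]
  refine div_le_div_of_nonneg_right ?_ (norm_nonneg _)
  refine (norm_sub_le _ _).trans ?_
  rw [norm_pow, hc, one_pow, norm_one]
  norm_num

theorem exists_norm_sum_box_le {n : ℕ} {c : Fin n → ℂ} (hc : ∀ i, ‖c i‖ = 1) {i₀ : Fin n}
    (h0 : c i₀ ≠ 1) {ε : ℝ} (hε : 0 < ε) : ∃ L₀ : ℕ, ∀ L, L₀ ≤ L →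
    ‖∑ t ∈ box (0 : Fin n → ℤ) L, ∏ i, c i ^ t i‖ ≤ ε * (L : ℝ) ^ n := by
  obtain ⟨L₀, hL₀⟩ := exists_nat_ge (2 / ‖c i₀ - 1‖ / ε)
  refine ⟨L₀, fun L hL => ?_⟩
  have e : ∑ t ∈ box (0 : Fin n → ℤ) L, ∏ i, c i ^ t i =
      ∏ i, ∑ a ∈ Finset.Ico (0 : ℤ) L, c i ^ a := by
    rw [Finset.prod_univ_sum]
    simp [box]
  have hL' : 2 / ‖c i₀ - 1‖ ≤ ε * L := by
    have h1 : (L₀ : ℝ) ≤ L := by exact_mod_cast hL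
    rw [div_le_iff₀ hε] at hL₀
    nlinarith
  rw [e, norm_prod, ← Finset.mul_prod_erase _ _ (Finset.mem_univ i₀)]
  have h2 : ∏ i ∈ Finset.univ.erase i₀, ‖∑ a ∈ Finset.Ico (0 : ℤ) L, c i ^ a‖ ≤
      (L : ℝ) ^ (n - 1) := by
    refine (Finset.prod_le_prod (fun _ _ => norm_nonneg _)
      fun i _ => norm_sum_zpow_le (hc i) L).trans (le_of_eq ?_)
    rw [Finset.prod_const, Finset.card_erase_of_mem (Finset.mem_univ _), Finset.card_univ,
      Fintype.card_fin]
  calc _ ≤ (ε * L) * (L : ℝ) ^ (n - 1) := by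
        gcongr
        exact (norm_sum_zpow_le_of_ne_one (hc i₀) h0 L).trans hL'
    _ = ε * (L : ℝ) ^ (n - 1 + 1) := by rw [pow_succ]; ring
    _ = _ := by rw [Nat.sub_add_cancel i₀.pos]

theorem exists_box_average_close {n : ℕ} {d Ω : Type*} [Fintype d] [MeasurableSpace Ω]
    (μ : Measure Ω) [IsProbabilityMeasure μ] (τ : Ω → UnitAddTorus d) (hτ : Measurable τ)
    (hτ0 : ∀ m : d → ℤ, m ≠ 0 → ∫ X, UnitAddTorus.mFourier m (τ X) ∂μ = 0)
    (φ : (Fin n → ℤ) → UnitAddTorus d)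
    (hφ : ∀ m : d → ℤ, m ≠ 0 → ∃ c : Fin n → ℂ, (∀ i, ‖c i‖ = 1) ∧ (∃ i, c i ≠ 1) ∧
      ∀ t, UnitAddTorus.mFourier m (φ t) = ∏ i, c i ^ t i)
    (f : C(UnitAddTorus d, ℂ)) {ε : ℝ} (hε : 0 < ε) :
    ∃ L₀ : ℕ, ∀ L, L₀ ≤ L → ∀ x, ‖∑ t ∈ box (0 : Fin n → ℤ) L, f (φ t + x) -
      (L : ℂ) ^ n * ∫ X, f (τ X) ∂μ‖ ≤ ε * (L : ℝ) ^ n := by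
  have hint : ∀ g : C(UnitAddTorus d, ℂ), Integrable (fun X => g (τ X)) μ := fun g =>
    Integrable.of_bound (g.continuous.measurable.comp hτ).aestronglyMeasurable ‖g‖
      (Eventually.of_forall fun X => g.norm_coe_le_norm _)
  -- trigonometric polynomials
  have hpoly : ∀ p ∈ Submodule.span ℂ (range (UnitAddTorus.mFourier (d := d))), ∀ ε : ℝ, 0 < ε →
      ∃ L₀ : ℕ, ∀ L, L₀ ≤ L → ∀ x, ‖∑ t ∈ box (0 : Fin n → ℤ) L, p (φ t + x) -
        (L : ℂ) ^ n * ∫ X, p (τ X) ∂μ‖ ≤ ε * (L : ℝ) ^ n := by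
    intro p hp
    induction hp using Submodule.span_induction with
    | mem p hp =>
      obtain ⟨m, rfl⟩ := hp
      intro ε hε
      by_cases hm : m = 0
      · subst hm
        refine ⟨0, fun L _ x => ?_⟩
        simp only [UnitAddTorus.mFourier_zero, ContinuousMap.one_apply, Finset.sum_const,
          card_box, integral_const, probReal_univ, one_smul, nsmul_eq_mul, mul_one]
        push_cast
        rw [sub_self, norm_zero]
        positivity
      · obtain ⟨c, hc, ⟨i₀, hi₀⟩, hct⟩ := hφ m hm
        obtain ⟨L₀, hL₀⟩ := exists_norm_sum_box_le hc hi₀ hε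
        refine ⟨L₀, fun L hL x => ?_⟩
        have hadd : ∀ t, UnitAddTorus.mFourier m (φ t + x) =
            (∏ i, c i ^ t i) * UnitAddTorus.mFourier m x := by
          intro t
          rw [← hct]
          simp [UnitAddTorus.mFourier, fourier_apply, smul_add, AddCircle.toCircle_add,
            Finset.prod_mul_distrib]
        simp only [hadd]
        rw [hτ0 m hm, mul_zero, sub_zero, ← Finset.sum_mul, norm_mul]
        refine (mul_le_of_le_one_right (norm_nonneg _) ?_).trans (hL₀ L hL)
        exact ((UnitAddTorus.mFourier m).norm_coe_le_norm x).trans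
          (le_of_eq UnitAddTorus.mFourier_norm)
    | zero =>
      intro ε hε
      exact ⟨0, fun L _ x => by simp; positivity⟩
    | add p q _ _ hp hq =>
      intro ε hε
      obtain ⟨L₁, h1⟩ := hp (ε / 2) (by positivity)
      obtain ⟨L₂, h2⟩ := hq (ε / 2) (by positivity)
      refine ⟨max L₁ L₂, fun L hL x => ?_⟩
      have h3 := h1 L (le_of_max_le_left hL) x
      have h4 := h2 L (le_of_max_le_right hL) x
      simp only [ContinuousMap.add_apply]
      rw [Finset.sum_add_distrib, integral_add (hint p) (hint q), mul_add, add_sub_add_comm]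
      refine (norm_add_le _ _).trans ((add_le_add h3 h4).trans (le_of_eq ?_))
      ring
    | smul a p _ hp =>
      intro ε hε
      obtain ⟨L₁, h1⟩ := hp (ε / (‖a‖ + 1)) (by positivity)
      refine ⟨L₁, fun L hL x => ?_⟩
      have h3 := h1 L hL x
      simp only [ContinuousMap.smul_apply, smul_eq_mul]
      rw [← Finset.mul_sum, integral_const_mul, mul_left_comm, ← mul_sub, norm_mul]
      calc _ ≤ (‖a‖ + 1) * (ε / (‖a‖ + 1) * (L : ℝ) ^ n) := by
            gcongr
            linarith
        _ = _ := by field_simp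
  have hdense : f ∈ closure (Submodule.span ℂ (range (UnitAddTorus.mFourier (d := d))) :
      Set C(UnitAddTorus d, ℂ)) := by
    rw [← Submodule.topologicalClosure_coe, UnitAddTorus.span_mFourier_closure_eq_top]
    trivial
  obtain ⟨p, hp, hfp⟩ := Metric.mem_closure_iff.1 hdense (ε / 3) (by positivity)
  rw [dist_eq_norm] at hfp
  obtain ⟨L₀, hL₀⟩ := hpoly p hp (ε / 3) (by positivity)
  refine ⟨L₀, fun L hL x => ?_⟩
  have hpt : ∀ y, ‖f y - p y‖ ≤ ε / 3 := fun y => ((f - p).norm_coe_le_norm y).trans hfp.le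
  have h1 : ‖∑ t ∈ box (0 : Fin n → ℤ) L, f (φ t + x) - ∑ t ∈ box (0 : Fin n → ℤ) L, p (φ t + x)‖
      ≤ ε / 3 * (L : ℝ) ^ n := by
    rw [← Finset.sum_sub_distrib]
    refine (norm_sum_le_of_le _ fun t _ => hpt _).trans (le_of_eq ?_)
    rw [Finset.sum_const, card_box, nsmul_eq_mul]
    push_cast; ring
  have h2 : ‖(L : ℂ) ^ n * ∫ X, p (τ X) ∂μ - (L : ℂ) ^ n * ∫ X, f (τ X) ∂μ‖ ≤
      ε / 3 * (L : ℝ) ^ n := by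
    rw [← mul_sub, ← integral_sub (hint p) (hint f), norm_mul, norm_pow, Complex.norm_natCast,
      mul_comm]
    gcongr
    refine (norm_integral_le_of_norm_le_const (C := ε / 3)
      (Eventually.of_forall fun X => ?_)).trans (by simp)
    rw [norm_sub_rev]
    exact hpt _
  have h3 := hL₀ L hL x
  have e : ∀ a b c d : ℂ, a - d = (a - b) + (b - c) + (c - d) := by intros; ring
  rw [e _ (∑ t ∈ box (0 : Fin n → ℤ) L, p (φ t + x)) ((L : ℂ) ^ n * ∫ X, p (τ X) ∂μ)]
  refine (norm_add₃_le).trans ((add_le_add (add_le_add h1 h3) h2).trans (le_of_eq ?_))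
  ring

/-- The uniform probability measure on the unit cube. -/
def cubeMeasure (n : ℕ) : Measure (Fin n → ℝ) :=
  Measure.pi fun _ => volume.restrict (Ioc (0 : ℝ) 1)

instance : IsProbabilityMeasure (volume.restrict (Ioc (0 : ℝ) 1)) := ⟨by simp⟩

instance (n : ℕ) : IsProbabilityMeasure (cubeMeasure n) := by
  unfold cubeMeasure; infer_instance

/-- The uniform probability measure on a power of the unit cube. -/
def cubePow (k n : ℕ) : Measure (Fin k → Fin n → ℝ) := Measure.pi fun _ => cubeMeasure n

instance (k n : ℕ) : IsProbabilityMeasure (cubePow k n) := by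
  unfold cubePow; infer_instance

/-- The projection to the torus. -/
def toTorus {k n : ℕ} (X : Fin k → Fin n → ℝ) : UnitAddTorus (Fin k × Fin n) :=
  fun p => (X p.1 p.2 : UnitAddCircle)

theorem continuous_toTorus {k n : ℕ} : Continuous (toTorus (k := k) (n := n)) := by
  refine continuous_pi fun p => ?_
  exact (AddCircle.continuous_mk' 1).comp (by fun_prop)

theorem toTorus_add {k n : ℕ} (X Y : Fin k → Fin n → ℝ) :
    toTorus (X + Y) = toTorus X + toTorus Y := by
  ext p; simp [toTorus]

theorem toTorus_neg {k n : ℕ} (X : Fin k → Fin n → ℝ) : toTorus (-X) = -toTorus X := by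
  ext p; simp [toTorus]

theorem toTorus_int {k n : ℕ} (q : Fin k → Fin n → ℤ) :
    toTorus (fun j i => (q j i : ℝ)) = 0 := by
  ext p
  simp only [toTorus, Pi.zero_apply]
  rw [AddCircle.coe_eq_zero_iff]
  exact ⟨q p.1 p.2, by simp⟩

theorem toTorus_eq_iff {k n : ℕ} {X Y : Fin k → Fin n → ℝ} :
    toTorus X = toTorus Y ↔ ∃ q : Fin k → Fin n → ℤ, X + (fun j i => (q j i : ℝ)) = Y := by
  constructor
  · intro h
    have h1 : ∀ j i, ∃ q : ℤ, X j i + q = Y j i := by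
      intro j i
      have h2 : ((Y j i - X j i : ℝ) : UnitAddCircle) = 0 := by
        rw [AddCircle.coe_sub, sub_eq_zero]; exact (congrFun h (j, i)).symm
      obtain ⟨q, hq⟩ := (AddCircle.coe_eq_zero_iff 1).1 h2
      refine ⟨q, ?_⟩
      simp only [zsmul_eq_mul, mul_one] at hq
      linarith
    choose q hq using h1
    exact ⟨q, by ext j i; exact hq j i⟩
  · rintro ⟨q, rfl⟩
    rw [toTorus_add, toTorus_int, add_zero]

theorem mFourier_toTorus {k n : ℕ} (m : Fin k × Fin n → ℤ) (X : Fin k → Fin n → ℝ) :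
    UnitAddTorus.mFourier m (toTorus X) =
      ∏ j, ∏ i, Complex.exp (2 * Real.pi * Complex.I * m (j, i) * X j i) := by
  simp [UnitAddTorus.mFourier, toTorus, Fintype.prod_prod_type]

theorem integral_mFourier_toTorus {k n : ℕ} {m : Fin k × Fin n → ℤ} (hm : m ≠ 0) :
    ∫ X, UnitAddTorus.mFourier m (toTorus X) ∂(cubePow k n) = 0 := by
  simp only [mFourier_toTorus]
  rw [cubePow, integral_fintype_prod_eq_prod (μ := fun _ => cubeMeasure n)
    (fun j (x : Fin n → ℝ) => ∏ i, Complex.exp (2 * Real.pi * Complex.I * m (j, i) * x i))]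
  obtain ⟨⟨j, i⟩, hji⟩ := Function.ne_iff.1 hm
  refine Finset.prod_eq_zero (Finset.mem_univ j) ?_
  rw [cubeMeasure, integral_fintype_prod_eq_prod (μ := fun _ => volume.restrict (Ioc (0 : ℝ) 1))
    (fun i (x : ℝ) => Complex.exp (2 * Real.pi * Complex.I * m (j, i) * x))]
  refine Finset.prod_eq_zero (Finset.mem_univ i) ?_
  rw [← intervalIntegral.integral_of_le zero_le_one, integral_exp_mul_complex]
  · have : Complex.exp (2 * Real.pi * Complex.I * m (j, i) * (1 : ℝ)) = 1 := by
      rw [Complex.exp_eq_one_iff]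
      exact ⟨m (j, i), by push_cast; ring⟩
    rw [this]
    simp
  · have : (m (j, i) : ℂ) ≠ 0 := by exact_mod_cast hji
    simp [Real.pi_ne_zero, this]

end LinDiscr
end

noncomputable section
namespace LinDiscr

open MeasureTheory

/-! ### Chains of approximate preimages -/

/-- `w 0, w 1, …` is a chain of approximate preimages of `s` by `B 0, B 1, …`, with errors at most
`1 / 2 + ε`. -/
def Chain {n : ℕ} (ε : ℝ) : (k : ℕ) → (Fin k → Matrix (Fin n) (Fin n) ℝ) →
    (Fin k → Fin n → ℝ) → (Fin n → ℝ) → Prop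
  | 0, _, _, _ => True
  | k + 1, B, w, s => ‖(B 0).mulVec (w 0) - s‖ ≤ 1 / 2 + ε ∧
      Chain ε k (fun j => B j.succ) (fun j => w j.succ) (w 0)

/-- The successive exact preimages of `v` by `B 0, B 1, …`, for matrices of determinant `1`. -/
def orb {n : ℕ} : (k : ℕ) → (Fin k → Matrix (Fin n) (Fin n) ℝ) → (Fin n → ℝ) →
    (Fin k → Fin n → ℝ)
  | 0, _, _ => fun j => j.elim0
  | k + 1, B, v => Fin.cons ((B 0).adjugate.mulVec v)
      (orb k (fun j => B j.succ) ((B 0).adjugate.mulVec v))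

theorem mulVec_adjugate_mulVec {n : ℕ} {A : Matrix (Fin n) (Fin n) ℝ} (hA : A.det = 1)
    (v : Fin n → ℝ) : A.mulVec (A.adjugate.mulVec v) = v := by
  rw [Matrix.mulVec_mulVec, Matrix.mul_adjugate, hA, one_smul, Matrix.one_mulVec]

theorem adjugate_mulVec_mulVec {n : ℕ} {A : Matrix (Fin n) (Fin n) ℝ} (hA : A.det = 1)
    (v : Fin n → ℝ) : A.adjugate.mulVec (A.mulVec v) = v := by
  rw [Matrix.mulVec_mulVec, Matrix.adjugate_mul, hA, one_smul, Matrix.one_mulVec]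

theorem Chain.sub_orb {n : ℕ} {ε : ℝ} : ∀ {k : ℕ} {B : Fin k → Matrix (Fin n) (Fin n) ℝ}
    {w : Fin k → Fin n → ℝ} {s : Fin n → ℝ}, (∀ j, (B j).det = 1) → Chain ε k B w s →
    ∀ v, Chain ε k B (w - orb k B v) (s - v)
  | 0, _, _, _, _, _, _ => trivial
  | k + 1, B, w, s, hB, h, v => by
    refine ⟨?_, ?_⟩
    · have : (B 0).mulVec ((w - orb (k + 1) B v) 0) - (s - v) = (B 0).mulVec (w 0) - s := by
        simp only [orb, Pi.sub_apply, Fin.cons_zero]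
        rw [Matrix.mulVec_sub, mulVec_adjugate_mulVec (hB 0)]
        abel
      rw [this]
      exact h.1
    · have := Chain.sub_orb (fun j => hB j.succ) h.2 ((B 0).adjugate.mulVec v)
      simpa [orb, Pi.sub_def] using this

theorem Chain.neg {n : ℕ} {ε : ℝ} : ∀ {k : ℕ} {B : Fin k → Matrix (Fin n) (Fin n) ℝ}
    {w : Fin k → Fin n → ℝ} {s : Fin n → ℝ}, Chain ε k B w s → Chain ε k B (-w) (-s)
  | 0, _, _, _, _ => trivial
  | k + 1, B, w, s, h => by
    refine ⟨?_, ?_⟩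
    · rw [Pi.neg_apply, Matrix.mulVec_neg, ← neg_sub', norm_neg]
      exact h.1
    · simpa [Pi.neg_def] using Chain.neg h.2

theorem Chain.mono {n : ℕ} {ε ε' : ℝ} (hε : ε ≤ ε') :
    ∀ {k : ℕ} {B : Fin k → Matrix (Fin n) (Fin n) ℝ}
    {w : Fin k → Fin n → ℝ} {s : Fin n → ℝ}, Chain ε k B w s → Chain ε' k B w s
  | 0, _, _, _, _ => trivial
  | _ + 1, _, _, _, h => ⟨h.1.trans (by linarith), Chain.mono hε h.2⟩

theorem chain_of_forall_pos {n : ℕ} : ∀ {k : ℕ} {B : Fin k → Matrix (Fin n) (Fin n) ℝ}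
    {w : Fin k → Fin n → ℝ} {s : Fin n → ℝ}, (∀ m : ℕ, Chain (1 / ((m : ℝ) + 1)) k B w s) →
    Chain 0 k B w s
  | 0, _, _, _, _ => trivial
  | k + 1, B, w, s, h => by
    refine ⟨?_, chain_of_forall_pos fun m => (h m).2⟩
    refine ge_of_tendsto' (x := atTop) (f := fun m : ℕ => 1 / 2 + 1 / ((m : ℝ) + 1)) ?_
      fun m => (h m).1
    exact tendsto_const_nhds.add tendsto_one_div_add_atTop_nhds_zero_nat

theorem isClosed_chain {n : ℕ} (ε : ℝ) : ∀ (k : ℕ) (B : Fin k → Matrix (Fin n) (Fin n) ℝ),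
    IsClosed {p : (Fin k → Fin n → ℝ) × (Fin n → ℝ) | Chain ε k B p.1 p.2}
  | 0, _ => isClosed_univ
  | k + 1, B => by
    refine IsClosed.inter (isClosed_le (f := fun p : (Fin (k + 1) → Fin n → ℝ) × (Fin n → ℝ) =>
      ‖(B 0).mulVec (p.1 0) - p.2‖) (by fun_prop) continuous_const) ?_
    exact (isClosed_chain ε k fun j => B j.succ).preimage
      (f := fun p : (Fin (k + 1) → Fin n → ℝ) × (Fin n → ℝ) => (fun j => p.1 j.succ, p.1 0))
      (by fun_prop)

theorem Chain.norm_le {n : ℕ} : ∀ {k : ℕ} {B : Fin k → Matrix (Fin n) (Fin n) ℝ},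
    (∀ j, (B j).det = 1) → ∀ T : ℝ, ∃ M : ℝ, ∀ w s, ‖s‖ ≤ T → Chain 1 k B w s → ‖w‖ ≤ M
  | 0, _, _, _ => ⟨0, fun w _ _ _ => by rw [Subsingleton.elim w 0, norm_zero]⟩
  | k + 1, B, hB, T => by
    obtain ⟨C, hC, h⟩ := norm_mulVec_le_sum (B 0).adjugate
    obtain ⟨M, hM⟩ := Chain.norm_le (fun j => hB (Fin.succ j)) (C * (3 / 2 + T))
    refine ⟨max (C * (3 / 2 + T)) M, fun w s hs hw => ?_⟩
    have h0 : ‖w 0‖ ≤ C * (3 / 2 + T) := by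
      rw [← adjugate_mulVec_mulVec (hB 0) (w 0)]
      refine (h _).trans ?_
      gcongr
      have h1 : (B 0).mulVec (w 0) = ((B 0).mulVec (w 0) - s) + s := by abel
      rw [h1]
      refine (norm_add_le _ _).trans (add_le_add (hw.1.trans (by norm_num)) hs)
    have h1 := hM _ _ h0 hw.2
    have h2 : 0 ≤ max (C * (3 / 2 + T)) M := (norm_nonneg _).trans (h0.trans (le_max_left _ _))
    rw [pi_norm_le_iff_of_nonneg h2]
    refine Fin.cases (h0.trans (le_max_left _ _)) fun j => ?_
    exact (norm_le_pi_norm (fun j : Fin k => w j.succ) j).trans (h1.trans (le_max_right _ _))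

theorem isCompact_chain {n k : ℕ} {ε : ℝ} (hε : ε ≤ 1) {B : Fin k → Matrix (Fin n) (Fin n) ℝ}
    (hB : ∀ j, (B j).det = 1) : IsCompact {w : Fin k → Fin n → ℝ | Chain ε k B w 0} := by
  obtain ⟨M, hM⟩ := Chain.norm_le hB 0
  refine Metric.isCompact_of_isClosed_isBounded ?_ ?_
  · exact (isClosed_chain ε k B).preimage (f := fun w => (w, (0 : Fin n → ℝ))) (by fun_prop)
  · refine (Metric.isBounded_closedBall (x := 0) (r := M)).subset fun w hw => ?_
    rw [mem_closedBall_zero_iff]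
    exact hM w 0 (by simp) (Chain.mono hε hw)

theorem norm_mulVec_le_of_abs_le {n : ℕ} {A : Matrix (Fin n) (Fin n) ℝ} {δ : ℝ} (hδ : 0 ≤ δ)
    (h : ∀ i j, |A i j| ≤ δ) (x : Fin n → ℝ) : ‖A.mulVec x‖ ≤ n * δ * ‖x‖ := by
  rw [pi_norm_le_iff_of_nonneg (by positivity)]
  intro i
  rw [Matrix.mulVec, dotProduct]
  refine (norm_sum_le_of_le (f := fun j => A i j * x j) Finset.univ (n := fun _ => δ * ‖x‖)
    fun j _ => ?_).trans (le_of_eq (by simp [mul_assoc]))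
  rw [norm_mul]
  exact mul_le_mul (h i j) (norm_le_pi_norm x j) (norm_nonneg _) hδ

theorem Chain.perturb {n : ℕ} {η : ℝ} (hη : 0 < η) :
    ∀ {k : ℕ} {B : Fin k → Matrix (Fin n) (Fin n) ℝ}, (∀ j, (B j).det = 1) → ∀ T : ℝ,
    ∃ δ : ℝ, 0 < δ ∧ ∀ B' : Fin k → Matrix (Fin n) (Fin n) ℝ,
      (∀ j a b, |B' j a b - B j a b| ≤ δ) → ∀ w s, ‖s‖ ≤ T → Chain 0 k B' w s → Chain η k B w s
  | 0, _, _, _ => ⟨1, one_pos, fun _ _ _ _ _ _ => trivial⟩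
  | k + 1, B, hB, T => by
    obtain ⟨C, hC, h⟩ := norm_mulVec_le_sum (B 0).adjugate
    set M : ℝ := 2 * C * (1 / 2 + |T|) with hM
    have hM0 : 0 ≤ M := by positivity
    obtain ⟨δ, hδ, hk⟩ := Chain.perturb hη (fun j => hB (Fin.succ j)) M
    set δ' : ℝ := min δ (min (1 / (2 * (C + 1) * (n + 1))) (η / ((n + 1) * (M + 1)))) with hδ'
    have hδ'0 : 0 < δ' := lt_min hδ (lt_min (by positivity) (by positivity))
    refine ⟨δ', hδ'0, fun B' hB' w s hs hw => ?_⟩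
    have hs' : ‖s‖ ≤ |T| := hs.trans (le_abs_self T)
    have hdiff := norm_mulVec_le_of_abs_le (A := B' 0 - B 0) hδ'0.le (fun a b => hB' 0 a b)
    have hw0 : ‖(B' 0).mulVec (w 0) - s‖ ≤ 1 / 2 := by simpa using hw.1
    have e : (B 0).mulVec (w 0) = ((B' 0).mulVec (w 0) - s) + s - (B' 0 - B 0).mulVec (w 0) := by
      rw [Matrix.sub_mulVec]; abel
    have hwM : ‖w 0‖ ≤ M := by
      have h1 : ‖w 0‖ ≤ C * (1 / 2 + |T| + n * δ' * ‖w 0‖) := by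
        calc ‖w 0‖ = ‖(B 0).adjugate.mulVec ((B 0).mulVec (w 0))‖ := by
              rw [adjugate_mulVec_mulVec (hB 0)]
          _ ≤ C * ‖(B 0).mulVec (w 0)‖ := h _
          _ ≤ _ := by
              gcongr
              rw [e]
              refine (norm_sub_le _ _).trans (add_le_add ((norm_add_le _ _).trans
                (add_le_add hw0 hs')) (hdiff _))
      have h2 : C * (n * δ') ≤ 1 / 2 := by
        have h3 : δ' ≤ 1 / (2 * (C + 1) * (n + 1)) := (min_le_right _ _).trans (min_le_left _ _)
        calc C * (n * δ') ≤ (C + 1) * ((n + 1) * (1 / (2 * (C + 1) * (n + 1)))) := by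
              gcongr <;> linarith
          _ = 1 / 2 := by field_simp
      have h3 : C * (n * δ') * ‖w 0‖ ≤ 1 / 2 * ‖w 0‖ := by gcongr
      rw [hM]
      linarith
    refine ⟨?_, hk _ (fun j a b => (hB' j.succ a b).trans (min_le_left _ _)) _ _ hwM hw.2⟩
    have e2 : (B 0).mulVec (w 0) - s = ((B' 0).mulVec (w 0) - s) - (B' 0 - B 0).mulVec (w 0) := by
      rw [Matrix.sub_mulVec]; abel
    rw [e2]
    refine (norm_sub_le _ _).trans (add_le_add hw0 ((hdiff _).trans ?_))
    calc n * δ' * ‖w 0‖ ≤ (n + 1) * (η / ((n + 1) * (M + 1))) * (M + 1) := by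
          gcongr
          · linarith
          · exact (min_le_right _ _).trans (min_le_right _ _)
          · linarith
      _ = η := by field_simp

theorem exists_chain_of_mem_range {n : ℕ} (A : ℕ → Matrix (Fin n) (Fin n) ℝ) :
    ∀ (k : ℕ) (y : Fin n → ℤ), y ∈ range (discrIter A k) → ∃ x : Fin k → Fin n → ℤ,
      Chain 0 k (fun j => A (k - 1 - j)) (fun j i => (x j i : ℝ)) (fun i => (y i : ℝ))
  | 0, _, _ => ⟨0, trivial⟩
  | k + 1, y, hy => by
    obtain ⟨u, rfl⟩ := hy
    obtain ⟨x, hx⟩ := exists_chain_of_mem_range A k (discrIter A k u) ⟨u, rfl⟩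
    refine ⟨Fin.cons (discrIter A k u) x, ?_, ?_⟩
    · have := norm_mulVec_sub_discr_le (A k) (discrIter A k u)
      simpa [discrIter] using this
    · have : (fun j : Fin k => A (k + 1 - 1 - (j.succ : Fin (k + 1)))) =
          fun j : Fin k => A (k - 1 - j) := by
        ext j : 1
        congr 1
        simp only [Fin.val_succ]
        omega
      rw [this]
      simpa only [Fin.cons_zero, Fin.cons_succ] using hx

theorem orb_add {n : ℕ} : ∀ {k : ℕ} (B : Fin k → Matrix (Fin n) (Fin n) ℝ) (v v' : Fin n → ℝ),
    orb k B (v + v') = orb k B v + orb k B v'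
  | 0, _, _, _ => by ext j; exact j.elim0
  | k + 1, B, v, v' => by
    ext j
    refine Fin.cases ?_ (fun j => ?_) j
    · simp [orb, Matrix.mulVec_add]
    · simp [orb, Matrix.mulVec_add, orb_add]

theorem orb_smul {n : ℕ} : ∀ {k : ℕ} (B : Fin k → Matrix (Fin n) (Fin n) ℝ) (c : ℝ)
    (v : Fin n → ℝ), orb k B (c • v) = c • orb k B v
  | 0, _, _, _ => by ext j; exact j.elim0
  | k + 1, B, c, v => by
    ext j
    refine Fin.cases ?_ (fun j => ?_) j
    · simp [orb, Matrix.mulVec_smul]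
    · simp [orb, Matrix.mulVec_smul, orb_smul]

theorem orb_eq_sum {n k : ℕ} (B : Fin k → Matrix (Fin n) (Fin n) ℝ) (v : Fin n → ℝ) :
    orb k B v = ∑ i, v i • orb k B (Pi.single i 1) := by
  let f : (Fin n → ℝ) →ₗ[ℝ] (Fin k → Fin n → ℝ) :=
    { toFun := orb k B, map_add' := orb_add B, map_smul' := orb_smul B }
  have h := LinearMap.pi_apply_eq_sum_univ f v
  have h2 : ∀ i : Fin n, (fun j => if i = j then (1 : ℝ) else 0) = Pi.single i 1 := by
    intro i; ext j; simp [Pi.single_apply, eq_comm]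
  simp only [h2] at h
  exact h

/-- The frequencies of a character of the torus along the orbit map. -/
def freq {n k : ℕ} (B : Fin k → Matrix (Fin n) (Fin n) ℝ) (m : Fin k → Fin n → ℤ)
    (v : Fin n → ℝ) : ℝ := ∑ j, ∑ i, (m j i : ℝ) * orb k B v j i

theorem mFourier_orb {n k : ℕ} (B : Fin k → Matrix (Fin n) (Fin n) ℝ) (m : Fin k × Fin n → ℤ)
    (t : Fin n → ℤ) :
    UnitAddTorus.mFourier m (toTorus (orb k B fun i => (t i : ℝ))) =
      ∏ i, Complex.exp (2 * Real.pi * Complex.I *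
        freq B (fun j i => m (j, i)) (Pi.single i 1)) ^ t i := by
  rw [mFourier_toTorus]
  simp only [← Complex.exp_int_mul, ← Complex.exp_sum]
  congr 1
  rw [orb_eq_sum]
  simp only [freq, Finset.sum_apply, Pi.smul_apply, smul_eq_mul]
  push_cast
  simp only [Finset.mul_sum]
  rw [Finset.sum_comm' (s := Finset.univ) (t := fun _ => Finset.univ)
    (t' := Finset.univ) (s' := fun _ => Finset.univ) (by simp)]
  conv_rhs => rw [Finset.sum_comm]; enter [2, j]; rw [Finset.sum_comm]
  rw [Finset.sum_comm]
  refine Finset.sum_congr rfl fun j _ => Finset.sum_congr rfl fun i _ =>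
    Finset.sum_congr rfl fun a _ => ?_
  ring

theorem cexp_freq_ne_one {x : ℝ} (hx : ∀ c : ℤ, x ≠ c) :
    Complex.exp (2 * Real.pi * Complex.I * x) ≠ 1 := by
  rw [Ne, Complex.exp_eq_one_iff]
  rintro ⟨c, hc⟩
  apply hx c
  have h : (2 * Real.pi * Complex.I : ℂ) ≠ 0 := by
    simp [Real.pi_ne_zero]
  rw [mul_comm (c : ℂ)] at hc
  exact_mod_cast mul_left_cancel₀ h hc

theorem exists_cnt_range_discrIter_le {n k : ℕ} {B : Fin k → Matrix (Fin n) (Fin n) ℝ}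
    (hB : ∀ j, (B j).det = 1)
    (hgen : ∀ m : Fin k → Fin n → ℤ, m ≠ 0 → ∃ i, ∀ c : ℤ, freq B m (Pi.single i 1) ≠ c)
    {ε : ℝ} (hvol : cubePow k n {X | ∃ w, Chain 0 k B w 0 ∧ toTorus X = toTorus w} <
      ENNReal.ofReal ε) :
    ∃ L : ℕ, 1 ≤ L ∧ ∃ δ : ℝ, 0 < δ ∧ ∀ A : ℕ → Matrix (Fin n) (Fin n) ℝ, (∀ j, (A j).det = 1) →
      (∀ (j : Fin k) a b, |A (k - 1 - j) a b - B j a b| ≤ δ) →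
      ∀ z, (cnt (range (discrIter A k)) z L : ℝ) ≤ ε * (L : ℝ) ^ n := by
  have hε : 0 < ε := by
    by_contra h
    rw [ENNReal.ofReal_of_nonpos (not_lt.1 h)] at hvol
    exact not_lt_zero hvol
  set ν := (cubePow k n).map toTorus with hν
  have hτ : Measurable (toTorus (k := k) (n := n)) := continuous_toTorus.measurable
  have : IsProbabilityMeasure ν := Measure.isProbabilityMeasure_map hτ.aemeasurable
  set W : ℝ → Set (Fin k → Fin n → ℝ) := fun η => {w | Chain η k B w 0} with hW
  have hK0 : IsCompact (toTorus '' W 0) := (isCompact_chain zero_le_one hB).image continuous_toTorus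
  have hνK : ν (toTorus '' W 0) < ENNReal.ofReal ε := by
    rw [hν, Measure.map_apply hτ hK0.measurableSet]
    refine lt_of_le_of_lt (measure_mono ?_) hvol
    rintro X ⟨w, hw, hX⟩
    exact ⟨w, hw, hX.symm⟩
  obtain ⟨U, hKU, hU, hνU⟩ := Set.exists_isOpen_lt_of_lt _ _ hνK
  obtain ⟨m, hm⟩ : ∃ m : ℕ, W (1 / ((m : ℝ) + 1)) ⊆ toTorus ⁻¹' U := by
    refine exists_subset_nhds_of_isCompact (V := fun m : ℕ => W (1 / ((m : ℝ) + 1))) ?_ ?_ ?_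
    · refine (antitone_nat_of_succ_le fun m => ?_).directed_ge
      intro w hw
      refine Chain.mono ?_ hw
      push_cast
      gcongr
      linarith
    · intro m
      refine isCompact_chain ?_ hB
      rw [div_le_one (by positivity)]
      have : (0 : ℝ) ≤ m := Nat.cast_nonneg m
      linarith
    · intro w hw
      refine (hU.preimage continuous_toTorus).mem_nhds ?_
      exact hKU ⟨w, chain_of_forall_pos fun m => mem_iInter.1 hw m, rfl⟩
  set η : ℝ := 1 / ((m : ℝ) + 1) with hη
  have hη0 : 0 < η := by positivity
  have hη1 : η ≤ 1 := by
    rw [hη, div_le_one (by positivity)]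
    have : (0 : ℝ) ≤ m := Nat.cast_nonneg m
    linarith
  have hKη : IsClosed (toTorus '' W η) :=
    ((isCompact_chain hη1 hB).image continuous_toTorus).isClosed
  obtain ⟨g, hg0, hg1, hg⟩ := exists_continuous_zero_one_of_isClosed hU.isClosed_compl hKη
    (by
      rw [disjoint_compl_left_iff_subset]
      rintro _ ⟨w, hw, rfl⟩
      exact hm hw)
  have hgint : ∫ X, g (toTorus X) ∂(cubePow k n) < ε := by
    have h1 : ∫ X, g (toTorus X) ∂(cubePow k n) ≤ ν.real U := by
      have hm' : MeasurableSet (toTorus (k := k) (n := n) ⁻¹' U) := hτ hU.measurableSet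
      rw [hν, map_measureReal_apply hτ hU.measurableSet, ← integral_indicator_one hm']
      refine integral_mono ?_ ?_ fun X => ?_
      · exact Integrable.of_bound (g.continuous.measurable.comp hτ).aestronglyMeasurable 1
          (Eventually.of_forall fun X => by
            rw [Real.norm_eq_abs, abs_of_nonneg (hg _).1]; exact (hg _).2)
      · exact (integrable_const (1 : ℝ)).indicator hm'
      · by_cases hX : X ∈ toTorus (k := k) (n := n) ⁻¹' U
        · simp only [indicator_of_mem hX]
          exact (hg _).2
        · simp only [indicator_of_notMem hX]
          exact (hg0 hX).le
    refine h1.trans_lt ?_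
    rw [Measure.real, ← ENNReal.toReal_ofReal hε.le]
    exact (ENNReal.toReal_lt_toReal (measure_ne_top _ _) ENNReal.ofReal_ne_top).2 hνU
  set I : ℝ := ∫ X, g (toTorus X) ∂(cubePow k n) with hI
  let f : C(UnitAddTorus (Fin k × Fin n), ℂ) :=
    ⟨fun x => (g x : ℂ), Complex.continuous_ofReal.comp g.continuous⟩
  obtain ⟨L₀, hL₀⟩ := exists_box_average_close (cubePow k n) toTorus hτ
    (fun m hm => integral_mFourier_toTorus hm) (fun t => toTorus (orb k B fun i => (t i : ℝ)))
    (by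
      intro m hm
      refine ⟨_, fun i => ?_, ?_, fun t => mFourier_orb B m t⟩
      · have := Complex.norm_exp_ofReal_mul_I
          (2 * Real.pi * freq B (fun j i => m (j, i)) (Pi.single i 1))
        refine Eq.trans (congrArg norm (congrArg Complex.exp ?_)) this
        push_cast; ring
      · obtain ⟨i, hi⟩ := hgen (fun j i => m (j, i)) (by
          intro h
          apply hm
          ext ⟨j, i⟩
          exact congrFun (congrFun h j) i)
        exact ⟨i, cexp_freq_ne_one hi⟩)
    f (ε := ε - I) (by linarith)
  set L := max L₀ 1 with hL
  have hbox : ∀ x, ∑ t ∈ box (0 : Fin n → ℤ) L, g (toTorus (orb k B fun i => (t i : ℝ)) + x) ≤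
      ε * (L : ℝ) ^ n := by
    intro x
    have h1 := hL₀ L (le_max_left _ _) x
    have h2 : (∫ X, f (toTorus X) ∂(cubePow k n)) = (I : ℂ) := by
      rw [hI, ← integral_complex_ofReal]; rfl
    rw [h2] at h1
    have h3 : ∑ t ∈ box (0 : Fin n → ℤ) L, f (toTorus (orb k B fun i => (t i : ℝ)) + x) -
        (L : ℂ) ^ n * (I : ℂ) =
        ((∑ t ∈ box (0 : Fin n → ℤ) L, g (toTorus (orb k B fun i => (t i : ℝ)) + x) -
          (L : ℝ) ^ n * I : ℝ) : ℂ) := by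
      push_cast; rfl
    rw [h3, Complex.norm_real, Real.norm_eq_abs] at h1
    have := (abs_le.1 h1).2
    linarith
  obtain ⟨δ, hδ, hpert⟩ := Chain.perturb hη0 hB (L : ℝ)
  refine ⟨L, le_max_right _ _, δ, hδ, fun A hA hAB z => ?_⟩
  set B' : Fin k → Matrix (Fin n) (Fin n) ℝ := fun j => A (k - 1 - j) with hB'
  set x₀ := toTorus (orb k B' fun i => (z i : ℝ)) with hx₀
  refine le_trans ?_ (hbox x₀)
  classical
  set S : Finset (Fin n → ℤ) := (box (0 : Fin n → ℤ) L).filter fun t =>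
    toTorus (orb k B fun i => (t i : ℝ)) + x₀ ∈ toTorus '' W η with hS
  have h1 : cnt (range (discrIter A k)) z L ≤ S.card := by
    rw [cnt, ← Set.ncard_coe_finset]
    refine Set.ncard_le_ncard_of_injOn (fun y => y - z) ?_ (fun a _ b _ h => by simpa using h)
      (Finset.finite_toSet _)
    rintro y ⟨hy, hyz⟩
    obtain ⟨x, hx⟩ := exists_chain_of_mem_range A k y hy
    rw [Finset.mem_coe, mem_box] at hyz
    have ht : y - z ∈ box (0 : Fin n → ℤ) L := by
      rw [mem_box]
      intro i
      have := hyz i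
      simp only [Pi.sub_apply, Pi.zero_apply]
      omega
    rw [hS, Finset.mem_coe, Finset.mem_filter]
    refine ⟨ht, ?_⟩
    set t := y - z with htdef
    have hts : (fun i => (y i : ℝ)) - (fun i => (z i : ℝ)) = fun i => (t i : ℝ) := by
      ext i; simp [htdef]
    have c1 := Chain.sub_orb (fun j => hA _) hx (fun i => (z i : ℝ))
    rw [hts] at c1
    have htn : ‖fun i => (t i : ℝ)‖ ≤ (L : ℝ) := by
      rw [pi_norm_le_iff_of_nonneg (Nat.cast_nonneg _)]
      intro i
      have := mem_box.1 ht i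
      simp only [Pi.zero_apply, zero_add] at this
      rw [Real.norm_eq_abs, abs_of_nonneg (by exact_mod_cast this.1)]
      exact_mod_cast this.2.le
    have c2 := hpert _ hAB _ _ htn c1
    have c3 := (Chain.sub_orb hB c2 (fun i => (t i : ℝ))).neg
    rw [sub_self, neg_zero] at c3
    refine ⟨_, c3, ?_⟩
    rw [neg_sub, sub_sub_eq_add_sub, sub_eq_add_neg, toTorus_add, toTorus_add, toTorus_neg,
      toTorus_int, neg_zero, add_zero]
  calc (cnt (range (discrIter A k)) z L : ℝ) ≤ S.card := by exact_mod_cast h1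
    _ = ∑ t ∈ S, (1 : ℝ) := by simp
    _ = ∑ t ∈ S, g (toTorus (orb k B fun i => (t i : ℝ)) + x₀) := by
        refine Finset.sum_congr rfl fun t ht => ?_
        exact (hg1 (Finset.mem_filter.1 ht).2).symm
    _ ≤ _ := Finset.sum_le_sum_of_subset_of_nonneg (Finset.filter_subset _ _)
        fun t _ _ => (hg _).1

end LinDiscr
end

noncomputable section
namespace LinDiscr

open MeasureTheory ComplexConjugate

/-! ### Power sums of unimodular numbers -/

theorem exists_one_le_norm_power_sum {ι : Type*} (S : Finset ι) (hS : S.Nonempty) (z : ι → ℂ)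
    (hz : ∀ s, ‖z s‖ = 1) : ∃ j : ℕ, 1 ≤ j ∧ j ≤ S.card ∧ 1 ≤ ‖∑ s ∈ S, z s ^ j‖ := by
  by_contra! hcon
  set M := S.card with hM
  have hM1 : 1 ≤ M := hS.card_pos
  set P : ℕ → ℕ → ℂ := fun a b => ∑ s ∈ S, z s ^ a * conj (z s) ^ b with hP
  have hzz : ∀ s, z s * conj (z s) = 1 := fun s => by
    rw [Complex.mul_conj, Complex.normSq_eq_norm_sq, hz]; norm_num
  have hPdiag : ∀ a, ‖P a a‖ = M := by
    intro a
    simp only [hP, ← mul_pow, hzz, one_pow, Finset.sum_const, nsmul_eq_mul, mul_one]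
    rw [Complex.norm_natCast]
  have hPgt : ∀ a b, b < a → P a b = ∑ s ∈ S, z s ^ (a - b) := by
    intro a b hab
    refine Finset.sum_congr rfl fun s _ => ?_
    conv_lhs => rw [← Nat.sub_add_cancel hab.le, pow_add, mul_assoc, ← mul_pow, hzz, one_pow,
      mul_one]
  have hPconj : ∀ a b, P a b = conj (P b a) := by
    intro a b
    simp only [hP, map_sum, map_mul, map_pow, Complex.conj_conj]
    exact Finset.sum_congr rfl fun s _ => mul_comm _ _
  have hPoff : ∀ a < M + 1, ∀ b < M + 1, a ≠ b → ‖P a b‖ < 1 := by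
    intro a ha b hb hab
    rcases lt_or_gt_of_ne hab with h | h
    · rw [hPconj, Complex.norm_conj, hPgt b a h]
      exact hcon _ (by omega) (by omega)
    · rw [hPgt a b h]
      exact hcon _ (by omega) (by omega)
  have hid : ∑ a ∈ Finset.range (M + 1), ∑ b ∈ Finset.range (M + 1), ‖P a b‖ ^ 2 =
      ∑ s ∈ S, ∑ t ∈ S, ‖∑ a ∈ Finset.range (M + 1), (z s * conj (z t)) ^ a‖ ^ 2 := by
    have hsq : ∀ w : ℂ, ((‖w‖ ^ 2 : ℝ) : ℂ) = w * conj w := fun w => by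
      rw [Complex.mul_conj, Complex.normSq_eq_norm_sq]
    have h : ((∑ a ∈ Finset.range (M + 1), ∑ b ∈ Finset.range (M + 1), ‖P a b‖ ^ 2 : ℝ) : ℂ) =
      ((∑ s ∈ S, ∑ t ∈ S, ‖∑ a ∈ Finset.range (M + 1), (z s * conj (z t)) ^ a‖ ^ 2 : ℝ) : ℂ) := by
      simp only [Complex.ofReal_sum, hsq, hP, map_sum, map_mul, map_pow, Complex.conj_conj,
        Finset.sum_mul_sum]
      rw [Finset.sum_congr rfl fun a _ => Finset.sum_comm]
      rw [Finset.sum_comm]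
      refine Finset.sum_congr rfl fun s _ => ?_
      rw [Finset.sum_congr rfl fun a _ => Finset.sum_comm]
      rw [Finset.sum_comm]
      refine Finset.sum_congr rfl fun t _ => Finset.sum_congr rfl fun a _ =>
        Finset.sum_congr rfl fun b _ => ?_
      ring
    exact_mod_cast h
  have hlow : (M : ℝ) * ((M : ℝ) + 1) ^ 2 ≤
      ∑ s ∈ S, ∑ t ∈ S, ‖∑ a ∈ Finset.range (M + 1), (z s * conj (z t)) ^ a‖ ^ 2 := by
    have : (M : ℝ) * ((M : ℝ) + 1) ^ 2 = ∑ s ∈ S, ((M : ℝ) + 1) ^ 2 := by simp [hM]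
    rw [this]
    refine Finset.sum_le_sum fun s hs => ?_
    refine le_trans (le_of_eq ?_) (Finset.single_le_sum
      (f := fun t => ‖∑ a ∈ Finset.range (M + 1), (z s * conj (z t)) ^ a‖ ^ 2)
      (fun t _ => by positivity) hs)
    simp only [hzz, one_pow, Finset.sum_const, Finset.card_range, nsmul_eq_mul, mul_one]
    rw [Complex.norm_natCast]
    push_cast; ring
  have hup : ∑ a ∈ Finset.range (M + 1), ∑ b ∈ Finset.range (M + 1), ‖P a b‖ ^ 2 <
      ∑ a ∈ Finset.range (M + 1), ∑ b ∈ Finset.range (M + 1),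
        if a = b then (M : ℝ) ^ 2 else 1 := by
    have hle : ∀ a ∈ Finset.range (M + 1), ∀ b ∈ Finset.range (M + 1),
        ‖P a b‖ ^ 2 ≤ if a = b then (M : ℝ) ^ 2 else 1 := by
      intro a ha b hb
      rw [Finset.mem_range] at ha hb
      split_ifs with hab
      · rw [hab, hPdiag]
      · exact pow_le_one₀ (norm_nonneg _) (hPoff a ha b hb hab).le
    refine Finset.sum_lt_sum (fun a ha => Finset.sum_le_sum (hle a ha)) ⟨0, by simp, ?_⟩
    refine Finset.sum_lt_sum (hle 0 (by simp)) ⟨1, by simp; omega, ?_⟩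
    rw [if_neg (by norm_num)]
    exact pow_lt_one₀ (norm_nonneg _) (hPoff 0 (by omega) 1 (by omega) (by norm_num)) (by norm_num)
  have hrow : ∑ a ∈ Finset.range (M + 1), ∑ b ∈ Finset.range (M + 1),
      (if a = b then (M : ℝ) ^ 2 else 1) = (M + 1) * ((M : ℝ) ^ 2 + M) := by
    have : ∀ a ∈ Finset.range (M + 1), ∑ b ∈ Finset.range (M + 1),
        (if a = b then (M : ℝ) ^ 2 else 1) = (M : ℝ) ^ 2 + M := by
      intro a ha
      have h1 : ∀ b, (if a = b then (M : ℝ) ^ 2 else 1) =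
          (if a = b then (M : ℝ) ^ 2 - 1 else 0) + 1 := by
        intro b; split_ifs <;> ring
      simp only [h1, Finset.sum_add_distrib, Finset.sum_ite_eq, ha, if_true]
      simp
    rw [Finset.sum_congr rfl this]
    simp
    ring
  rw [hid, hrow] at hup
  nlinarith

/-! ### Integrals over the unit cube -/

theorem cubeMeasure_eq_restrict (n : ℕ) :
    cubeMeasure n = volume.restrict (Set.univ.pi fun _ : Fin n => Ioc (0 : ℝ) 1) := by
  rw [cubeMeasure, volume_pi, Measure.restrict_pi_pi]

theorem ae_mem_cube (n : ℕ) : ∀ᵐ x ∂(cubeMeasure n), ∀ i, x i ∈ Ioc (0 : ℝ) 1 := by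
  rw [cubeMeasure_eq_restrict]
  filter_upwards [ae_restrict_mem (MeasurableSet.univ_pi fun _ => measurableSet_Ioc)] with x hx i
  exact hx i (mem_univ i)

theorem integral_sum_translates {n : ℕ} {f : (Fin n → ℝ) → ℂ} (hf : Integrable f)
    (T : Finset (Fin n → ℤ))
    (hT : ∀ x : Fin n → ℝ, (∀ i, x i ∈ Ioc (0 : ℝ) 1) → ∀ q : Fin n → ℤ, q ∉ T →
      f (x + fun i => (q i : ℝ)) = 0) :
    ∫ x, ∑ q ∈ T, f (x + fun i => (q i : ℝ)) ∂(cubeMeasure n) = ∫ x, f x := by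
  set D : Set (Fin n → ℝ) := Set.univ.pi fun _ : Fin n => Ioc (0 : ℝ) 1 with hD
  have hDm : MeasurableSet D := MeasurableSet.univ_pi fun _ => measurableSet_Ioc
  set E : (Fin n → ℤ) → Set (Fin n → ℝ) := fun q =>
    (fun x => x - fun i => (q i : ℝ)) ⁻¹' D with hE
  have hmp : ∀ q : Fin n → ℤ, MeasurePreserving (fun x : Fin n → ℝ => x + fun i => (q i : ℝ)) :=
    fun q => measurePreserving_add_right volume _
  have hEm : ∀ q, MeasurableSet (E q) := fun q => hDm.preimage (by fun_prop)
  have hmem : ∀ q x, x ∈ E q ↔ ∀ i, q i = ⌈x i⌉ - 1 := by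
    intro q x
    simp only [hE, hD, mem_preimage, mem_univ_pi, Pi.sub_apply, mem_Ioc]
    refine forall_congr' fun i => ?_
    rw [eq_sub_iff_add_eq, eq_comm, Int.ceil_eq_iff]
    push_cast
    constructor <;> rintro ⟨h1, h2⟩ <;> constructor <;> linarith
  have hunion : ⋃ q, E q = Set.univ := by
    refine eq_univ_of_forall fun x => mem_iUnion.2 ⟨fun i => ⌈x i⌉ - 1, ?_⟩
    rw [hmem]
    exact fun i => rfl
  have hdisj : Pairwise (Function.onFun Disjoint E) := by
    intro q q' hqq
    rw [Function.onFun, Set.disjoint_left]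
    intro x hx hx'
    apply hqq
    ext i
    rw [(hmem q x).1 hx i, (hmem q' x).1 hx' i]
  have hEint : ∀ q : Fin n → ℤ, ∫ x in E q, f x = ∫ x in D, f (x + fun i => (q i : ℝ)) := by
    intro q
    have := (hmp q).setIntegral_preimage_emb (MeasurableEquiv.addRight _).measurableEmbedding f (E q)
    rw [← this]
    congr 2
    ext x
    simp [hE]
  rw [← setIntegral_univ (f := f), ← hunion, integral_iUnion hEm hdisj hf.integrableOn,
    tsum_eq_sum (s := T), cubeMeasure_eq_restrict, integral_finsetSum]
  · exact Finset.sum_congr rfl fun q _ => (hEint q).symm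
  · intro q _
    exact ((hmp q).integrable_comp_of_integrable hf).integrableOn
  · intro q hq
    rw [hEint q]
    refine setIntegral_eq_zero_of_forall_eq_zero fun x hx => ?_
    exact hT x (fun i => hx i (mem_univ i)) q hq

/-! ### The parallelepipeds `A⁻¹ (s + [-1/2, 1/2]ⁿ)` -/

/-- The set of the points sent by `A` to the cube of side `1` centred at `s`. -/
def cell {n : ℕ} (A : Matrix (Fin n) (Fin n) ℝ) (s : Fin n → ℝ) : Set (Fin n → ℝ) :=
  {w | ‖A.mulVec w - s‖ ≤ 1 / 2}

theorem cell_eq_preimage {n : ℕ} (A : Matrix (Fin n) (Fin n) ℝ) (s : Fin n → ℝ) :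
    cell A s = A.mulVec ⁻¹' Metric.closedBall s (1 / 2) := by
  ext w
  simp [cell, dist_eq_norm]

theorem isClosed_cell {n : ℕ} (A : Matrix (Fin n) (Fin n) ℝ) (s : Fin n → ℝ) :
    IsClosed (cell A s) := isClosed_le (by fun_prop) continuous_const

theorem volume_cell {n : ℕ} {A : Matrix (Fin n) (Fin n) ℝ} (hA : A.det = 1) (s : Fin n → ℝ) :
    volume (cell A s) = 1 := by
  rw [cell_eq_preimage, volume_preimage_mulVec hA, Real.volume_pi_closedBall _ (by norm_num)]
  norm_num

theorem measurePreserving_mulVec {n : ℕ} {A : Matrix (Fin n) (Fin n) ℝ} (hA : A.det = 1) :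
    MeasurePreserving A.mulVec := by
  have hm : Measurable A.mulVec := Continuous.measurable (by fun_prop)
  refine ⟨hm, ?_⟩
  ext s hs
  rw [Measure.map_apply hm hs, volume_preimage_mulVec hA]

theorem measurableEmbedding_mulVec {n : ℕ} {A : Matrix (Fin n) (Fin n) ℝ} (hA : A.det = 1) :
    MeasurableEmbedding A.mulVec := by
  refine Continuous.measurableEmbedding (by fun_prop) ?_
  exact Function.LeftInverse.injective (g := A.adjugate.mulVec) (adjugate_mulVec_mulVec hA)

theorem integral_exp_symm_interval (a : ℝ) :
    ∫ y in (-(1 / 2) : ℝ)..(1 / 2), Complex.exp (-(2 * Real.pi * Complex.I * a) * y) =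
      (Real.sinc (Real.pi * a) : ℂ) := by
  by_cases ha : a = 0
  · subst ha
    simp only [Complex.ofReal_zero, mul_zero, neg_zero, zero_mul, Complex.exp_zero, Real.sinc_zero,
      Complex.ofReal_one]
    rw [intervalIntegral.integral_const]
    norm_num
  · have hpa : Real.pi * a ≠ 0 := mul_ne_zero Real.pi_ne_zero ha
    have hpa' : (Real.pi : ℂ) * a ≠ 0 := by exact_mod_cast hpa
    have hc : -(2 * Real.pi * Complex.I * a : ℂ) ≠ 0 := by
      have : -(2 * Real.pi * Complex.I * a : ℂ) = (-2 * Complex.I) * (Real.pi * a) := by ring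
      rw [this]
      exact mul_ne_zero (by simp) hpa'
    rw [integral_exp_mul_complex hc, Real.sinc_of_ne_zero hpa]
    push_cast
    rw [Complex.sin, div_eq_div_iff hc hpa']
    have e1 : -(2 * Real.pi * Complex.I * a : ℂ) * (1 / 2) = -(Real.pi * a) * Complex.I := by ring
    have e2 : -(2 * Real.pi * Complex.I * a : ℂ) * -(1 / 2) = Real.pi * a * Complex.I := by ring
    rw [e1, e2]
    linear_combination ((Complex.exp (-(Real.pi * a) * Complex.I) -
      Complex.exp (Real.pi * a * Complex.I)) * (Real.pi * a)) * Complex.I_sq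

theorem integral_cube_exp {n : ℕ} (ζ : Fin n → ℝ) :
    ∫ y in Metric.closedBall (0 : Fin n → ℝ) (1 / 2),
      Complex.exp (-(2 * Real.pi * Complex.I * (∑ i, ζ i * y i : ℝ))) =
      ∏ i, (Real.sinc (Real.pi * ζ i) : ℂ) := by
  have h1 : Metric.closedBall (0 : Fin n → ℝ) (1 / 2) =
      Set.univ.pi fun _ => Icc (-(1 / 2) : ℝ) (1 / 2) := by
    rw [closedBall_pi _ (by norm_num)]
    simp [Real.closedBall_eq_Icc]
  rw [h1, volume_pi, Measure.restrict_pi_pi]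
  have h2 : ∀ y : Fin n → ℝ, Complex.exp (-(2 * Real.pi * Complex.I * (∑ i, ζ i * y i : ℝ))) =
      ∏ i, Complex.exp (-(2 * Real.pi * Complex.I * ζ i) * y i) := by
    intro y
    rw [← Complex.exp_sum]
    congr 1
    push_cast
    rw [Finset.mul_sum, ← Finset.sum_neg_distrib]
    exact Finset.sum_congr rfl fun i _ => by ring
  simp only [h2]
  rw [integral_fintype_prod_eq_prod (μ := fun _ => volume.restrict (Icc (-(1 / 2) : ℝ) (1 / 2)))
    (fun i (y : ℝ) => Complex.exp (-(2 * Real.pi * Complex.I * ζ i) * y))]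
  refine Finset.prod_congr rfl fun i _ => ?_
  rw [integral_Icc_eq_integral_Ioc, ← intervalIntegral.integral_of_le (by norm_num),
    integral_exp_symm_interval]

theorem integral_cell_exp {n : ℕ} {A : Matrix (Fin n) (Fin n) ℝ} (hA : A.det = 1) (s : Fin n → ℝ)
    (i₀ : Fin n) (j : ℕ) :
    ∫ w in cell A s, Complex.exp (-(2 * Real.pi * Complex.I * (j * w i₀))) =
      Complex.exp (-(2 * Real.pi * Complex.I * (A.adjugate.mulVec s i₀ : ℝ))) ^ j *
        ∏ i, (Real.sinc (Real.pi * (j * A.adjugate i₀ i)) : ℂ) := by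
  have h1 := (measurePreserving_mulVec hA).setIntegral_preimage_emb (measurableEmbedding_mulVec hA)
    (fun y => Complex.exp (-(2 * Real.pi * Complex.I * (j * (A.adjugate.mulVec y i₀ : ℝ)))))
    (Metric.closedBall s (1 / 2))
  simp only [adjugate_mulVec_mulVec hA] at h1
  rw [cell_eq_preimage, h1]
  have h2 := (measurePreserving_add_right (volume : Measure (Fin n → ℝ)) s).setIntegral_preimage_emb
    (MeasurableEquiv.addRight s).measurableEmbedding
    (fun y => Complex.exp (-(2 * Real.pi * Complex.I * (j * (A.adjugate.mulVec y i₀ : ℝ)))))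
    (Metric.closedBall s (1 / 2))
  have h3 : (fun x => x + s) ⁻¹' Metric.closedBall s (1 / 2) = Metric.closedBall 0 (1 / 2) := by
    ext x; simp [dist_eq_norm]
  rw [← h2, h3, ← integral_cube_exp, ← integral_const_mul]
  refine setIntegral_congr_fun Metric.isClosed_closedBall.measurableSet fun y _ => ?_
  rw [← Complex.exp_nat_mul, ← Complex.exp_add]
  congr 1
  rw [Matrix.mulVec_add, Pi.add_apply]
  have h4 : A.adjugate.mulVec y i₀ = ∑ i, A.adjugate i₀ i * y i := rfl
  rw [h4]
  simp only [mul_assoc, ← Finset.mul_sum]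
  push_cast
  ring

end LinDiscr
end

noncomputable section
namespace LinDiscr

open MeasureTheory

/-! ### Extinction of the backward chains -/

open Classical in
/-- The number of pairs `(s, q)` with `s ∈ S`, `q ∈ T` and `x + q ∈ cell A s`. -/
def mult {n : ℕ} (A : Matrix (Fin n) (Fin n) ℝ) (S : Finset (Fin n → ℝ)) (T : Finset (Fin n → ℤ))
    (x : Fin n → ℝ) : ℕ :=
  ∑ q ∈ T, (S.filter fun s => x + (fun i => (q i : ℝ)) ∈ cell A s).card

theorem finite_setOf_norm_int_le (n : ℕ) (M : ℝ) :
    {q : Fin n → ℤ | ‖fun i => (q i : ℝ)‖ ≤ M}.Finite := by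
  refine (Set.Finite.pi fun _ : Fin n => Set.finite_Icc (-⌈M⌉) ⌈M⌉).subset fun q hq i _ => ?_
  have h := (norm_le_pi_norm _ i).trans (show ‖fun i => (q i : ℝ)‖ ≤ M from hq)
  rw [Real.norm_eq_abs, abs_le] at h
  have h1 := Int.le_ceil M
  constructor
  · have : -(⌈M⌉ : ℝ) ≤ q i := by linarith [h.1]
    exact_mod_cast this
  · have : (q i : ℝ) ≤ ⌈M⌉ := by linarith [h.2]
    exact_mod_cast this

theorem exists_finset_translates {n : ℕ} {A : Matrix (Fin n) (Fin n) ℝ} (hA : A.det = 1)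
    (S : Finset (Fin n → ℝ)) : ∃ T : Finset (Fin n → ℤ),
    ∀ x : Fin n → ℝ, (∀ i, x i ∈ Ioc (0 : ℝ) 1) → ∀ q : Fin n → ℤ, q ∉ T → ∀ s ∈ S,
      x + (fun i => (q i : ℝ)) ∉ cell A s := by
  obtain ⟨C, hC, h⟩ := norm_mulVec_le_sum A.adjugate
  obtain ⟨M, hM⟩ : ∃ M : ℝ, ∀ s ∈ S, ‖s‖ ≤ M := by
    obtain ⟨M, hM⟩ := (S.finite_toSet.image norm).bddAbove
    exact ⟨M, fun s hs => hM (mem_image_of_mem _ hs)⟩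
  refine ⟨(finite_setOf_norm_int_le n (C * (1 / 2 + M) + 1)).toFinset, fun x hx q hq s hs hw => ?_⟩
  apply hq
  rw [Set.Finite.mem_toFinset]
  set w := x + fun i => (q i : ℝ) with hwdef
  have hx1 : ‖x‖ ≤ 1 := by
    rw [pi_norm_le_iff_of_nonneg zero_le_one]
    intro i
    rw [Real.norm_eq_abs, abs_of_pos (hx i).1]
    exact (hx i).2
  have hw1 : ‖w‖ ≤ C * (1 / 2 + M) := by
    rw [← adjugate_mulVec_mulVec hA w]
    refine (h _).trans ?_
    gcongr
    rw [show A.mulVec w = (A.mulVec w - s) + s by abel]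
    exact (norm_add_le _ _).trans (add_le_add hw (hM s hs))
  show ‖fun i => (q i : ℝ)‖ ≤ _
  have : (fun i => (q i : ℝ)) = w - x := by rw [hwdef]; abel
  rw [this]
  exact (norm_sub_le _ _).trans (add_le_add hw1 hx1)

theorem mult_eq_sum_indicator {n : ℕ} (A : Matrix (Fin n) (Fin n) ℝ) (S : Finset (Fin n → ℝ))
    (T : Finset (Fin n → ℤ)) (x : Fin n → ℝ) :
    (mult A S T x : ℝ) = ∑ q ∈ T, ∑ s ∈ S,
      (cell A s).indicator (fun _ => (1 : ℝ)) (x + fun i => (q i : ℝ)) := by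
  classical
  rw [mult]
  push_cast
  refine Finset.sum_congr rfl fun q _ => ?_
  rw [Finset.card_filter]
  push_cast
  refine Finset.sum_congr rfl fun s _ => ?_
  by_cases h : (x + fun i => (q i : ℝ)) ∈ cell A s <;> simp [h]

theorem measurable_mult {n : ℕ} (A : Matrix (Fin n) (Fin n) ℝ) (S : Finset (Fin n → ℝ))
    (T : Finset (Fin n → ℤ)) : Measurable fun x => (mult A S T x : ℝ) := by
  simp only [mult_eq_sum_indicator]
  refine Finset.measurable_fun_sum _ fun q _ => Finset.measurable_fun_sum _ fun s _ => ?_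
  exact (measurable_const.indicator (isClosed_cell A s).measurableSet).comp
    (measurable_id.add_const _)

theorem mult_le {n : ℕ} (A : Matrix (Fin n) (Fin n) ℝ) (S : Finset (Fin n → ℝ))
    (T : Finset (Fin n → ℤ)) (x : Fin n → ℝ) : mult A S T x ≤ T.card * S.card := by
  classical
  rw [mult, ← smul_eq_mul]
  refine Finset.sum_le_card_nsmul _ _ _ fun q _ => ?_
  exact Finset.card_filter_le _ _

theorem integrable_comp_mult {n : ℕ} (A : Matrix (Fin n) (Fin n) ℝ) (S : Finset (Fin n → ℝ))
    (T : Finset (Fin n → ℤ)) {g : ℝ → ℝ} (hg : Measurable g) :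
    Integrable (fun x => g (mult A S T x)) (cubeMeasure n) := by
  refine Integrable.of_bound (hg.comp (measurable_mult A S T)).aestronglyMeasurable
    (∑ N ∈ Finset.range (T.card * S.card + 1), |g N|) (Eventually.of_forall fun x => ?_)
  exact Finset.single_le_sum (f := fun N : ℕ => |g N|) (fun N _ => abs_nonneg _)
    (Finset.mem_range.2 (Nat.lt_succ_of_le (mult_le A S T x)))

theorem integral_mult_mul_exp {n : ℕ} {A : Matrix (Fin n) (Fin n) ℝ} (hA : A.det = 1)
    {S : Finset (Fin n → ℝ)} {T : Finset (Fin n → ℤ)}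
    (hT : ∀ x : Fin n → ℝ, (∀ i, x i ∈ Ioc (0 : ℝ) 1) → ∀ q : Fin n → ℤ, q ∉ T → ∀ s ∈ S,
      x + (fun i => (q i : ℝ)) ∉ cell A s) (i₀ : Fin n) (j : ℕ) :
    ∫ x, (mult A S T x : ℂ) * Complex.exp (-(2 * Real.pi * Complex.I * (j * x i₀)))
        ∂(cubeMeasure n) =
      (∑ s ∈ S, Complex.exp (-(2 * Real.pi * Complex.I * (A.adjugate.mulVec s i₀ : ℝ))) ^ j) *
        ∏ i, (Real.sinc (Real.pi * (j * A.adjugate i₀ i)) : ℂ) := by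
  set e : (Fin n → ℝ) → ℂ := fun x => Complex.exp (-(2 * Real.pi * Complex.I * (j * x i₀))) with he
  have hec : Continuous e := by rw [he]; fun_prop
  have hen : ∀ x, ‖e x‖ = 1 := by
    intro x
    have := Complex.norm_exp_ofReal_mul_I (-(2 * Real.pi * (j * x i₀)))
    refine Eq.trans (congrArg norm (congrArg Complex.exp ?_)) this
    push_cast; ring
  set f : (Fin n → ℝ) → ℂ := fun w => ∑ s ∈ S, (cell A s).indicator e w with hf
  have hfi : ∀ s ∈ S, Integrable ((cell A s).indicator e) := by
    intro s _
    rw [integrable_indicator_iff (isClosed_cell A s).measurableSet]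
    refine Measure.integrableOn_of_bounded (M := 1) ?_ hec.aestronglyMeasurable ?_
    · rw [volume_cell hA]; exact ENNReal.one_ne_top
    · exact Eventually.of_forall fun x => (hen x).le
  have h1 := integral_sum_translates (integrable_finsetSum S hfi) T (by
    intro x hx q hq
    exact Finset.sum_eq_zero fun s hs => indicator_of_notMem (hT x hx q hq s hs) _)
  have h2 : ∀ x, (mult A S T x : ℂ) * e x =
      ∑ q ∈ T, ∑ s ∈ S, (cell A s).indicator e (x + fun i => (q i : ℝ)) := by
    intro x
    have h3 : (mult A S T x : ℂ) = ((mult A S T x : ℝ) : ℂ) := by push_cast; rfl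
    rw [h3, mult_eq_sum_indicator]
    push_cast
    simp only [Finset.sum_mul]
    refine Finset.sum_congr rfl fun q _ => Finset.sum_congr rfl fun s _ => ?_
    have h4 : e (x + fun i => (q i : ℝ)) = e x := by
      simp only [he, Pi.add_apply]
      rw [Complex.exp_eq_exp_iff_exists_int]
      exact ⟨-(j * q i₀), by push_cast; ring⟩
    by_cases h : (x + fun i => (q i : ℝ)) ∈ cell A s
    · simp [h, h4]
    · simp [h]
  refine (integral_congr_ae (Eventually.of_forall h2)).trans ?_
  rw [h1, integral_finsetSum _ hfi, Finset.sum_mul]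
  refine Finset.sum_congr rfl fun s _ => ?_
  rw [integral_indicator (isClosed_cell A s).measurableSet]
  exact integral_cell_exp hA s i₀ j

theorem integral_exp_cube (n : ℕ) (i₀ : Fin n) {j : ℕ} (hj : 1 ≤ j) :
    ∫ x, Complex.exp (-(2 * Real.pi * Complex.I * (j * x i₀))) ∂(cubeMeasure n) = 0 := by
  classical
  have h := integral_mFourier_toTorus (k := 1) (n := n)
    (m := fun p => if p.2 = i₀ then -(j : ℤ) else 0) (by
      intro h
      have := congrFun h (0, i₀)
      simp at this
      omega)
  simp only [mFourier_toTorus] at h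
  rw [cubePow, integral_fintype_prod_eq_prod (μ := fun _ => cubeMeasure n)
    (fun l (x : Fin n → ℝ) => ∏ i, Complex.exp (2 * Real.pi * Complex.I *
      ((if i = i₀ then -(j : ℤ) else 0 : ℤ) : ℂ) * x i))] at h
  rw [Fin.prod_univ_one] at h
  rw [← h]
  refine integral_congr_ae (Eventually.of_forall fun x => ?_)
  simp only
  rw [Finset.prod_eq_single i₀]
  · rw [if_pos rfl]
    congr 1
    push_cast; ring
  · intro i _ hi
    simp [hi]
  · simp

theorem integral_mult {n : ℕ} {A : Matrix (Fin n) (Fin n) ℝ} (hA : A.det = 1)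
    {S : Finset (Fin n → ℝ)} {T : Finset (Fin n → ℤ)}
    (hT : ∀ x : Fin n → ℝ, (∀ i, x i ∈ Ioc (0 : ℝ) 1) → ∀ q : Fin n → ℤ, q ∉ T → ∀ s ∈ S,
      x + (fun i => (q i : ℝ)) ∉ cell A s) (i₀ : Fin n) :
    ∫ x, (mult A S T x : ℝ) ∂(cubeMeasure n) = S.card := by
  have h := integral_mult_mul_exp hA hT i₀ 0
  simp only [Nat.cast_zero, zero_mul, mul_zero, neg_zero, Complex.exp_zero, mul_one, pow_zero,
    Real.sinc_zero, Complex.ofReal_one, Finset.prod_const_one, Finset.sum_const,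
    nsmul_eq_mul] at h
  have h2 : ((∫ x, (mult A S T x : ℝ) ∂(cubeMeasure n) : ℝ) : ℂ) = (S.card : ℝ) := by
    rw [← integral_complex_ofReal]
    simpa using h
  exact_mod_cast h2

/-- A quantitative nondegeneracy condition on the row `i₀` of `A⁻¹`. -/
def Nondeg {n : ℕ} (i₀ : Fin n) (m : ℕ) (c : ℝ) (A : Matrix (Fin n) (Fin n) ℝ) : Prop :=
  ∀ j : ℕ, 1 ≤ j → j ≤ m → c ≤ |∏ i, Real.sinc (Real.pi * (j * A.adjugate i₀ i))|

theorem le_integral_abs_mult_sub {n : ℕ} {A : Matrix (Fin n) (Fin n) ℝ} (hA : A.det = 1)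
    {S : Finset (Fin n → ℝ)} {T : Finset (Fin n → ℤ)}
    (hT : ∀ x : Fin n → ℝ, (∀ i, x i ∈ Ioc (0 : ℝ) 1) → ∀ q : Fin n → ℤ, q ∉ T → ∀ s ∈ S,
      x + (fun i => (q i : ℝ)) ∉ cell A s) {i₀ : Fin n} {m : ℕ} {c : ℝ}
    (hnd : Nondeg i₀ m c A) (hS : S.Nonempty) (hSm : S.card ≤ m) :
    c ≤ ∫ x, |(mult A S T x : ℝ) - S.card| ∂(cubeMeasure n) := by
  obtain ⟨j, hj1, hjS, hj⟩ := exists_one_le_norm_power_sum S hS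
    (fun s => Complex.exp (-(2 * Real.pi * Complex.I * (A.adjugate.mulVec s i₀ : ℝ)))) (by
      intro s
      have := Complex.norm_exp_ofReal_mul_I (-(2 * Real.pi * (A.adjugate.mulVec s i₀)))
      refine Eq.trans (congrArg norm (congrArg Complex.exp ?_)) this
      push_cast; ring)
  have h1 := integral_mult_mul_exp hA hT i₀ j
  have h2 := integral_exp_cube n i₀ hj1
  set e : (Fin n → ℝ) → ℂ := fun x => Complex.exp (-(2 * Real.pi * Complex.I * (j * x i₀))) with he
  have hec : Continuous e := by rw [he]; fun_prop
  have hen : ∀ x, ‖e x‖ = 1 := by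
    intro x
    have := Complex.norm_exp_ofReal_mul_I (-(2 * Real.pi * (j * x i₀)))
    refine Eq.trans (congrArg norm (congrArg Complex.exp ?_)) this
    push_cast; ring
  have hei : Integrable e (cubeMeasure n) :=
    Integrable.of_bound hec.aestronglyMeasurable 1 (Eventually.of_forall fun x => (hen x).le)
  have hmi : Integrable (fun x => (mult A S T x : ℂ) * e x) (cubeMeasure n) := by
    have h3 := (integrable_comp_mult A S T (g := id) measurable_id).ofReal (𝕜 := ℂ)
    refine (h3.mul_bdd (c := 1) hec.aestronglyMeasurable
      (Eventually.of_forall fun x => (hen x).le)).congr (Eventually.of_forall fun x => ?_)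
    simp
  have h4 : ∫ x, ((mult A S T x : ℂ) - S.card) * e x ∂(cubeMeasure n) =
      (∑ s ∈ S, Complex.exp (-(2 * Real.pi * Complex.I * (A.adjugate.mulVec s i₀ : ℝ))) ^ j) *
        ∏ i, (Real.sinc (Real.pi * (j * A.adjugate i₀ i)) : ℂ) := by
    simp only [sub_mul]
    rw [integral_sub hmi (hei.const_mul _), integral_const_mul, h2, mul_zero, sub_zero]
    exact h1
  have h5 : ‖∫ x, ((mult A S T x : ℂ) - S.card) * e x ∂(cubeMeasure n)‖ ≤
      ∫ x, |(mult A S T x : ℝ) - S.card| ∂(cubeMeasure n) := by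
    refine (norm_integral_le_integral_norm _).trans (le_of_eq ?_)
    refine integral_congr_ae (Eventually.of_forall fun x => ?_)
    simp only
    rw [norm_mul, hen, mul_one, ← Real.norm_eq_abs, ← Complex.norm_real]
    push_cast; rfl
  refine le_trans ?_ h5
  rw [h4, norm_mul, ← Complex.ofReal_prod, Complex.norm_real, Real.norm_eq_abs]
  calc c ≤ |∏ i, Real.sinc (Real.pi * (j * A.adjugate i₀ i))| := hnd j hj1 (hjS.trans hSm)
    _ ≤ _ := le_mul_of_one_le_left (abs_nonneg _) hj

/-- A bounded strictly concave function on the nonnegative integers. -/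
def concaveWeight (x : ℝ) : ℝ := x / (x + 1)

theorem measurable_concaveWeight : Measurable concaveWeight := by
  unfold concaveWeight; fun_prop

theorem concaveWeight_le (N M : ℕ) :
    concaveWeight N ≤ concaveWeight M + ((N : ℝ) - M) / ((M : ℝ) + 1) ^ 2 -
      (|(N : ℝ) - M| - ((N : ℝ) - M)) / (2 * ((M : ℝ) + 1) ^ 3) := by
  have hN : (0 : ℝ) < (N : ℝ) + 1 := by positivity
  have hM : (0 : ℝ) < (M : ℝ) + 1 := by positivity
  have e : concaveWeight N = concaveWeight M + ((N : ℝ) - M) / ((M : ℝ) + 1) ^ 2 -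
      ((N : ℝ) - M) ^ 2 / (((M : ℝ) + 1) ^ 2 * ((N : ℝ) + 1)) := by
    unfold concaveWeight; field_simp; ring
  rw [e]
  refine sub_le_sub_left ?_ _
  rcases le_or_gt M N with h | h
  · have h' : (0 : ℝ) ≤ (N : ℝ) - M := sub_nonneg.2 (by exact_mod_cast h)
    rw [abs_of_nonneg h', sub_self, zero_div]
    positivity
  · have h' : (N : ℝ) + 1 ≤ M := by exact_mod_cast h
    rw [abs_of_neg (by linarith)]
    have h1 : (-((N : ℝ) - M) - ((N : ℝ) - M)) / (2 * ((M : ℝ) + 1) ^ 3) =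
        (M - N) / (((M : ℝ) + 1) ^ 2 * ((M : ℝ) + 1)) := by
      field_simp
      ring
    rw [h1]
    refine div_le_div₀ (sq_nonneg _) ?_ (by positivity) ?_
    · nlinarith
    · gcongr

theorem integral_concaveWeight_mult_le {n : ℕ} {A : Matrix (Fin n) (Fin n) ℝ} (hA : A.det = 1)
    {S : Finset (Fin n → ℝ)} {T : Finset (Fin n → ℤ)}
    (hT : ∀ x : Fin n → ℝ, (∀ i, x i ∈ Ioc (0 : ℝ) 1) → ∀ q : Fin n → ℤ, q ∉ T → ∀ s ∈ S,
      x + (fun i => (q i : ℝ)) ∉ cell A s) {i₀ : Fin n} {m : ℕ} {c : ℝ} (hc : 0 ≤ c)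
    (hnd : Nondeg i₀ m c A) (hS : S.Nonempty) (hSm : S.card ≤ m) :
    ∫ x, concaveWeight (mult A S T x) ∂(cubeMeasure n) ≤
      concaveWeight S.card - c / (2 * ((m : ℝ) + 1) ^ 3) := by
  have h0 := integral_mult hA hT i₀
  have h1 := le_integral_abs_mult_sub hA hT hnd hS hSm
  set M : ℝ := (S.card : ℝ) with hM
  have i0 : Integrable (fun x => (mult A S T x : ℝ)) (cubeMeasure n) :=
    integrable_comp_mult A S T (g := id) measurable_id
  have i1 : Integrable (fun x => (mult A S T x : ℝ) - M) (cubeMeasure n) :=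
    integrable_comp_mult A S T (g := fun y => y - M) (by fun_prop)
  have i2 : Integrable (fun x => |(mult A S T x : ℝ) - M|) (cubeMeasure n) := i1.abs
  have i3 : ∫ x, ((mult A S T x : ℝ) - M) ∂(cubeMeasure n) = 0 := by
    rw [integral_sub i0 (integrable_const _), h0, integral_const, probReal_univ, one_smul, sub_self]
  have i4 : Integrable (fun x => concaveWeight M + ((mult A S T x : ℝ) - M) / (M + 1) ^ 2)
      (cubeMeasure n) := (integrable_const _).add (i1.div_const _)
  have i5 : Integrable (fun x => |(mult A S T x : ℝ) - M| - ((mult A S T x : ℝ) - M))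
      (cubeMeasure n) := i2.sub i1
  have h2 : ∫ x, concaveWeight (mult A S T x) ∂(cubeMeasure n) ≤
      ∫ x, (concaveWeight M + ((mult A S T x : ℝ) - M) / (M + 1) ^ 2 -
        (|(mult A S T x : ℝ) - M| - ((mult A S T x : ℝ) - M)) / (2 * (M + 1) ^ 3))
          ∂(cubeMeasure n) := by
    refine integral_mono (integrable_comp_mult A S T measurable_concaveWeight)
      (i4.sub (i5.div_const _)) fun x => ?_
    exact concaveWeight_le _ _
  rw [integral_sub i4 (i5.div_const _),
    integral_add (integrable_const _) (i1.div_const _), integral_div, integral_div,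
    integral_sub i2 i1, i3] at h2
  simp only [integral_const, probReal_univ, one_smul, zero_div, add_zero, sub_zero] at h2
  refine h2.trans (sub_le_sub_left ?_ _)
  have hMm : M ≤ m := by rw [hM]; exact_mod_cast hSm
  have hM0 : 0 ≤ M := Nat.cast_nonneg _
  exact div_le_div₀ (hc.trans h1) h1 (by positivity) (by gcongr)

/-- The points of the torus from which the backward chains starting in `S` survive. -/
def aliveSet {n : ℕ} (k : ℕ) (B : Fin k → Matrix (Fin n) (Fin n) ℝ) (S : Set (Fin n → ℝ)) :
    Set (Fin k → Fin n → ℝ) :=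
  {X | ∃ s ∈ S, ∃ q : Fin k → Fin n → ℤ, Chain 0 k B (X + fun j i => (q j i : ℝ)) s}

theorem aliveSet_succ {n k : ℕ} (B : Fin (k + 1) → Matrix (Fin n) (Fin n) ℝ)
    (S : Set (Fin n → ℝ)) (X : Fin (k + 1) → Fin n → ℝ) :
    X ∈ aliveSet (k + 1) B S ↔ (fun j => X j.succ) ∈ aliveSet k (fun j => B j.succ)
      {w | (∃ q : Fin n → ℤ, w = X 0 + fun i => (q i : ℝ)) ∧ ∃ s ∈ S, w ∈ cell (B 0) s} := by
  constructor
  · rintro ⟨s, hs, q, h0, h⟩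
    refine ⟨_, ⟨⟨q 0, rfl⟩, s, hs, ?_⟩, fun j => q j.succ, h⟩
    simpa [cell] using h0
  · rintro ⟨w, ⟨⟨q, rfl⟩, s, hs, hw⟩, q', h⟩
    refine ⟨s, hs, Fin.cons q q', ?_, ?_⟩
    · simpa [cell] using hw
    · simpa [Pi.add_def] using h

theorem measurableSet_aliveSet {n : ℕ} (k : ℕ) (B : Fin k → Matrix (Fin n) (Fin n) ℝ)
    {S : Set (Fin n → ℝ)} (hS : S.Countable) : MeasurableSet (aliveSet k B S) := by
  have : aliveSet k B S = ⋃ s ∈ S, ⋃ q : Fin k → Fin n → ℤ,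
      {X | Chain 0 k B (X + fun j i => (q j i : ℝ)) s} := by
    ext X; simp [aliveSet]
  rw [this]
  refine MeasurableSet.biUnion hS fun s _ => MeasurableSet.iUnion fun q => IsClosed.measurableSet ?_
  exact (isClosed_chain 0 k B).preimage
    (f := fun X => (X + (fun j i => (q j i : ℝ)), s)) (by fun_prop)

theorem cubePow_aliveSet_succ {n k : ℕ} (B : Fin (k + 1) → Matrix (Fin n) (Fin n) ℝ)
    {S : Set (Fin n → ℝ)} (hS : S.Countable) :
    cubePow (k + 1) n (aliveSet (k + 1) B S) = ∫⁻ x, cubePow k n (aliveSet k (fun j => B j.succ)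
      {w | (∃ q : Fin n → ℤ, w = x + fun i => (q i : ℝ)) ∧ ∃ s ∈ S, w ∈ cell (B 0) s})
        ∂(cubeMeasure n) := by
  have hmp := (measurePreserving_piFinSuccAbove (fun _ : Fin (k + 1) => cubeMeasure n) 0).symm
  have hm := measurableSet_aliveSet (k + 1) B hS
  rw [cubePow, ← hmp.measure_preimage hm.nullMeasurableSet,
    Measure.prod_apply (hmp.measurable hm)]
  refine lintegral_congr fun x => ?_
  rw [cubePow]
  congr 1
  ext Y
  rw [mem_preimage, mem_preimage, aliveSet_succ]
  simp [MeasurableEquiv.piFinSuccAbove, Fin.insertNthEquiv]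

theorem aliveSet_empty {n k : ℕ} (B : Fin k → Matrix (Fin n) (Fin n) ℝ) :
    aliveSet k B (∅ : Set (Fin n → ℝ)) = ∅ := by
  ext X; simp [aliveSet]

theorem exists_finset_step {n : ℕ} {A : Matrix (Fin n) (Fin n) ℝ}
    {S : Finset (Fin n → ℝ)} {T : Finset (Fin n → ℤ)} {x : Fin n → ℝ}
    (hT : ∀ q : Fin n → ℤ, q ∉ T → ∀ s ∈ S, x + (fun i => (q i : ℝ)) ∉ cell A s) :
    ∃ S' : Finset (Fin n → ℝ), S'.card ≤ mult A S T x ∧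
      {w | (∃ q : Fin n → ℤ, w = x + fun i => (q i : ℝ)) ∧ ∃ s ∈ (S : Set (Fin n → ℝ)),
        w ∈ cell A s} = (S' : Set (Fin n → ℝ)) := by
  classical
  refine ⟨(T.filter fun q => ∃ s ∈ S, x + (fun i => (q i : ℝ)) ∈ cell A s).image
    fun q => x + fun i => (q i : ℝ), ?_, ?_⟩
  · refine Finset.card_image_le.trans ?_
    rw [Finset.card_filter, mult]
    refine Finset.sum_le_sum fun q _ => ?_
    split_ifs with h
    · obtain ⟨s, hs, h⟩ := h
      exact Finset.card_pos.2 ⟨s, Finset.mem_filter.2 ⟨hs, h⟩⟩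
    · exact Nat.zero_le _
  · ext w
    simp only [mem_ofPred_eq, Finset.coe_image, Finset.coe_filter, mem_image, Finset.mem_coe]
    constructor
    · rintro ⟨⟨q, rfl⟩, s, hs, h⟩
      refine ⟨q, ⟨?_, s, hs, h⟩, rfl⟩
      by_contra hq
      exact hT q hq s hs h
    · rintro ⟨q, ⟨_, s, hs, h⟩, rfl⟩
      exact ⟨⟨q, rfl⟩, s, hs, h⟩

theorem concaveWeight_mono {x y : ℝ} (hx : 0 ≤ x) (hxy : x ≤ y) :
    concaveWeight x ≤ concaveWeight y := by
  unfold concaveWeight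
  rw [div_le_div_iff₀ (by linarith) (by linarith)]
  nlinarith

theorem concaveWeight_nonneg {x : ℝ} (hx : 0 ≤ x) : 0 ≤ concaveWeight x := by
  unfold concaveWeight; positivity

/-- The survival probability of the backward chains, a critical branching mechanism. -/
theorem cubePow_aliveSet_le {n : ℕ} (i₀ : Fin n) {m : ℕ} (hm : 1 ≤ m) {c : ℝ} (hc : 0 < c)
    (hc1 : c ≤ 1) : ∀ (k : ℕ) (B : Fin k → Matrix (Fin n) (Fin n) ℝ), (∀ j, (B j).det = 1) →
    (∀ j, Nondeg i₀ m c (B j)) → ∀ S : Finset (Fin n → ℝ),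
    cubePow k n (aliveSet k B (S : Set (Fin n → ℝ))) ≤ ENNReal.ofReal ((S.card : ℝ) / m +
      concaveWeight S.card / (c / (2 * ((m : ℝ) + 1) ^ 3) * (k + 1))) := by
  have hm0 : (0 : ℝ) < m := by exact_mod_cast hm
  set d : ℝ := c / (2 * ((m : ℝ) + 1) ^ 3) with hd
  have hd0 : 0 < d := by positivity
  have hd1 : d ≤ 1 / 2 := by
    rw [hd]
    refine div_le_div₀ zero_le_one hc1 (by norm_num) ?_
    have : (1 : ℝ) ≤ ((m : ℝ) + 1) ^ 3 := one_le_pow₀ (by linarith)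
    linarith
  intro k
  induction k with
  | zero =>
    intro B _ _ S
    rcases S.eq_empty_or_nonempty with rfl | hS
    · simp [aliveSet_empty]
    · refine prob_le_one.trans (ENNReal.one_le_ofReal.2 ?_)
      have h1 : (1 : ℝ) ≤ S.card := by exact_mod_cast hS.card_pos
      have h2 : d ≤ concaveWeight S.card := by
        refine hd1.trans ((le_of_eq ?_).trans (concaveWeight_mono zero_le_one h1))
        norm_num [concaveWeight]
      have h3 : 1 ≤ concaveWeight S.card / (d * ((0 : ℕ) + 1)) := by
        rw [Nat.cast_zero, zero_add, mul_one, le_div_iff₀ hd0, one_mul]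
        exact h2
      have h4 : (0 : ℝ) ≤ (S.card : ℝ) / m := by positivity
      linarith
  | succ k ih =>
    intro B hB hnd S
    rcases S.eq_empty_or_nonempty with rfl | hS
    · simp [aliveSet_empty]
    rcases lt_or_ge m S.card with hSm | hSm
    · refine prob_le_one.trans (ENNReal.one_le_ofReal.2 ?_)
      have h1 : (1 : ℝ) ≤ (S.card : ℝ) / m := by
        rw [le_div_iff₀ hm0, one_mul]; exact_mod_cast hSm.le
      have h2 := concaveWeight_nonneg (Nat.cast_nonneg (α := ℝ) S.card)
      have h3 : 0 ≤ concaveWeight S.card / (d * ((k + 1 : ℕ) + 1)) := by positivity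
      linarith
    · obtain ⟨T, hT⟩ := exists_finset_translates (hB 0) S
      set v : (Fin n → ℝ) → ℝ := fun x => (mult (B 0) S T x : ℝ) / m +
        concaveWeight (mult (B 0) S T x) / (d * (k + 1)) with hv
      have hv0 : ∀ x, 0 ≤ v x := fun x => by
        have := concaveWeight_nonneg (Nat.cast_nonneg (α := ℝ) (mult (B 0) S T x))
        positivity
      have i1 : Integrable (fun x => (mult (B 0) S T x : ℝ)) (cubeMeasure n) :=
        integrable_comp_mult (B 0) S T (g := id) measurable_id
      have i2 := integrable_comp_mult (B 0) S T measurable_concaveWeight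
      have hvi : Integrable v (cubeMeasure n) := (i1.div_const _).add (i2.div_const _)
      have hub : cubePow (k + 1) n (aliveSet (k + 1) B (S : Set (Fin n → ℝ))) ≤
          ENNReal.ofReal (∫ x, v x ∂(cubeMeasure n)) := by
        rw [cubePow_aliveSet_succ B S.countable_toSet,
          ofReal_integral_eq_lintegral_ofReal hvi (Eventually.of_forall hv0)]
        refine lintegral_mono_ae ?_
        filter_upwards [ae_mem_cube n] with x hx
        obtain ⟨S', hS'c, hS'⟩ := exists_finset_step (A := B 0) (hT x hx)
        rw [hS']
        refine (ih _ (fun j => hB j.succ) (fun j => hnd j.succ) S').trans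
          (ENNReal.ofReal_le_ofReal ?_)
        have h1 : (S'.card : ℝ) ≤ mult (B 0) S T x := by exact_mod_cast hS'c
        have h2 := concaveWeight_mono (Nat.cast_nonneg _) h1
        rw [hv]
        simp only
        gcongr
      have hvint : ∫ x, v x ∂(cubeMeasure n) ≤
          (S.card : ℝ) / m + (concaveWeight S.card - d) / (d * (k + 1)) := by
        rw [hv, integral_add (i1.div_const _) (i2.div_const _), integral_div, integral_div,
          integral_mult (hB 0) hT i₀]
        have := integral_concaveWeight_mult_le (hB 0) hT hc.le (hnd 0) hS hSm
        gcongr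
      have hle1 := prob_le_one (μ := cubePow (k + 1) n)
        (s := aliveSet (k + 1) B (S : Set (Fin n → ℝ)))
      set u := cubePow (k + 1) n (aliveSet (k + 1) B (S : Set (Fin n → ℝ))) with hu
      have hutop : u ≠ ⊤ := measure_ne_top _ _
      rw [← ENNReal.ofReal_toReal hutop]
      refine ENNReal.ofReal_le_ofReal ?_
      have hu1 : u.toReal ≤ 1 := by
        simpa using ENNReal.toReal_mono ENNReal.one_ne_top hle1
      have hu2 : u.toReal ≤ (S.card : ℝ) / m + (concaveWeight S.card - d) / (d * (k + 1)) := by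
        refine le_trans ?_ hvint
        exact ENNReal.toReal_le_of_le_ofReal (integral_nonneg hv0) hub
      have hk : (0 : ℝ) < (k : ℝ) + 1 := by positivity
      have e1 : (S.card : ℝ) / m + concaveWeight S.card / (d * ((k + 1 : ℕ) + 1)) =
          (((k : ℝ) + 1 + 1) * ((S.card : ℝ) / m) + concaveWeight S.card / d) / ((k : ℝ) + 1 + 1) := by
        push_cast; field_simp
      rw [e1, le_div_iff₀ (by positivity)]
      have e2 : (concaveWeight S.card - d) / (d * (k + 1)) * ((k : ℝ) + 1) =
          concaveWeight S.card / d - 1 := by field_simp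
      have h3 := mul_le_mul_of_nonneg_right hu2 hk.le
      rw [add_mul, e2] at h3
      have h4 : (0 : ℝ) ≤ (S.card : ℝ) / m := by positivity
      linarith

end LinDiscr
end

noncomputable section
namespace LinDiscr

/-! ### Genericity -/

theorem freq_succ {n k : ℕ} (B : Fin (k + 1) → Matrix (Fin n) (Fin n) ℝ)
    (m : Fin (k + 1) → Fin n → ℤ) (v : Fin n → ℝ) :
    freq B m v = (fun i => (m 0 i : ℝ)) ⬝ᵥ ((B 0).adjugate.mulVec v) +
      freq (fun j => B j.succ) (fun j => m j.succ) ((B 0).adjugate.mulVec v) := by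
  simp [freq, Fin.sum_univ_succ, orb, dotProduct]

theorem exists_orthogonal_pair {n : ℕ} (hn : 2 ≤ n) {a v : Fin n → ℝ} (ha : a ≠ 0) (hv : v ≠ 0) :
    ∃ p q : Fin n → ℝ, q ⬝ᵥ p = 0 ∧ a ⬝ᵥ p ≠ 0 ∧ q ⬝ᵥ v ≠ 0 := by
  obtain ⟨x, hx⟩ := Function.ne_iff.1 ha
  obtain ⟨y, hy⟩ := Function.ne_iff.1 hv
  simp only [Pi.zero_apply] at hx hy
  by_cases h : ∃ x y, x ≠ y ∧ a x ≠ 0 ∧ v y ≠ 0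
  · obtain ⟨x, y, hxy, hx, hy⟩ := h
    refine ⟨Pi.single x 1, Pi.single y 1, ?_, ?_, ?_⟩
    · simp [hxy]
    · simpa using hx
    · simpa using hy
  · push Not at h
    have hxy : x = y := by
      by_contra hne
      exact hy (h x y hne hx)
    subst hxy
    have : Nontrivial (Fin n) := Fin.nontrivial_iff_two_le.2 hn
    obtain ⟨z, hz⟩ := exists_ne x
    have hvz : v z = 0 := h x z hz.symm hx
    have haz : a z = 0 := by
      by_contra hne
      exact hy (h z x hz hne)
    refine ⟨Pi.single x 1 + Pi.single z 1, Pi.single x 1 - Pi.single z 1, ?_, ?_, ?_⟩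
    · simp [dotProduct_add, hz, hz.symm]
    · simpa [dotProduct_add, haz] using hx
    · simpa [sub_dotProduct, hvz] using hy

theorem exists_shear {n : ℕ} {A : Matrix (Fin n) (Fin n) ℝ} (hA : A.det = 1)
    {p q : Fin n → ℝ} (hpq : q ⬝ᵥ p = 0) {δ : ℝ} (hδ : 0 < δ) :
    ∃ (t : ℝ) (A' : Matrix (Fin n) (Fin n) ℝ), t ≠ 0 ∧ A'.det = 1 ∧
      (∀ a b, |A' a b - A a b| < δ) ∧
      ∀ v, A'.adjugate.mulVec v = A.adjugate.mulVec (v + (t * (q ⬝ᵥ v)) • p) := by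
  set U : Matrix (Fin n) (Fin n) ℝ := Matrix.vecMulVec p q with hU
  have hUU : U * U = 0 := by
    rw [hU, Matrix.vecMulVec_mul_vecMulVec, hpq, zero_smul]
    ext i j; simp [Matrix.vecMulVec_apply]
  have hUv : ∀ v, U.mulVec v = (q ⬝ᵥ v) • p := by
    intro v
    ext i
    simp [hU, Matrix.vecMulVec_mulVec, mul_comm]
  set M : ℝ := ∑ a, ∑ b, |(U * A) a b| with hM
  have hM0 : 0 ≤ M := by positivity
  set t : ℝ := δ / (M + 1) with ht
  have ht0 : 0 < t := by positivity
  have hdet : (1 - t • U).det = 1 := by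
    have h := Matrix.det_one_add_replicateCol_mul_replicateRow (ι := Unit) (-(t • p)) q
    have e : Matrix.replicateCol Unit (-(t • p)) * Matrix.replicateRow Unit q = -(t • U) := by
      ext i j
      simp [Matrix.mul_apply, hU, Matrix.vecMulVec_apply, mul_assoc]
    rw [e, ← sub_eq_add_neg] at h
    rw [h]
    simp [hpq]
  have hinv : (1 - t • U) * (1 + t • U) = 1 := by
    rw [sub_mul, mul_add, mul_add, one_mul, one_mul, mul_one, Matrix.smul_mul, Matrix.mul_smul, hUU]
    simp
  have hadj : (1 - t • U).adjugate = 1 + t • U := by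
    have h : (1 - t • U).adjugate * ((1 - t • U) * (1 + t • U)) = (1 - t • U).adjugate * 1 := by
      rw [hinv]
    rw [← mul_assoc, Matrix.adjugate_mul, hdet, one_smul, one_mul, mul_one] at h
    exact h.symm
  refine ⟨t, (1 - t • U) * A, ht0.ne', ?_, ?_, ?_⟩
  · rw [Matrix.det_mul, hdet, hA, one_mul]
  · intro a b
    have e : ((1 - t • U) * A) a b - A a b = -(t * (U * A) a b) := by
      rw [sub_mul, one_mul, Matrix.smul_mul, Matrix.sub_apply, Matrix.smul_apply, smul_eq_mul]
      ring
    rw [e, abs_neg, abs_mul, abs_of_pos ht0]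
    have h1 : |(U * A) a b| ≤ M :=
      (Finset.single_le_sum (f := fun b => |(U * A) a b|) (fun _ _ => abs_nonneg _)
        (Finset.mem_univ b)).trans (Finset.single_le_sum (f := fun a => ∑ b, |(U * A) a b|)
        (fun _ _ => Finset.sum_nonneg fun _ _ => abs_nonneg _) (Finset.mem_univ a))
    calc t * |(U * A) a b| ≤ t * M := by gcongr
      _ < t * (M + 1) := by gcongr; linarith
      _ = δ := by rw [ht]; field_simp
  · intro v
    rw [Matrix.adjugate_mul_distrib, hadj, ← Matrix.mulVec_mulVec, Matrix.add_mulVec,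
      Matrix.one_mulVec, Matrix.smul_mulVec, hUv, smul_smul]

theorem exists_perturbation_freq_ne {n : ℕ} (hn : 2 ≤ n) : ∀ {k : ℕ}
    (B : Fin k → Matrix (Fin n) (Fin n) ℝ), (∀ j, (B j).det = 1) → ∀ (m : Fin k → Fin n → ℤ),
    m ≠ 0 → ∀ v : Fin n → ℝ, v ≠ 0 → ∀ (c δ : ℝ), 0 < δ →
    ∃ B' : Fin k → Matrix (Fin n) (Fin n) ℝ, (∀ j, (B' j).det = 1) ∧
      (∀ j a b, |B' j a b - B j a b| < δ) ∧ freq B' m v ≠ c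
  | 0, _, _, m, hm, _, _, _, _, _ => absurd (Subsingleton.elim m 0) hm
  | k + 1, B, hB, m, hm, v, hv, c, δ, hδ => by
    by_cases hm' : (fun j : Fin k => m j.succ) = 0
    · have hfr : ∀ B' : Fin (k + 1) → Matrix (Fin n) (Fin n) ℝ,
          freq B' m v = (fun i => (m 0 i : ℝ)) ⬝ᵥ ((B' 0).adjugate.mulVec v) := by
        intro B'
        rw [freq_succ, hm']
        simp [freq]
      by_cases hc : freq B m v = c
      · set m₀ : Fin n → ℝ := fun i => (m 0 i : ℝ) with hm₀
        have hm0 : m₀ ≠ 0 := by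
          intro h
          apply hm
          ext j i
          refine Fin.cases ?_ (fun j => ?_) j
          · have := congrFun h i
            simpa [hm₀] using this
          · exact congrFun (congrFun hm' j) i
        set a := Matrix.vecMul m₀ (B 0).adjugate with ha
        have ha0 : a ≠ 0 := by
          intro h
          apply hm0
          have h1 : Matrix.vecMul a (B 0) = m₀ := by
            rw [ha, Matrix.vecMul_vecMul, Matrix.adjugate_mul, hB 0, one_smul, Matrix.vecMul_one]
          rw [← h1, h, Matrix.zero_vecMul]
        obtain ⟨p, q, hpq, hap, hqv⟩ := exists_orthogonal_pair hn ha0 hv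
        obtain ⟨t, A', ht, hA', hclose, hadj⟩ := exists_shear (hB 0) hpq hδ
        refine ⟨Fin.cons A' fun j => B j.succ, ?_, ?_, ?_⟩
        · refine Fin.cases (by simpa using hA') fun j => by simpa using hB j.succ
        · refine Fin.cases (by simpa using hclose) fun j => by simpa using fun _ _ => hδ
        · rw [hfr, Fin.cons_zero, hadj, Matrix.dotProduct_mulVec, ← ha, dotProduct_add,
            dotProduct_smul]
          rw [hfr, Matrix.dotProduct_mulVec, ← ha] at hc
          rw [hc, smul_eq_mul]
          intro h
          have h1 : t * (q ⬝ᵥ v) * (a ⬝ᵥ p) = 0 := by linarith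
          exact mul_ne_zero (mul_ne_zero ht hqv) hap h1
      · exact ⟨B, hB, fun j a b => by simpa using hδ, hc⟩
    · have hv' : (B 0).adjugate.mulVec v ≠ 0 := by
        intro h
        apply hv
        rw [← mulVec_adjugate_mulVec (hB 0) v, h, Matrix.mulVec_zero]
      obtain ⟨B', hB', hclose, hne⟩ := exists_perturbation_freq_ne hn (fun j => B j.succ)
        (fun j => hB j.succ) _ hm' _ hv'
        (c - (fun i => (m 0 i : ℝ)) ⬝ᵥ ((B 0).adjugate.mulVec v)) δ hδ
      refine ⟨Fin.cons (B 0) B', ?_, ?_, ?_⟩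
      · refine Fin.cases (by simpa using hB 0) fun j => by simpa using hB' j
      · refine Fin.cases (by simpa using fun _ _ => hδ) fun j => by simpa using hclose j
      · rw [freq_succ]
        simp only [Fin.cons_zero, Fin.cons_succ]
        intro h
        apply hne
        linarith

theorem continuous_orb {n : ℕ} : ∀ k : ℕ,
    Continuous fun p : (Fin k → Matrix (Fin n) (Fin n) ℝ) × (Fin n → ℝ) => orb k p.1 p.2
  | 0 => continuous_pi fun j => j.elim0
  | k + 1 => by
    have h0 : Continuous fun p : (Fin (k + 1) → Matrix (Fin n) (Fin n) ℝ) × (Fin n → ℝ) =>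
        (p.1 0).adjugate.mulVec p.2 :=
      (((continuous_apply 0).comp continuous_fst).matrix_adjugate).matrix_mulVec continuous_snd
    refine continuous_pi fun j => ?_
    refine Fin.cases ?_ (fun j => ?_) j
    · exact h0
    · have h1 : Continuous fun p : (Fin (k + 1) → Matrix (Fin n) (Fin n) ℝ) × (Fin n → ℝ) =>
          ((fun j : Fin k => p.1 j.succ), (p.1 0).adjugate.mulVec p.2) :=
        (continuous_pi fun j => (continuous_apply j.succ).comp continuous_fst).prodMk h0
      exact (continuous_apply j).comp ((continuous_orb k).comp h1)

theorem continuous_freq {n k : ℕ} (m : Fin k → Fin n → ℤ) (v : Fin n → ℝ) :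
    Continuous fun B : Fin k → Matrix (Fin n) (Fin n) ℝ => freq B m v := by
  have h : Continuous fun B : Fin k → Matrix (Fin n) (Fin n) ℝ => orb k B v :=
    (continuous_orb k).comp (continuous_id.prodMk continuous_const)
  unfold freq
  fun_prop

/-- Finite sequences of matrices of determinant `1`. -/
abbrev UnimodularTuple (k n : ℕ) : Type :=
  {B : Fin k → Matrix (Fin n) (Fin n) ℝ // ∀ j, (B j).det = 1}

theorem isClosed_unimodular (k n : ℕ) :
    IsClosed {B : Fin k → Matrix (Fin n) (Fin n) ℝ | ∀ j, (B j).det = 1} := by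
  simp only [ofPred_forall]
  refine isClosed_iInter fun j => isClosed_eq ?_ continuous_const
  exact (continuous_apply j).matrix_det

theorem locallyCompactSpace_unimodularTuple (k n : ℕ) :
    LocallyCompactSpace (UnimodularTuple k n) := by
  have : LocallyCompactSpace (Fin k → Matrix (Fin n) (Fin n) ℝ) :=
    inferInstanceAs (LocallyCompactSpace (Fin k → Fin n → Fin n → ℝ))
  exact (isClosed_unimodular k n).isClosedEmbedding_subtypeVal.locallyCompactSpace

theorem exists_generic_mem {n : ℕ} (hn : 2 ≤ n) {k : ℕ} {O : Set (UnimodularTuple k n)}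
    (hO : IsOpen O) (hne : O.Nonempty) :
    ∃ B ∈ O, ∀ m : Fin k → Fin n → ℤ, m ≠ 0 → ∀ (i : Fin n) (c : ℤ),
      freq B.1 m (Pi.single i 1) ≠ c := by
  have := locallyCompactSpace_unimodularTuple k n
  have hd : Dense (⋂ p : {m : Fin k → Fin n → ℤ // m ≠ 0} × Fin n × ℤ,
      {B : UnimodularTuple k n | freq B.1 p.1.1 (Pi.single p.2.1 1) ≠ (p.2.2 : ℝ)}) := by
    refine dense_iInter_of_isOpen (fun p => ?_) fun p => ?_
    · exact isOpen_ne_fun ((continuous_freq _ _).comp continuous_subtype_val) continuous_const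
    · intro B
      have hstep := fun N : ℕ => exists_perturbation_freq_ne hn B.1 B.2 p.1.1 p.1.2
        (Pi.single p.2.1 (1 : ℝ)) (by simp) (p.2.2 : ℝ) (1 / ((N : ℝ) + 1)) (by positivity)
      choose B' hB' hclose hne using hstep
      refine mem_closure_of_tendsto (f := fun N => (⟨B' N, hB' N⟩ : UnimodularTuple k n))
        (b := atTop) ?_ (Eventually.of_forall fun N => hne N)
      rw [tendsto_subtype_rng]
      refine tendsto_pi_nhds.2 fun j => tendsto_pi_nhds.2 fun a => tendsto_pi_nhds.2 fun b => ?_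
      rw [tendsto_iff_dist_tendsto_zero]
      refine squeeze_zero (fun _ => dist_nonneg) (fun N => ?_)
        (tendsto_one_div_add_atTop_nhds_zero_nat (𝕜 := ℝ))
      rw [Real.dist_eq]
      exact (hclose N j a b).le
  obtain ⟨B, hBO, hB⟩ := hd.inter_open_nonempty O hO hne
  refine ⟨B, hBO, fun m hm i c => ?_⟩
  exact mem_iInter.1 hB (⟨m, hm⟩, i, c)

theorem isOpen_close {n k : ℕ} (B : Fin k → Matrix (Fin n) (Fin n) ℝ) (δ : ℝ) :
    IsOpen {B' : Fin k → Matrix (Fin n) (Fin n) ℝ | ∀ j a b, |B' j a b - B j a b| < δ} := by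
  simp only [ofPred_forall]
  refine isOpen_iInter_of_finite fun j => isOpen_iInter_of_finite fun a =>
    isOpen_iInter_of_finite fun b => isOpen_lt ?_ continuous_const
  have : Continuous fun B' : Fin k → Matrix (Fin n) (Fin n) ℝ => B' j a b :=
    (continuous_apply j).matrix_elem a b
  fun_prop

theorem continuous_prod_sinc {n : ℕ} (i₀ : Fin n) (j : ℕ) :
    Continuous fun A : Matrix (Fin n) (Fin n) ℝ =>
      |∏ i, Real.sinc (Real.pi * (j * A.adjugate i₀ i))| := by
  refine (continuous_finsetProd _ fun i _ => Real.continuous_sinc.comp ?_).abs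
  have : Continuous fun A : Matrix (Fin n) (Fin n) ℝ => A.adjugate i₀ i :=
    continuous_id.matrix_adjugate.matrix_elem i₀ i
  fun_prop

/-- The open form of `Nondeg`. -/
def StrictNondeg {n : ℕ} (i₀ : Fin n) (m : ℕ) (c : ℝ) (A : Matrix (Fin n) (Fin n) ℝ) : Prop :=
  ∀ j ∈ Finset.Icc 1 m, c < |∏ i, Real.sinc (Real.pi * ((j : ℕ) * A.adjugate i₀ i))|

theorem isOpen_strictNondeg {n : ℕ} (i₀ : Fin n) (m : ℕ) (c : ℝ) :
    IsOpen {A : Matrix (Fin n) (Fin n) ℝ | StrictNondeg i₀ m c A} := by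
  simp only [StrictNondeg, ofPred_forall]
  exact isOpen_biInter_finset fun j _ => isOpen_lt continuous_const (continuous_prod_sinc i₀ j)

theorem sinc_pi_mul_ne_zero {x : ℝ} (hx : ∀ c : ℤ, x ≠ c) : Real.sinc (Real.pi * x) ≠ 0 := by
  have hx0 : x ≠ 0 := by simpa using hx 0
  have hpx : Real.pi * x ≠ 0 := mul_ne_zero Real.pi_ne_zero hx0
  rw [Real.sinc_of_ne_zero hpx]
  refine div_ne_zero (fun h => ?_) hpx
  obtain ⟨c, hc⟩ := Real.sin_eq_zero_iff.1 h
  apply hx c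
  rw [mul_comm] at hc
  exact (mul_left_cancel₀ Real.pi_ne_zero hc).symm

theorem exists_strictNondeg_close {n : ℕ} (hn : 2 ≤ n) (i₀ : Fin n) (m : ℕ)
    {A : Matrix (Fin n) (Fin n) ℝ} (hA : A.det = 1) {δ : ℝ} (hδ : 0 < δ) :
    ∃ (G : Matrix (Fin n) (Fin n) ℝ) (c : ℝ), 0 < c ∧ G.det = 1 ∧ (∀ a b, |G a b - A a b| < δ) ∧
      StrictNondeg i₀ m c G := by
  obtain ⟨B, hB, hgen⟩ := exists_generic_mem hn (k := 1)
    ((isOpen_close (fun _ => A) δ).preimage continuous_subtype_val)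
    ⟨⟨fun _ => A, fun _ => hA⟩, by simpa using fun _ _ => hδ⟩
  set G := B.1 0 with hG
  have hpos : ∀ j ∈ Finset.Icc 1 m,
      0 < |∏ i, Real.sinc (Real.pi * ((j : ℕ) * G.adjugate i₀ i))| := by
    intro j hj
    rw [abs_pos, Finset.prod_ne_zero_iff]
    intro i _
    refine sinc_pi_mul_ne_zero fun c => ?_
    have hj1 : 1 ≤ j := (Finset.mem_Icc.1 hj).1
    have h := hgen (fun _ => Pi.single i₀ (j : ℤ)) (by
      intro h
      have := congrFun (congrFun h 0) i₀
      simp at this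
      omega) i c
    rw [freq_succ] at h
    have e : (fun l => ((Pi.single i₀ (j : ℤ) : Fin n → ℤ) l : ℝ)) = Pi.single i₀ (j : ℝ) := by
      ext l
      by_cases hl : l = i₀
      · subst hl; simp
      · simp [hl]
    rw [e] at h
    simpa [freq, hG] using h
  obtain ⟨c, hc, hcm⟩ : ∃ c : ℝ, 0 < c ∧ ∀ j ∈ Finset.Icc 1 m,
      c < |∏ i, Real.sinc (Real.pi * ((j : ℕ) * G.adjugate i₀ i))| := by
    have hev : ∀ᶠ c : ℝ in 𝓝[>] 0, ∀ j ∈ Finset.Icc 1 m,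
        c < |∏ i, Real.sinc (Real.pi * ((j : ℕ) * G.adjugate i₀ i))| :=
      (Finset.eventually_all _).2 fun j hj => mem_nhdsWithin_of_mem_nhds
        (Iio_mem_nhds (hpos j hj))
    obtain ⟨c, h1, h2⟩ := (hev.and self_mem_nhdsWithin).exists
    exact ⟨c, h2, h1⟩
  exact ⟨G, c, hc, B.2 0, fun a b => hB 0 a b, hcm⟩

theorem exists_uniform_strictNondeg {n : ℕ} (hn : 2 ≤ n) (i₀ : Fin n) (m : ℕ) (K : ℝ) {δ : ℝ}
    (hδ : 0 < δ) : ∃ c : ℝ, 0 < c ∧ ∀ A : Matrix (Fin n) (Fin n) ℝ, A.det = 1 →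
      (∀ a b, |A a b| ≤ K) → ∃ G : Matrix (Fin n) (Fin n) ℝ, G.det = 1 ∧
        (∀ a b, |G a b - A a b| < δ) ∧ StrictNondeg i₀ m c G := by
  set 𝒦 : Set (Matrix (Fin n) (Fin n) ℝ) := {A | A.det = 1 ∧ ∀ a b, |A a b| ≤ K} with h𝒦
  have hcpt : IsCompact 𝒦 := by
    have h1 : IsCompact {A : Matrix (Fin n) (Fin n) ℝ | ∀ a, A a ∈ {r | ∀ b, r b ∈ Icc (-K) K}} :=
      isCompact_pi_infinite fun _ => isCompact_pi_infinite fun _ => isCompact_Icc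
    refine h1.of_isClosed_subset ?_ fun A hA a b => abs_le.1 (hA.2 a b)
    have h2 : IsClosed {A : Matrix (Fin n) (Fin n) ℝ | A.det = 1} :=
      isClosed_eq continuous_id.matrix_det continuous_const
    suffices h3 : IsClosed {A : Matrix (Fin n) (Fin n) ℝ | ∀ a b, |A a b| ≤ K} from h2.inter h3
    simp only [ofPred_forall]
    refine isClosed_iInter fun a => isClosed_iInter fun b => isClosed_le ?_ continuous_const
    exact (continuous_id.matrix_elem a b).abs
  have key : ∃ c : ℝ, 0 < c ∧ ∀ A ∈ 𝒦, ∃ G : Matrix (Fin n) (Fin n) ℝ, G.det = 1 ∧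
        (∀ a b, |G a b - A a b| < δ) ∧ StrictNondeg i₀ m c G := by
    refine hcpt.induction_on (p := fun s => ∃ c : ℝ, 0 < c ∧ ∀ A ∈ s,
      ∃ G : Matrix (Fin n) (Fin n) ℝ, G.det = 1 ∧
        (∀ a b, |G a b - A a b| < δ) ∧ StrictNondeg i₀ m c G) ?_ ?_ ?_ ?_
    · exact ⟨1, one_pos, fun A hA => absurd hA (notMem_empty A)⟩
    · rintro s t hst ⟨c, hc, h⟩
      exact ⟨c, hc, fun A hA => h A (hst hA)⟩
    · rintro s t ⟨c, hc, h⟩ ⟨d, hd, h'⟩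
      refine ⟨min c d, lt_min hc hd, ?_⟩
      rintro A (hA | hA)
      · obtain ⟨G, hG, hGA, hGc⟩ := h A hA
        exact ⟨G, hG, hGA, fun j hj => (min_le_left _ _).trans_lt (hGc j hj)⟩
      · obtain ⟨G, hG, hGA, hGc⟩ := h' A hA
        exact ⟨G, hG, hGA, fun j hj => (min_le_right _ _).trans_lt (hGc j hj)⟩
    · intro A hA
      obtain ⟨G, c, hc, hG, hGA, hGc⟩ := exists_strictNondeg_close hn i₀ m hA.1
        (δ := δ / 2) (by positivity)
      refine ⟨{A' | ∀ a b, |A' a b - A a b| < δ / 2}, mem_nhdsWithin_of_mem_nhds ?_, c, hc,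
        fun A' hA' => ⟨G, hG, fun a b => ?_, hGc⟩⟩
      · have h := (isOpen_close (k := 1) (fun _ => A) (δ / 2)).preimage
          (f := fun A' : Matrix (Fin n) (Fin n) ℝ => fun _ : Fin 1 => A') (by fun_prop)
        refine mem_of_superset (h.mem_nhds ?_) fun A' hA' => hA' 0
        simp [hδ]
      · have h1 := hGA a b
        have h2 := hA' a b
        rw [abs_lt] at h1 h2 ⊢
        constructor <;> linarith [h1.1, h1.2, h2.1, h2.2]
  obtain ⟨c, hc, h⟩ := key
  exact ⟨c, hc, fun A hA hAK => h A ⟨hA, hAK⟩⟩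

theorem exists_generic_nondeg_close {n : ℕ} (hn : 2 ≤ n) (i₀ : Fin n) (m : ℕ) (K : ℝ) {δ : ℝ}
    (hδ : 0 < δ) : ∃ c : ℝ, 0 < c ∧ c ≤ 1 ∧ ∀ (k : ℕ) (B : Fin k → Matrix (Fin n) (Fin n) ℝ),
      (∀ j, (B j).det = 1) → (∀ j a b, |B j a b| ≤ K) →
      ∃ B' : Fin k → Matrix (Fin n) (Fin n) ℝ, (∀ j, (B' j).det = 1) ∧
        (∀ j a b, |B' j a b - B j a b| < δ) ∧ (∀ j, Nondeg i₀ m c (B' j)) ∧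
        ∀ m : Fin k → Fin n → ℤ, m ≠ 0 → ∀ (i : Fin n) (c : ℤ),
          freq B' m (Pi.single i 1) ≠ c := by
  obtain ⟨c, hc, h⟩ := exists_uniform_strictNondeg hn i₀ m K hδ
  refine ⟨min c 1, lt_min hc one_pos, min_le_right _ _, fun k B hB hBK => ?_⟩
  choose G hG hGB hGc using fun j => h (B j) (hB j) (hBK j)
  have hopen : IsOpen ({B' : Fin k → Matrix (Fin n) (Fin n) ℝ |
      (∀ j a b, |B' j a b - B j a b| < δ)} ∩ {B' | ∀ j, StrictNondeg i₀ m c (B' j)}) := by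
    refine (isOpen_close B δ).inter ?_
    simp only [ofPred_forall]
    exact isOpen_iInter_of_finite fun j =>
      IsOpen.preimage (f := fun p : Fin k → Matrix (Fin n) (Fin n) ℝ => p j) (continuous_apply j)
        (isOpen_strictNondeg i₀ m c)
  obtain ⟨B', hB', hgen⟩ := exists_generic_mem hn (hopen.preimage continuous_subtype_val)
    ⟨⟨G, hG⟩, hGB, hGc⟩
  refine ⟨B'.1, B'.2, hB'.1, fun j l hl1 hlm => ?_, hgen⟩
  exact (min_le_left _ _).trans (hB'.2 j l (Finset.mem_Icc.2 ⟨hl1, hlm⟩)).le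

end LinDiscr
end

noncomputable section
namespace LinDiscr

/-! ### The topology of the space of sequences -/

theorem seminorm_le_of_abs_le {n : ℕ} (N : Seminorm ℝ (Matrix (Fin n) (Fin n) ℝ)) :
    ∃ C : ℝ, 0 < C ∧ ∀ (M : Matrix (Fin n) (Fin n) ℝ) (δ : ℝ), (∀ a b, |M a b| ≤ δ) →
      0 ≤ δ → N M ≤ C * δ := by
  refine ⟨(∑ a, ∑ b, N (Matrix.single a b 1)) + 1, ?_, fun M δ hM hδ => ?_⟩
  · have : 0 ≤ ∑ a, ∑ b, N (Matrix.single a b (1 : ℝ)) :=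
      Finset.sum_nonneg fun a _ => Finset.sum_nonneg fun b _ => apply_nonneg N _
    linarith
  have hsum : ∀ (s : Finset (Fin n)) (f : Fin n → Matrix (Fin n) (Fin n) ℝ),
      N (∑ i ∈ s, f i) ≤ ∑ i ∈ s, N (f i) := fun s f =>
    Finset.le_sum_of_subadditive N (map_zero N).le (map_add_le_add N) s f
  have h1 : N M ≤ ∑ a, ∑ b, N (Matrix.single a b 1) * δ := by
    conv_lhs => rw [Matrix.matrix_eq_sum_single M]
    refine (hsum _ _).trans (Finset.sum_le_sum fun a _ => (hsum _ _).trans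
      (Finset.sum_le_sum fun b _ => ?_))
    have : Matrix.single a b (M a b) = M a b • Matrix.single a b (1 : ℝ) := by
      rw [Matrix.smul_single, smul_eq_mul, mul_one]
    rw [this, map_smul_eq_mul, mul_comm, Real.norm_eq_abs]
    exact mul_le_mul_of_nonneg_left (hM a b) (apply_nonneg N _)
  refine h1.trans ?_
  simp only [← Finset.sum_mul]
  rw [add_mul]
  linarith

theorem abs_le_of_seminorm {n : ℕ} (N : Seminorm ℝ (Matrix (Fin n) (Fin n) ℝ))
    (hN : ∀ M, N M = 0 → M = 0) :
    ∃ C : ℝ, 0 < C ∧ ∀ (M : Matrix (Fin n) (Fin n) ℝ) a b, |M a b| ≤ C * N M := by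
  obtain ⟨C₁, hC₁, h1⟩ := seminorm_le_of_abs_le N
  set f : (Fin n → Fin n → ℝ) → ℝ := fun v => N (Matrix.of v) with hf
  have hfc : Continuous f := by
    refine (LipschitzWith.of_dist_le_mul (K := C₁.toNNReal) fun v w => ?_).continuous
    rw [Real.coe_toNNReal _ hC₁.le, Real.dist_eq]
    refine (abs_sub_map_le_sub N _ _).trans (h1 _ _ (fun a b => ?_) dist_nonneg)
    exact ((norm_le_pi_norm _ b).trans (norm_le_pi_norm (v - w) a)).trans_eq (dist_eq_norm v w).symm
  rcases (Metric.sphere (0 : Fin n → Fin n → ℝ) 1).eq_empty_or_nonempty with he | hne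
  · refine ⟨1, one_pos, fun M a b => ?_⟩
    have hM : M = 0 := by
      by_contra hM
      set w : Fin n → Fin n → ℝ := M with hw
      have hM' : ‖w‖ ≠ 0 := norm_ne_zero_iff.2 hM
      have : ‖w‖⁻¹ • w ∈ Metric.sphere (0 : Fin n → Fin n → ℝ) 1 := by
        rw [mem_sphere_zero_iff_norm, norm_smul, norm_inv, norm_norm, inv_mul_cancel₀ hM']
      rw [he] at this
      exact this
    simp [hM]
  · obtain ⟨v₀, hv₀, hmin⟩ := (isCompact_sphere (0 : Fin n → Fin n → ℝ) 1).exists_isMinOn hne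
      hfc.continuousOn
    have hpos : 0 < f v₀ := by
      refine lt_of_le_of_ne (apply_nonneg N _) fun h => ?_
      have h2 : v₀ = 0 := hN _ h.symm
      rw [h2] at hv₀
      simp at hv₀
    refine ⟨(f v₀)⁻¹, inv_pos.2 hpos, fun M a b => ?_⟩
    set w : Fin n → Fin n → ℝ := M with hw
    have hab : |M a b| ≤ ‖w‖ := (norm_le_pi_norm _ b).trans (norm_le_pi_norm w a)
    refine hab.trans ?_
    rw [inv_mul_eq_div, le_div_iff₀ hpos]
    rcases eq_or_ne w 0 with h0 | h0
    · rw [h0, norm_zero, zero_mul]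
      exact apply_nonneg N _
    · have hn0 : ‖w‖ ≠ 0 := norm_ne_zero_iff.2 h0
      have h3 : ‖w‖⁻¹ • w ∈ Metric.sphere (0 : Fin n → Fin n → ℝ) 1 := by
        rw [mem_sphere_zero_iff_norm, norm_smul, norm_inv, norm_norm, inv_mul_cancel₀ hn0]
      have h4 : f v₀ ≤ f (‖w‖⁻¹ • w) := hmin h3
      have h5 : f (‖w‖⁻¹ • w) = ‖w‖⁻¹ * N M := by
        have : f (‖w‖⁻¹ • w) = N (‖w‖⁻¹ • M) := rfl
        rw [this, map_smul_eq_mul, norm_inv, norm_norm]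
      rw [h5] at h4
      calc ‖w‖ * f v₀ ≤ ‖w‖ * (‖w‖⁻¹ * N M) := by gcongr
        _ = N M := by field_simp

theorem EllInfSL.det_mat {n : ℕ} {N : Seminorm ℝ (Matrix (Fin n) (Fin n) ℝ)} (A : EllInfSL N)
    (j : ℕ) : (A.mat j).det = 1 := (A.1 j).2

theorem EllInfSL.seminorm_sub_le_dist {n : ℕ} {N : Seminorm ℝ (Matrix (Fin n) (Fin n) ℝ)}
    (A B : EllInfSL N) (j : ℕ) : N (A.mat j - B.mat j) ≤ dist A B :=
  le_ciSup (EllInfSL.bddAbove_sub A B) j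

theorem EllInfSL.dist_le {n : ℕ} {N : Seminorm ℝ (Matrix (Fin n) (Fin n) ℝ)}
    {A B : EllInfSL N} {r : ℝ} (h : ∀ j, N (A.mat j - B.mat j) ≤ r) : dist A B ≤ r :=
  ciSup_le h

/-- A dense open set of sequences with a small rate of injectivity in some time. -/
theorem dense_interior_rate_le {n : ℕ} (hn : 2 ≤ n)
    (N : Seminorm ℝ (Matrix (Fin n) (Fin n) ℝ)) (hN : ∀ M, N M = 0 → M = 0) {ε : ℝ} (hε : 0 < ε) :
    Dense (interior {A : EllInfSL N | ∃ k, rate A.mat k ≤ ε}) := by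
  obtain ⟨C₁, hC₁, h1⟩ := seminorm_le_of_abs_le N
  obtain ⟨C₂, hC₂, h2⟩ := abs_le_of_seminorm N hN
  rw [Metric.dense_iff]
  intro A r hr
  obtain ⟨D, hD⟩ := A.2
  set i₀ : Fin n := ⟨0, by omega⟩ with hi₀
  obtain ⟨m, hm⟩ := exists_nat_gt (2 / ε)
  have hm0 : (0 : ℝ) < m := lt_trans (by positivity) hm
  have hm1 : 1 ≤ m := by exact_mod_cast hm0
  set δ : ℝ := r / (2 * C₁) with hδ
  have hδ0 : 0 < δ := by positivity
  obtain ⟨c, hc, hc1, hgen⟩ := exists_generic_nondeg_close hn i₀ m (C₂ * D) hδ0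
  set d : ℝ := c / (2 * ((m : ℝ) + 1) ^ 3) with hd
  have hd0 : 0 < d := by positivity
  obtain ⟨k, hk⟩ := exists_nat_gt (2 / (d * ε))
  obtain ⟨B', hB', hclose, hnd, hfreq⟩ := hgen k (fun j => A.mat (k - 1 - j))
    (fun j => A.det_mat _) (fun j a b => (h2 _ a b).trans (by gcongr; exact hD _))
  set A'm : ℕ → Matrix (Fin n) (Fin n) ℝ := fun j =>
    if h : j < k then B' ⟨k - 1 - j, by omega⟩ else A.mat j with hA'm
  have hA'det : ∀ j, (A'm j).det = 1 := by
    intro j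
    simp only [hA'm]
    split_ifs with h
    · exact hB' _
    · exact A.det_mat j
  have hA'B : ∀ j : Fin k, A'm (k - 1 - j) = B' j := by
    intro j
    have hj := j.2
    simp only [hA'm]
    rw [dif_pos (by omega)]
    congr 1
    ext
    simp only
    omega
  have hA'close : ∀ j, N (A'm j - A.mat j) ≤ r / 2 := by
    intro j
    have : r / 2 = C₁ * δ := by rw [hδ]; field_simp
    rw [this]
    refine h1 _ _ (fun a b => ?_) hδ0.le
    simp only [hA'm]
    split_ifs with h
    · have h3 := hclose ⟨k - 1 - j, by omega⟩ a b
      have h4 : k - 1 - (k - 1 - j) = j := by omega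
      simp only [h4] at h3
      exact h3.le
    · simpa using hδ0.le
  let A' : EllInfSL N := ⟨fun j => ⟨A'm j, hA'det j⟩, D + r / 2, fun j => by
    have h3 : A'm j = A.mat j + (A'm j - A.mat j) := by abel
    show N (A'm j) ≤ _
    rw [h3]
    exact (map_add_le_add N _ _).trans (add_le_add (hD j) (hA'close j))⟩
  have hA'mat : A'.mat = A'm := rfl
  refine ⟨A', ?_, ?_⟩
  · rw [Metric.mem_ball]
    exact (EllInfSL.dist_le hA'close).trans_lt (by linarith)
  · have hvol : cubePow k n {X | ∃ w, Chain 0 k B' w 0 ∧ toTorus X = toTorus w} <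
        ENNReal.ofReal ε := by
      have hsub : {X | ∃ w, Chain 0 k B' w 0 ∧ toTorus X = toTorus w} ⊆
          aliveSet k B' (({0} : Finset (Fin n → ℝ)) : Set (Fin n → ℝ)) := by
        rintro X ⟨w, hw, hX⟩
        obtain ⟨q, rfl⟩ := toTorus_eq_iff.1 hX
        exact ⟨0, by simp, q, hw⟩
      refine lt_of_le_of_lt ((MeasureTheory.measure_mono hsub).trans
        (cubePow_aliveSet_le i₀ hm1 hc hc1 k B' hB' hnd {0})) ?_
      rw [ENNReal.ofReal_lt_ofReal_iff hε, Finset.card_singleton, ← hd]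
      have e1 : ((1 : ℕ) : ℝ) / m < ε / 2 := by
        rw [Nat.cast_one, div_lt_iff₀ hm0]
        rw [div_lt_iff₀ hε] at hm
        linarith
      have e2 : concaveWeight ((1 : ℕ) : ℝ) / (d * (k + 1)) ≤ ε / 2 := by
        rw [div_le_iff₀ (by positivity)]
        rw [div_lt_iff₀ (by positivity)] at hk
        have : concaveWeight ((1 : ℕ) : ℝ) = 1 / 2 := by norm_num [concaveWeight]
        rw [this]
        have h3 : 0 < d * ε := by positivity
        nlinarith
      linarith
    obtain ⟨L, hL, δ', hδ', hcnt⟩ := exists_cnt_range_discrIter_le hB'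
      (fun m hm => ⟨i₀, hfreq m hm i₀⟩) hvol
    rw [mem_interior_iff_mem_nhds, Metric.mem_nhds_iff]
    refine ⟨δ' / C₂, by positivity, fun A'' hA'' => ⟨k, ?_⟩⟩
    refine rate_le_of_upperDensityLE (upperDensityLE_of_cnt_le hL fun z => ?_)
    refine hcnt A''.mat (fun j => A''.det_mat j) (fun j a b => ?_) z
    rw [← hA'B j, ← hA'mat]
    refine (h2 (A''.mat (k - 1 - j) - A'.mat (k - 1 - j)) a b).trans ?_
    have h3 := (EllInfSL.seminorm_sub_le_dist A'' A' (k - 1 - j)).trans (Metric.mem_ball.1 hA'').le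
    rw [le_div_iff₀ hC₂] at h3
    linarith

theorem exists_geometric_bound {τ : ℕ → ℝ} (h1 : ∀ k, τ k ≤ 1) (h0 : Tendsto τ atTop (𝓝 0))
    {l : ℕ} (hl : 1 ≤ l) : ∃ lam : ℝ, 0 < lam ∧ lam < 1 ∧
      ∀ k : ℕ, τ (l * k) ≤ lam ^ k + 1 / (l : ℝ) := by
  have hl1 : (1 : ℝ) ≤ l := by exact_mod_cast hl
  have hl0 : (0 : ℝ) < l := by linarith
  obtain ⟨K, hK⟩ := eventually_atTop.1
    (h0.eventually (gt_mem_nhds (show (0 : ℝ) < 1 / l by positivity)))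
  set x : ℝ := 1 / (l * (K + 2)) with hx
  have hx0 : 0 < x := by positivity
  have hx2 : x ≤ 1 / 2 := by
    rw [hx]
    refine div_le_div_of_nonneg_left zero_le_one (by norm_num) ?_
    have : (0 : ℝ) ≤ K := Nat.cast_nonneg K
    nlinarith
  refine ⟨1 - x, by linarith, by linarith, fun k => ?_⟩
  rcases le_or_gt K k with hk | hk
  · have h2 := hK (l * k) (hk.trans (Nat.le_mul_of_pos_left k (by omega)))
    have h3 : 0 ≤ (1 - x) ^ k := pow_nonneg (by linarith) k
    linarith
  · have h2 := one_add_mul_le_pow (show (-2 : ℝ) ≤ -x by linarith) k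
    rw [← sub_eq_add_neg] at h2
    have h3 : (k : ℝ) * x ≤ 1 / l := by
      have hkK : (k : ℝ) ≤ K + 2 := by
        have : (k : ℝ) ≤ K := by exact_mod_cast hk.le
        linarith
      calc (k : ℝ) * x ≤ (K + 2) * x := by gcongr
        _ = 1 / l := by rw [hx]; field_simp
    have := h1 (l * k)
    linarith

end LinDiscr
end

theorem mainTheorem7 (n : ℕ) (hn : 2 ≤ n)
    (N : Seminorm ℝ (Matrix (Fin n) (Fin n) ℝ)) (hN : ∀ M, N M = 0 → M = 0) :
    (∀ᶠ A in residual (LinDiscr.EllInfSL N),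
      LinDiscr.HasAsymptoticRate A.mat 0 ∧
      ∀ l : ℕ, 1 ≤ l → ∃ lam : ℝ, 0 < lam ∧ lam < 1 ∧
        ∀ k : ℕ, LinDiscr.rate A.mat (l * k) ≤ lam ^ k + 1 / (l : ℝ)) ∧
    (∀ ε : ℝ, 0 < ε → ∃ U : Set (LinDiscr.EllInfSL N), IsOpen U ∧ Dense U ∧
      ∀ A ∈ U, ∃ t : ℝ, LinDiscr.HasAsymptoticRate A.mat t ∧ t < ε) := by
  refine ⟨?_, fun ε hε => ⟨_, isOpen_interior,
    LinDiscr.dense_interior_rate_le hn N hN (half_pos hε), fun A hA => ?_⟩⟩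
  · have hmem : ∀ q : ℕ, interior {A : LinDiscr.EllInfSL N |
        ∃ k, LinDiscr.rate A.mat k ≤ 1 / ((q : ℝ) + 1)} ∈ residual (LinDiscr.EllInfSL N) :=
      fun q => residual_of_dense_open isOpen_interior
        (LinDiscr.dense_interior_rate_le hn N hN (by positivity))
    filter_upwards [countable_iInter_mem.2 hmem] with A hA
    obtain ⟨t, ht, ht0, htle⟩ := LinDiscr.exists_hasAsymptoticRate A.det_mat
    have ht1 : t ≤ 0 := by
      refine ge_of_tendsto' (tendsto_one_div_add_atTop_nhds_zero_nat (𝕜 := ℝ)) fun q => ?_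
      obtain ⟨k, hk⟩ := interior_subset (mem_iInter.1 hA q)
      exact (htle k).trans hk
    have h0 : LinDiscr.HasAsymptoticRate A.mat 0 := by
      rwa [le_antisymm ht1 ht0] at ht
    exact ⟨h0, fun l hl => LinDiscr.exists_geometric_bound (LinDiscr.rate_le_one A.mat) h0 hl⟩
  · obtain ⟨t, ht, _, htle⟩ := LinDiscr.exists_hasAsymptoticRate A.det_mat
    obtain ⟨k, hk⟩ := interior_subset hA
    exact ⟨t, ht, ((htle k).trans hk).trans_lt (half_lt_self hε)⟩
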